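/- **Setting.** For points $X_1,\dots,X_N\in\mathbb R^d$ and $w\in\mathbb R^N$ let $\mu_w=\sum_i w_iX_i$ and $\Sigma_w=\sum_i w_iX_iX_i^\top-\mu_w\mu_w^\top$ (which equals $\sum_i w_i(X_i-\mu_w)(X_i-\mu_w)^\top$ if $\sum_i w_i=1$), and let $\Delta_{N,\epsilon}=\{w:\|w\|_1=1,\ 0\le w_i\le \frac1{(1-\epsilon)N}\ \forall i\}$. The softmax objective is $f(w)=\frac1\rho\ln\operatorname{tr}\exp(\rho\Sigma_w)$ with $\rho=\frac{\ln d}{\epsilon}$. Projected gradient descent with step $1/\beta$ on a set $\mathcal K$ starts from an arbitrary $w_0\in\mathcal K$, iterates $w_{t+1}=\Pi_{\mathcal K}(w_t-\frac1\beta\nabla f(w_t))$, and after $T$ iterations outputs any $w_s$, $0\le s<T$, that minimizes $\|w_{t+1}-w_t\|_2$ over $0\le t<T$. A function is $\beta$-smooth on $\mathcal K$ if it is differentiable at the points of $\mathcal K$ and $\|\nabla f(x)-\nabla f(y)\|_2\le\beta\|x-y\|_2$ for $x,y\in\mathcal K$. An $\epsilon$-corruption of $N$ points replaces at most $\epsilon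 N$ of them by arbitrary points, chosen after inspecting all of them. Preprocessing with radius $R$ takes a coordinate-wise median $m$ of the input points $X_i$, discards every $X_i$ with $\|X_i-m\|_2>R$, and replaces the remaining $N'$ points by $X_i-m$. **Theorem.** (a) *(With high probability.)* There are universal constants $\epsilon_0,C,K_0,A,K_1,K_2,K_3>0$ such that the following holds for all $d\ge2$, $0<\epsilon<\epsilon_0$, $0<\tau<1$, $\mu^\star\in\mathbb R^d$ and $N\ge K_0\,(d+\log(1/\tau))/\epsilon^2$. Put $L=\log(Nd/\tau)$, $R=A\sqrt{dL}$ and $\beta=K_1\frac{Nd^2}{\epsilon}L^3$. Except on an event of (outer) probability at most $\tau$ over $N$ independent samples from $\mathcal N(\mu^\star,I)$, for every $\epsilon$-corruption $X$ of the samples and every coordinate-wise median of $X$, after preprocessing with radius $R$: the set $\Delta_{N',2\epsilon}$ is nonempty; the softmax objective $f$ of the preprocessed points is $\beta$-smooth on $\Delta_{N',2\epsilon}$; $0\le f\le K_2\,d\,L$ on $\Delta_{N',2\epsilon}$; and for every $T\ge K_3\frac{Nd^3}{\epsilon}L^4$, every output $w$ of $T$ iterations of projected gradient descent on $f$ over $\Delta_{N',2\epsilon}$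 with step $1/\beta$ satisfies $\|\mu_w-\mu^\star\|_2\le C\,\epsilon\sqrt{\log(1/\epsilon)}$, where $\mu_w=\sum_i w_iX_i$ is taken over the surviving original points. (b) *(Under deterministic conditions.)* For all $c_1,c_2>0$ there are constants $\epsilon_0,C,K_1,K_2,K_3>0$, depending only on $c_1,c_2$, such that the following holds for all $d\ge2$, $0<\epsilon<\epsilon_0$, $\Lambda\ge1$, $N\ge1$, $\mu^\star\in\mathbb R^d$, all points $X_1,\dots,X_N\in\mathbb R^d$ with $\max_i\|X_i\|_2\le\sqrt{d\Lambda}$, and all sets $G\subseteq[N]$ with $|G|\ge(1-\epsilon)N$. Suppose that for every $w\in\Delta_{N,2\epsilon}$ 1. $\big\|\sum_{i\in G}w_i(X_i-\mu^\star)(X_i-\mu^\star)^\top-I\big\|_2\le c_1\,\epsilon\log(1/\epsilon)$, and 2. for every $\delta\ge0$, $\lambda_{\max}(\Sigma_w)\le1+\delta$ implies $\|\mu^\star-\mu_w\|_2\le c_2\big(\sqrt{\epsilon\delta}+\epsilon\sqrt{\log(1/\epsilon)}\big)$. Put $\beta=K_1\frac{Nd^2}{\epsilon}\,\ln d\cdot\Lambda^2$.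 Then $f$ is $\beta$-smooth on $\Delta_{N,2\epsilon}$, $0\le f\le K_2\,d\,\Lambda$ on $\Delta_{N,2\epsilon}$, and for every $T\ge K_3\frac{Nd^3}{\epsilon}\,\ln d\cdot\Lambda^3$, every output $w$ of $T$ iterations of projected gradient descent on $f$ over $\Delta_{N,2\epsilon}$ with step $1/\beta$ satisfies $\|\mu_w-\mu^\star\|_2\le C\,\epsilon\sqrt{\log(1/\epsilon)}$. -/

import Mathlib

open MeasureTheory ProbabilityTheory
open scoped Matrix

namespace RobustMean

noncomputable section

/-- The set `Δ_{N,ε}` of weight vectors on a finite index type with `N` elements: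
`‖w‖₁ = 1` and `0 ≤ w_i ≤ 1 / ((1 - ε) N)` for every `i`. -/
def weightSet (ι : Type) [Fintype ι] (ε : ℝ) : Set (EuclideanSpace ℝ ι) :=
  {w | ∑ i, |w i| = 1 ∧ ∀ i, 0 ≤ w i ∧ w i ≤ 1 / ((1 - ε) * (Fintype.card ι : ℝ))}

/-- The weighted empirical mean `μ_w = ∑ i, w_i X_i`. -/
def wMean {ι : Type} [Fintype ι] {d : ℕ} (X : ι → EuclideanSpace ℝ (Fin d))
    (w : EuclideanSpace ℝ ι) : EuclideanSpace ℝ (Fin d) :=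
  ∑ i, w i • X i

/-- The outer product `x xᵀ`. -/
def outer {d : ℕ} (x : EuclideanSpace ℝ (Fin d)) : Matrix (Fin d) (Fin d) ℝ :=
  Matrix.vecMulVec (x : Fin d → ℝ) (x : Fin d → ℝ)

/-- The weighted empirical covariance `Σ_w = X diag(w) Xᵀ - X w wᵀ Xᵀ`, that is
`∑ i, w_i X_i X_iᵀ - μ_w μ_wᵀ`. When the weights sum to one, this is
`∑ i, w_i (X_i - μ_w) (X_i - μ_w)ᵀ`; see `wCov_eq`. -/
def wCov {ι : Type} [Fintype ι] {d : ℕ} (X : ι → EuclideanSpace ℝ (Fin d))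
    (w : EuclideanSpace ℝ ι) : Matrix (Fin d) (Fin d) ℝ :=
  ∑ i, w i • outer (X i) - outer (wMean X w)

theorem wCov_eq {ι : Type} [Fintype ι] {d : ℕ} (X : ι → EuclideanSpace ℝ (Fin d))
    (w : EuclideanSpace ℝ ι) (hw : ∑ i, w i = 1) :
    wCov X w = ∑ i, w i • outer (X i - wMean X w) := by
  ext a b
  have key : ∀ c : Fin d, wMean X w c = ∑ i, w i * X i c := by
    intro c
    simp [wMean]
  simp only [wCov, outer, Matrix.sub_apply, Matrix.sum_apply, Matrix.smul_apply,
    Matrix.vecMulVec_apply, smul_eq_mul, PiLp.sub_apply]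
  have h : ∀ i, w i * ((X i a - wMean X w a) * (X i b - wMean X w b))
      = w i * (X i a * X i b) - (w i * X i a) * wMean X w b - wMean X w a * (w i * X i b)
        + w i * (wMean X w a * wMean X w b) := fun i => by ring
  simp only [h, Finset.sum_add_distrib, Finset.sum_sub_distrib, ← Finset.sum_mul,
    ← Finset.mul_sum, ← key, hw]
  ring

/-- The spectral norm of a square real matrix (the operator norm for the Euclidean norm). -/
def specNorm {d : ℕ} (A : Matrix (Fin d) (Fin d) ℝ) : ℝ :=
  ‖Matrix.toEuclideanCLM (n := Fin d) (𝕜 := ℝ) A‖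

/-- The softmax objective `f(w) = smax_ρ(Σ_w) = (1/ρ) ln tr exp(ρ Σ_w)` with `ρ = ln d / ε`. -/
def softmaxObj {ι : Type} [Fintype ι] {d : ℕ} (ε : ℝ) (X : ι → EuclideanSpace ℝ (Fin d))
    (w : EuclideanSpace ℝ ι) : ℝ :=
  1 / (Real.log d / ε) *
    Real.log (Matrix.trace (NormedSpace.exp ((Real.log d / ε) • wCov X w)))

/-- `f` is `β`-smooth on `K`: it is differentiable at the points of `K`, and its gradient is
`β`-Lipschitz there. -/
def SmoothOn {E : Type} [NormedAddCommGroup E] [InnerProductSpace ℝ E] [CompleteSpace E]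
    (f : E → ℝ) (β : ℝ) (K : Set E) : Prop :=
  (∀ x ∈ K, DifferentiableAt ℝ f x) ∧
    ∀ x ∈ K, ∀ y ∈ K, ‖gradient f x - gradient f y‖ ≤ β * ‖x - y‖

/-- A point of `K` nearest to `x`. For a nonempty closed convex `K` in a Hilbert space it exists
and is unique, and `proj K` is the metric projection onto `K`. -/
def proj {E : Type} [NormedAddCommGroup E] (K : Set E) (x : E) : E :=
  Classical.epsilon fun p => p ∈ K ∧ ∀ q ∈ K, ‖x - p‖ ≤ ‖x - q‖

/-- Projected gradient descent on `f` over `K` with step size `η`, started at `w₀`: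
`w_{t+1} = Π_K (w_t - η ∇f(w_t))`. -/
def pgd {E : Type} [NormedAddCommGroup E] [InnerProductSpace ℝ E] [CompleteSpace E]
    (K : Set E) (f : E → ℝ) (η : ℝ) (w₀ : E) : ℕ → E
  | 0 => w₀
  | t + 1 => proj K (pgd K f η w₀ t - η • gradient f (pgd K f η w₀ t))

/-- `w` is an output of `T` iterations of projected gradient descent from some starting point
`w₀ ∈ K`: it is an iterate `w_s` with `s < T` for which `‖w_{s+1} - w_s‖` is minimal among
`0 ≤ t < T`. -/
def IsPGDOutput {E : Type} [NormedAddCommGroup E] [InnerProductSpace ℝ E] [CompleteSpace E]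
    (K : Set E) (f : E → ℝ) (η : ℝ) (T : ℕ) (w : E) : Prop :=
  ∃ w₀ ∈ K, ∃ s < T, w = pgd K f η w₀ s ∧
    ∀ t < T, ‖pgd K f η w₀ (s + 1) - pgd K f η w₀ s‖ ≤ ‖pgd K f η w₀ (t + 1) - pgd K f η w₀ t‖

/-- Strong contamination: `X` is obtained from the sample `Z` of `N` points by replacing at most
`ε N` of them by arbitrary points (and possibly reordering). -/
def IsCorruption {N d : ℕ} (ε : ℝ) (Z X : Fin N → EuclideanSpace ℝ (Fin d)) : Prop :=
  ∃ σ : Equiv.Perm (Fin N), (Set.ncard {i | X i ≠ Z (σ i)} : ℝ) ≤ ε * N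

/-- `m` is a coordinate-wise median of the points `X_i`: in every coordinate at least half of the
points are at most `m`, and at least half of them are at least `m`. -/
def IsCoordMedian {N d : ℕ} (X : Fin N → EuclideanSpace ℝ (Fin d))
    (m : EuclideanSpace ℝ (Fin d)) : Prop :=
  ∀ j, N ≤ 2 * Set.ncard {i | X i j ≤ m j} ∧ N ≤ 2 * Set.ncard {i | m j ≤ X i j}

/-- The indices that survive the preprocessing step: the samples at distance at most `R` from the
centre `m`. -/
abbrev Kept {N d : ℕ} (X : Fin N → EuclideanSpace ℝ (Fin d)) (m : EuclideanSpace ℝ (Fin d))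
    (R : ℝ) : Type :=
  {i : Fin N // ‖X i - m‖ ≤ R}

/-- The preprocessed sample: the surviving points, centred at `m`. -/
def preprocess {N d : ℕ} (X : Fin N → EuclideanSpace ℝ (Fin d)) (m : EuclideanSpace ℝ (Fin d))
    (R : ℝ) : Kept X m R → EuclideanSpace ℝ (Fin d) :=
  fun i => X i - m

/-- The concentration condition on the remaining good samples `G`: for every
`w ∈ Δ_{N,2ε}`, `‖∑_{i ∈ G} w_i (X_i - μ) (X_i - μ)ᵀ - I‖₂ ≤ δ`. -/
def GoodMoments {ι : Type} [Fintype ι] {d : ℕ} (ε δ : ℝ) (X : ι → EuclideanSpace ℝ (Fin d))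
    (G : Finset ι) (μ : EuclideanSpace ℝ (Fin d)) : Prop :=
  ∀ w ∈ weightSet ι (2 * ε), specNorm (∑ i ∈ G, w i • outer (X i - μ) - 1) ≤ δ

/-- The property that a small weighted covariance certifies a good weighted mean: for all
`w ∈ Δ_{N,2ε}` and `δ ≥ 0`, if `λ_max(Σ_w) ≤ 1 + δ` (that is, `Σ_w ⪯ (1 + δ) I`), then
`‖μ - μ_w‖ ≤ c (√(ε δ) + ε √(log (1/ε)))`. -/
def SpectralCertificate {ι : Type} [Fintype ι] {d : ℕ} (ε c : ℝ)
    (X : ι → EuclideanSpace ℝ (Fin d)) (μ : EuclideanSpace ℝ (Fin d)) : Prop :=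
  ∀ w ∈ weightSet ι (2 * ε), ∀ δ : ℝ, 0 ≤ δ →
    ((1 + δ) • (1 : Matrix (Fin d) (Fin d) ℝ) - wCov X w).PosSemidef →
    ‖μ - wMean X w‖ ≤ c * (√(ε * δ) + ε * √(Real.log (1 / ε)))

end

end RobustMean

/-!
Write `Y_w` for the Gibbs state `exp (ρ Σ_w) / tr exp (ρ Σ_w)` of a weight vector `w`, so that
`f(w) - ε ≤ tr (Y_w Σ_w)` and `Σ_w ⪯ f(w) I`. Three facts make the theorem true.

*Smoothness.* Expanding `⟨A - B, Y_A - Y_B⟩` in the eigenbases of two symmetric matrices, with the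
squared overlaps of the bases as weights, every term is of the form `(ln p - ln q) (p - q)` with
`p, q ∈ (0, 1]`, hence at least `(p - q)²`. So the Gibbs map is nonexpansive for the Frobenius
norm (`norm_gibbs_sub_le`). The same expansion gives Gibbs' inequality (`logTrExp_add_inner_le`),
and the two together yield the gradient of `f` and its Lipschitz constant without differentiating
the matrix exponential (`hasGradientAt_softmaxObj`, `norm_softmaxGrad_sub_le`).

*Stationary points are good.* By the descent lemma the shortest of `T` steps has length `O(1/β)`,
so an output `w` satisfies `⟨∇f(w), u - w⟩ ≥ -O(ε)` for all admissible `u`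
(`IsPGDOutput.inner_softmaxGrad_ge`). Taking for `u` the uniform weights on the good points, this
says `f(w) ≤ tr (Y_w Σ_u) + ‖μ_u - μ_w‖² + O(ε)`. Here `tr (Y_w Σ_u) ≤ 1 + O(ε ln (1/ε))`, and the
certificate bounds `‖μ_u - μ_w‖²` by `O(ε² ln (1/ε))` plus `O(ε)` times the excess of `f(w)` over
`1`, which is absorbed for small `ε`. So `λ_max(Σ_w) ≤ f(w) ≤ 1 + O(ε ln (1/ε))`, and the
certificate applied to `w` itself ends the deterministic part (`norm_wMean_sub_le_of_stationary`).

*Gaussian samples satisfy the conditions.* Both deterministic conditions follow from a stability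
property of the uncorrupted sample (`StableSample`): its first two moments are right up to `O(ε)`,
and no `O(ε)` fraction of it carries more than `O(ε ln (1/ε))` of the second moment in any
direction. It suffices to check stability on a half-net of the sphere
(`stableSample_of_half_net`); there the tail part is replaced by the single sum
`∑_j (⟨g_j, v⟩² - 4 ln (1/ε))_+` over the centred sample `g`, so that no union bound over subsets
of the sample is needed, and exponential Markov inequalities give failure probability
`exp (-Ω(N ε²))` in each direction. With high probability the sample also lies in a cube of side
`O(√L)` around the mean. The coordinate-wise median of the corrupted sample then lies in that
cube, and preprocessing discards no good point (`exists_good_of_stableSample`).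
-/

namespace RobustMean

noncomputable section

/-! ### The Frobenius inner product, the softmax of a matrix and its Gibbs state -/

/-- A square matrix as a vector of Euclidean space, so that the norm and the inner product are the
Frobenius ones. -/
def frob {d : ℕ} : Matrix (Fin d) (Fin d) ℝ →ₗ[ℝ] EuclideanSpace ℝ (Fin d × Fin d) where
  toFun A := WithLp.toLp 2 fun p => A p.1 p.2
  map_add' A B := by ext; simp
  map_smul' c A := by ext; simp

@[simp]
lemma frob_apply {d : ℕ} (A : Matrix (Fin d) (Fin d) ℝ) (p : Fin d × Fin d) :
    frob A p = A p.1 p.2 := rfl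

lemma inner_frob {d : ℕ} (A B : Matrix (Fin d) (Fin d) ℝ) :
    inner ℝ (frob A) (frob B) = Matrix.trace (A * Bᵀ) := by
  simp only [PiLp.inner_apply, frob_apply, RCLike.inner_apply, conj_trivial, Matrix.trace,
    Matrix.diag, Matrix.mul_apply, Matrix.transpose_apply, Fintype.sum_prod_type]
  exact Finset.sum_congr rfl fun i _ => Finset.sum_congr rfl fun j _ => mul_comm _ _

lemma inner_frob_vecMulVec {d : ℕ} (A : Matrix (Fin d) (Fin d) ℝ) (x y : Fin d → ℝ) :
    inner ℝ (frob A) (frob (Matrix.vecMulVec x y)) = x ⬝ᵥ A *ᵥ y := by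
  simp only [PiLp.inner_apply, frob_apply, RCLike.inner_apply, conj_trivial, dotProduct,
    Matrix.mulVec, Matrix.vecMulVec_apply, Fintype.sum_prod_type, Finset.mul_sum]
  exact Finset.sum_congr rfl fun i _ => Finset.sum_congr rfl fun j _ => by ring

lemma norm_frob_vecMulVec {d : ℕ} (x y : EuclideanSpace ℝ (Fin d)) :
    ‖frob (Matrix.vecMulVec x y)‖ = ‖x‖ * ‖y‖ := by
  rw [EuclideanSpace.norm_eq, EuclideanSpace.norm_eq, EuclideanSpace.norm_eq,
    ← Real.sqrt_mul (by positivity)]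
  congr 1
  simp [Fintype.sum_prod_type, Matrix.vecMulVec_apply, mul_pow, Finset.sum_mul_sum]

lemma exists_orthogonal_diagonalization {d : ℕ} {A : Matrix (Fin d) (Fin d) ℝ}
    (hA : A.IsHermitian) :
    ∃ (U : Matrix (Fin d) (Fin d) ℝ) (a : Fin d → ℝ), U * Uᵀ = 1 ∧ Uᵀ * U = 1 ∧
      A = U * Matrix.diagonal a * Uᵀ := by
  refine ⟨hA.eigenvectorUnitary, hA.eigenvalues, ?_, ?_, ?_⟩
  · have := Unitary.coe_mul_star_self hA.eigenvectorUnitary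
    simpa [Matrix.star_eq_conjTranspose] using this
  · have := Unitary.coe_star_mul_self hA.eigenvectorUnitary
    simpa [Matrix.star_eq_conjTranspose] using this
  · have := hA.spectral_theorem
    rw [Unitary.conjStarAlgAut_apply] at this
    simpa [Matrix.star_eq_conjTranspose, Function.comp_def] using this

lemma exp_orthogonal_conj {d : ℕ} {U : Matrix (Fin d) (Fin d) ℝ} (a : Fin d → ℝ)
    (h : U * Uᵀ = 1) :
    NormedSpace.exp (U * Matrix.diagonal a * Uᵀ) =
      U * Matrix.diagonal (fun i => Real.exp (a i)) * Uᵀ := by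
  have hU : IsUnit U := IsUnit.of_mul_eq_one _ h
  have hinv : U⁻¹ = Uᵀ := Matrix.inv_eq_right_inv h
  rw [← hinv, Matrix.exp_conj _ _ hU, Matrix.exp_diagonal]
  congr 3
  ext i
  rw [Pi.coe_exp, Real.exp_eq_exp_ℝ]

/-- The squared overlaps `⟨u_i, v_j⟩²` between two orthonormal bases, the columns of `U` and `V`. -/
def overlap {d : ℕ} (U V : Matrix (Fin d) (Fin d) ℝ) (i j : Fin d) : ℝ := ((Uᵀ * V) i j) ^ 2

lemma overlap_nonneg {d : ℕ} (U V : Matrix (Fin d) (Fin d) ℝ) (i j : Fin d) :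
    0 ≤ overlap U V i j := sq_nonneg _

lemma sum_overlap_right {d : ℕ} {U V : Matrix (Fin d) (Fin d) ℝ} (hU : Uᵀ * U = 1)
    (hV : V * Vᵀ = 1) (i : Fin d) : ∑ j, overlap U V i j = 1 := by
  have h : (Uᵀ * V) * (Uᵀ * V)ᵀ = 1 := by
    rw [Matrix.transpose_mul, Matrix.transpose_transpose, Matrix.mul_assoc, ← Matrix.mul_assoc V,
      hV, Matrix.one_mul, hU]
  have := congrFun (congrFun h i) i
  rw [Matrix.mul_apply] at this
  simpa [overlap, sq] using this

lemma overlap_comm {d : ℕ} (U V : Matrix (Fin d) (Fin d) ℝ) (i j : Fin d) :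
    overlap U V i j = overlap V U j i := by
  have : (Uᵀ * V) = (Vᵀ * U)ᵀ := by simp [Matrix.transpose_mul]
  rw [overlap, overlap, this, Matrix.transpose_apply]

lemma sum_overlap_left {d : ℕ} {U V : Matrix (Fin d) (Fin d) ℝ} (hU : U * Uᵀ = 1)
    (hV : Vᵀ * V = 1) (j : Fin d) : ∑ i, overlap U V i j = 1 := by
  simp_rw [overlap_comm U V]
  exact sum_overlap_right hV hU j

lemma inner_frob_conj {d : ℕ} (U V : Matrix (Fin d) (Fin d) ℝ) (p q : Fin d → ℝ) :
    inner ℝ (frob (U * Matrix.diagonal p * Uᵀ)) (frob (V * Matrix.diagonal q * Vᵀ)) =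
      ∑ i, ∑ j, overlap U V i j * (p i * q j) := by
  have h1 : U * Matrix.diagonal p * Uᵀ * (V * Matrix.diagonal q * Vᵀ)ᵀ =
      U * (Matrix.diagonal p * ((Uᵀ * V) * Matrix.diagonal q * Vᵀ)) := by
    simp only [Matrix.transpose_mul, Matrix.transpose_transpose, Matrix.diagonal_transpose,
      Matrix.mul_assoc]
  have h2 : Matrix.diagonal p * ((Uᵀ * V) * Matrix.diagonal q * Vᵀ) * U =
      Matrix.diagonal p * ((Uᵀ * V) * Matrix.diagonal q * (Uᵀ * V)ᵀ) := by
    simp only [Matrix.transpose_mul, Matrix.transpose_transpose, Matrix.mul_assoc]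
  rw [inner_frob, h1, Matrix.trace_mul_comm, h2]
  generalize hW : Uᵀ * V = W
  simp only [Matrix.trace, Matrix.diag, Matrix.diagonal_mul]
  refine Finset.sum_congr rfl fun i _ => ?_
  rw [Matrix.mul_apply, Finset.mul_sum]
  refine Finset.sum_congr rfl fun j _ => ?_
  rw [Matrix.mul_diagonal, Matrix.transpose_apply, overlap, hW]
  ring

lemma sum_sum_overlap_mul_left {d : ℕ} {U V : Matrix (Fin d) (Fin d) ℝ} (hU : Uᵀ * U = 1)
    (hV : V * Vᵀ = 1) (f : Fin d → ℝ) : ∑ i, ∑ j, overlap U V i j * f i = ∑ i, f i := by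
  simp_rw [← Finset.sum_mul, sum_overlap_right hU hV, one_mul]

lemma sum_sum_overlap_mul_right {d : ℕ} {U V : Matrix (Fin d) (Fin d) ℝ} (hU : U * Uᵀ = 1)
    (hV : Vᵀ * V = 1) (f : Fin d → ℝ) : ∑ i, ∑ j, overlap U V i j * f j = ∑ j, f j := by
  rw [Finset.sum_comm]
  simp_rw [← Finset.sum_mul, sum_overlap_left hU hV, one_mul]

lemma inner_frob_conj_self {d : ℕ} {U : Matrix (Fin d) (Fin d) ℝ} (hU : Uᵀ * U = 1)
    (p q : Fin d → ℝ) :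
    inner ℝ (frob (U * Matrix.diagonal p * Uᵀ)) (frob (U * Matrix.diagonal q * Uᵀ)) =
      ∑ i, p i * q i := by
  have : ∀ i j, overlap U U i j = if i = j then 1 else 0 := fun i j => by
    rw [overlap, hU, Matrix.one_apply]
    split_ifs <;> simp
  simp [inner_frob_conj, this]

/-- `ln tr exp A`. -/
def logTrExp {d : ℕ} (A : Matrix (Fin d) (Fin d) ℝ) : ℝ :=
  Real.log (Matrix.trace (NormedSpace.exp A))

/-- The Gibbs state `exp A / tr exp A`, the gradient of `logTrExp` at `A`. -/
def gibbs {d : ℕ} (A : Matrix (Fin d) (Fin d) ℝ) : Matrix (Fin d) (Fin d) ℝ :=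
  (Matrix.trace (NormedSpace.exp A))⁻¹ • NormedSpace.exp A

lemma trace_orthogonal_conj {d : ℕ} {U : Matrix (Fin d) (Fin d) ℝ} (p : Fin d → ℝ)
    (h : Uᵀ * U = 1) : Matrix.trace (U * Matrix.diagonal p * Uᵀ) = ∑ i, p i := by
  rw [Matrix.trace_mul_comm, ← Matrix.mul_assoc, h, Matrix.one_mul, Matrix.trace_diagonal]

/-- The spectral form of a symmetric matrix together with that of its Gibbs state: the eigenvalues
`a` of `A` turn into the probability vector `exp (a i - ln tr exp A)`. -/
lemma exists_spectral_gibbs {d : ℕ} [NeZero d] {A : Matrix (Fin d) (Fin d) ℝ}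
    (hA : A.IsHermitian) :
    ∃ (U : Matrix (Fin d) (Fin d) ℝ) (a : Fin d → ℝ), U * Uᵀ = 1 ∧ Uᵀ * U = 1 ∧
      A = U * Matrix.diagonal a * Uᵀ ∧
      gibbs A = U * Matrix.diagonal (fun i => Real.exp (a i - logTrExp A)) * Uᵀ ∧
      ∑ i, Real.exp (a i - logTrExp A) = 1 ∧ ∀ i, a i ≤ logTrExp A := by
  obtain ⟨U, a, h1, h2, h3⟩ := exists_orthogonal_diagonalization hA
  have htr : Matrix.trace (NormedSpace.exp A) = ∑ i, Real.exp (a i) := by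
    rw [h3, exp_orthogonal_conj a h1, trace_orthogonal_conj _ h2]
  have hpos : 0 < ∑ i, Real.exp (a i) :=
    Finset.sum_pos (fun i _ => Real.exp_pos _) Finset.univ_nonempty
  have hexp : ∀ i, Real.exp (a i - logTrExp A) = (∑ i, Real.exp (a i))⁻¹ * Real.exp (a i) := by
    intro i
    rw [Real.exp_sub, logTrExp, htr, Real.exp_log hpos, div_eq_inv_mul]
  refine ⟨U, a, h1, h2, h3, ?_, ?_, fun i => ?_⟩
  · simp_rw [hexp]
    rw [gibbs, htr]
    conv_lhs => rw [h3, exp_orthogonal_conj a h1]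
    rw [← Matrix.smul_mul, ← Matrix.mul_smul, ← Matrix.diagonal_smul]
    rfl
  · simp_rw [hexp]
    rw [← Finset.mul_sum, inv_mul_cancel₀ hpos.ne']
  · rw [logTrExp, htr, Real.le_log_iff_exp_le hpos]
    exact Finset.single_le_sum (f := fun i => Real.exp (a i)) (fun i _ => (Real.exp_pos _).le)
      (Finset.mem_univ i)

/-- Gibbs' inequality `tr Y (ln Y - ln Y') ≥ 0` for two Gibbs states: `logTrExp` lies above its
tangents. -/
lemma logTrExp_add_inner_le {d : ℕ} [NeZero d] {A B : Matrix (Fin d) (Fin d) ℝ}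
    (hA : A.IsHermitian) (hB : B.IsHermitian) :
    logTrExp A + inner ℝ (frob (gibbs A)) (frob B - frob A) ≤ logTrExp B := by
  obtain ⟨U, a, hU1, hU2, hA', hYA, hsA, hle⟩ := exists_spectral_gibbs hA
  obtain ⟨V, b, hV1, hV2, hB', hYB, hsB, hleB⟩ := exists_spectral_gibbs hB
  set α := logTrExp A
  set β := logTrExp B
  have e1 : inner ℝ (frob (gibbs A)) (frob B) =
      ∑ i, ∑ j, overlap U V i j * (Real.exp (a i - α) * b j) := by
    rw [hYA, hB', inner_frob_conj]
  have rowsum := sum_sum_overlap_mul_left hU2 hV1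
  have colsum := sum_sum_overlap_mul_right hU1 hV2
  have e2 : inner ℝ (frob (gibbs A)) (frob A) =
      ∑ i, ∑ j, overlap U V i j * (Real.exp (a i - α) * a i) := by
    rw [rowsum fun i => Real.exp (a i - α) * a i, hYA, congrArg frob hA',
      inner_frob_conj_self hU2]
  have key : ∑ i, ∑ j, overlap U V i j * (Real.exp (a i - α) - Real.exp (b j - β)) ≤
      ∑ i, ∑ j, overlap U V i j * (Real.exp (a i - α) * ((a i - α) - (b j - β))) := by
    refine Finset.sum_le_sum fun i _ => Finset.sum_le_sum fun j _ =>
      mul_le_mul_of_nonneg_left ?_ (overlap_nonneg _ _ _ _)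
    have h := Real.add_one_le_exp ((b j - β) - (a i - α))
    have h2 : Real.exp (b j - β) = Real.exp (a i - α) * Real.exp ((b j - β) - (a i - α)) := by
      rw [← Real.exp_add]; ring_nf
    rw [h2]
    nlinarith [Real.exp_pos (a i - α)]
  have l1 : ∑ i, ∑ j, overlap U V i j * (Real.exp (a i - α) - Real.exp (b j - β)) = 0 := by
    simp_rw [mul_sub, Finset.sum_sub_distrib]
    rw [rowsum fun i => Real.exp (a i - α), colsum fun j => Real.exp (b j - β), hsA, hsB, sub_self]
  have l2 : ∑ i, ∑ j, overlap U V i j * (Real.exp (a i - α) * ((a i - α) - (b j - β))) =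
      inner ℝ (frob (gibbs A)) (frob A) - inner ℝ (frob (gibbs A)) (frob B) + (β - α) := by
    rw [e1, e2, ← Finset.sum_sub_distrib]
    have : β - α = ∑ i, ∑ j, overlap U V i j * (Real.exp (a i - α) * (β - α)) := by
      rw [rowsum fun i => Real.exp (a i - α) * (β - α), ← Finset.sum_mul, hsA, one_mul]
    rw [this]
    clear this
    rw [← Finset.sum_add_distrib]
    refine Finset.sum_congr rfl fun i _ => ?_
    rw [← Finset.sum_sub_distrib, ← Finset.sum_add_distrib]
    refine Finset.sum_congr rfl fun j _ => ?_
    ring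
  rw [inner_sub_right]
  linarith

/-- The Gibbs map is firmly nonexpansive for the Frobenius norm: in the double spectral sum of
`⟨A - B, Y_A - Y_B⟩` every term has the form `(ln p - ln q) (p - q) ≥ (p - q)²` with
`p, q ∈ (0, 1]`. -/
lemma norm_gibbs_sub_sq_le {d : ℕ} [NeZero d] {A B : Matrix (Fin d) (Fin d) ℝ}
    (hA : A.IsHermitian) (hB : B.IsHermitian) :
    ‖frob (gibbs A) - frob (gibbs B)‖ ^ 2 ≤
      inner ℝ (frob A - frob B) (frob (gibbs A) - frob (gibbs B)) := by
  obtain ⟨U, a, hU1, hU2, hA', hYA, hsA, hle⟩ := exists_spectral_gibbs hA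
  obtain ⟨V, b, hV1, hV2, hB', hYB, hsB, hleB⟩ := exists_spectral_gibbs hB
  set α := logTrExp A
  set β := logTrExp B
  have rowsum := sum_sum_overlap_mul_left hU2 hV1
  have colsum := sum_sum_overlap_mul_right hU1 hV2
  -- Both sides are instances of one bilinear identity for functions of the two spectra.
  have gen : ∀ p q r s : Fin d → ℝ,
      inner ℝ (frob (U * Matrix.diagonal p * Uᵀ) - frob (V * Matrix.diagonal q * Vᵀ))
        (frob (U * Matrix.diagonal r * Uᵀ) - frob (V * Matrix.diagonal s * Vᵀ)) =
      ∑ i, ∑ j, overlap U V i j * ((p i - q j) * (r i - s j)) := by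
    intro p q r s
    simp only [inner_sub_left, inner_sub_right]
    rw [inner_frob_conj_self hU2, inner_frob_conj_self hV2,
      real_inner_comm (frob (U * Matrix.diagonal r * Uᵀ)), inner_frob_conj, inner_frob_conj]
    rw [← rowsum fun i => p i * r i, ← colsum fun j => q j * s j]
    simp only [← Finset.sum_sub_distrib]
    refine Finset.sum_congr rfl fun i _ => Finset.sum_congr rfl fun j _ => ?_
    ring
  have hlin : inner ℝ (frob A - frob B) (frob (gibbs A) - frob (gibbs B)) =
      ∑ i, ∑ j, overlap U V i j * (((a i - α) - (b j - β)) *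
        (Real.exp (a i - α) - Real.exp (b j - β))) := by
    have h0 : ∑ i, ∑ j, overlap U V i j * ((β - α) *
        (Real.exp (a i - α) - Real.exp (b j - β))) = 0 := by
      simp_rw [mul_sub (β - α), mul_sub, Finset.sum_sub_distrib]
      rw [rowsum fun i => (β - α) * Real.exp (a i - α),
        colsum fun j => (β - α) * Real.exp (b j - β), ← Finset.mul_sum, ← Finset.mul_sum, hsA, hsB,
        sub_self]
    rw [hYA, hYB, congrArg frob hA', congrArg frob hB', gen, ← add_zero (∑ i, _), ← h0,
      ← Finset.sum_add_distrib]
    refine Finset.sum_congr rfl fun i _ => ?_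
    rw [← Finset.sum_add_distrib]
    refine Finset.sum_congr rfl fun j _ => ?_
    ring
  rw [hlin, ← real_inner_self_eq_norm_sq, hYA, hYB, gen]
  refine Finset.sum_le_sum fun i _ => Finset.sum_le_sum fun j _ =>
    mul_le_mul_of_nonneg_left ?_ (overlap_nonneg _ _ _ _)
  have mono : ∀ x y : ℝ, x ≤ y → Real.exp y ≤ 1 →
      (Real.exp x - Real.exp y) * (Real.exp x - Real.exp y) ≤
        (x - y) * (Real.exp x - Real.exp y) := by
    intro x y hxy hy
    have h1 : Real.exp x ≤ Real.exp y := Real.exp_le_exp.2 hxy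
    have h2 : Real.exp y - Real.exp x ≤ y - x := by
      have h := Real.add_one_le_exp (x - y)
      have h3 : Real.exp x = Real.exp y * Real.exp (x - y) := by rw [← Real.exp_add]; ring_nf
      rw [h3]
      nlinarith [Real.exp_pos y]
    nlinarith
  rcases le_total (a i - α) (b j - β) with h | h
  · exact mono _ _ h (Real.exp_le_one_iff.2 (sub_nonpos.2 (hleB j)))
  · have := mono _ _ h (Real.exp_le_one_iff.2 (sub_nonpos.2 (hle i)))
    linarith

lemma norm_gibbs_sub_le {d : ℕ} [NeZero d] {A B : Matrix (Fin d) (Fin d) ℝ}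
    (hA : A.IsHermitian) (hB : B.IsHermitian) :
    ‖frob (gibbs A) - frob (gibbs B)‖ ≤ ‖frob A - frob B‖ := by
  have h := (norm_gibbs_sub_sq_le hA hB).trans (real_inner_le_norm _ _)
  by_contra! hlt
  nlinarith [norm_nonneg (frob A - frob B)]

lemma norm_gibbs_le_one {d : ℕ} [NeZero d] {A : Matrix (Fin d) (Fin d) ℝ}
    (hA : A.IsHermitian) : ‖frob (gibbs A)‖ ≤ 1 := by
  obtain ⟨U, a, hU1, hU2, hA', hYA, hsA, hle⟩ := exists_spectral_gibbs hA
  have : ‖frob (gibbs A)‖ ^ 2 ≤ 1 := by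
    rw [← real_inner_self_eq_norm_sq, hYA, inner_frob_conj_self hU2, ← hsA]
    refine Finset.sum_le_sum fun i _ => mul_le_of_le_one_left (Real.exp_pos _).le ?_
    exact Real.exp_le_one_iff.2 (sub_nonpos.2 (hle i))
  nlinarith [norm_nonneg (frob (gibbs A))]

lemma posSemidef_gibbs {d : ℕ} [NeZero d] {A : Matrix (Fin d) (Fin d) ℝ}
    (hA : A.IsHermitian) : (gibbs A).PosSemidef := by
  obtain ⟨U, a, hU1, hU2, hA', hYA, hsA, hle⟩ := exists_spectral_gibbs hA
  rw [hYA]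
  have := (Matrix.PosSemidef.diagonal (n := Fin d) (R := ℝ)
    (d := fun i => Real.exp (a i - logTrExp A)) fun i => (Real.exp_pos _).le)
  simpa using this.mul_mul_conjTranspose_same U

lemma trace_gibbs {d : ℕ} [NeZero d] {A : Matrix (Fin d) (Fin d) ℝ}
    (hA : A.IsHermitian) : (gibbs A).trace = 1 := by
  obtain ⟨U, a, hU1, hU2, hA', hYA, hsA, hle⟩ := exists_spectral_gibbs hA
  rw [hYA, trace_orthogonal_conj _ hU2, hsA]

/-- `λ_max(A) ≤ ln tr exp A`. -/
lemma posSemidef_logTrExp_smul_one_sub {d : ℕ} [NeZero d] {A : Matrix (Fin d) (Fin d) ℝ}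
    (hA : A.IsHermitian) : (logTrExp A • (1 : Matrix (Fin d) (Fin d) ℝ) - A).PosSemidef := by
  obtain ⟨U, a, hU1, hU2, hA', hYA, hsA, hle⟩ := exists_spectral_gibbs hA
  have h : logTrExp A • (1 : Matrix (Fin d) (Fin d) ℝ) - A =
      U * Matrix.diagonal (fun i => logTrExp A - a i) * Uᵀ := by
    have : Matrix.diagonal (fun i => logTrExp A - a i) =
        logTrExp A • (1 : Matrix (Fin d) (Fin d) ℝ) - Matrix.diagonal a := by
      ext i j
      by_cases hij : i = j <;> simp [hij]
    rw [this, Matrix.mul_sub, Matrix.sub_mul, ← hA', Matrix.mul_smul, Matrix.mul_one,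
      Matrix.smul_mul, hU1]
  rw [h]
  have := (Matrix.PosSemidef.diagonal (n := Fin d) (R := ℝ)
    (d := fun i => logTrExp A - a i) fun i => ?_)
  · simpa using this.mul_mul_conjTranspose_same U
  · simpa using hle i

lemma logTrExp_zero {d : ℕ} : logTrExp (0 : Matrix (Fin d) (Fin d) ℝ) = Real.log d := by
  simp [logTrExp, NormedSpace.exp_zero]

/-- The entropy of a Gibbs state is at most `ln d`. -/
lemma logTrExp_le {d : ℕ} [NeZero d] {A : Matrix (Fin d) (Fin d) ℝ} (hA : A.IsHermitian) :
    logTrExp A ≤ inner ℝ (frob (gibbs A)) (frob A) + Real.log d := by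
  have := logTrExp_add_inner_le hA (Matrix.isHermitian_zero (n := Fin d) (α := ℝ))
  rw [logTrExp_zero, map_zero, zero_sub, inner_neg_right] at this
  linarith

/-- The first-order expansion of `logTrExp` is exact up to a quadratic error. -/
lemma abs_logTrExp_sub_sub_inner_le {d : ℕ} [NeZero d] {A B : Matrix (Fin d) (Fin d) ℝ}
    (hA : A.IsHermitian) (hB : B.IsHermitian) :
    |logTrExp B - logTrExp A - inner ℝ (frob (gibbs A)) (frob B - frob A)| ≤
      ‖frob B - frob A‖ ^ 2 := by
  have h1 := logTrExp_add_inner_le hA hB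
  have h2 := logTrExp_add_inner_le hB hA
  have h3 : inner ℝ (frob (gibbs B) - frob (gibbs A)) (frob B - frob A) ≤
      ‖frob B - frob A‖ ^ 2 := by
    refine (real_inner_le_norm _ _).trans ?_
    rw [sq]
    gcongr
    exact norm_gibbs_sub_le hB hA
  rw [← neg_sub (frob B), inner_neg_right] at h2
  rw [inner_sub_left] at h3
  rw [abs_le]
  constructor <;> nlinarith [sq_nonneg ‖frob B - frob A‖]

/-! ### The gradient of the softmax objective -/

section Softmax

variable {ι : Type} [Fintype ι] {d : ℕ}

/-- The rank-one matrix `x yᵀ`. -/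
def outer₂ (x y : EuclideanSpace ℝ (Fin d)) : Matrix (Fin d) (Fin d) ℝ :=
  Matrix.vecMulVec (x : Fin d → ℝ) (y : Fin d → ℝ)

lemma outer_eq_outer₂ (x : EuclideanSpace ℝ (Fin d)) : outer x = outer₂ x x := rfl

lemma outer₂_apply (x y : EuclideanSpace ℝ (Fin d)) (a b : Fin d) :
    outer₂ x y a b = x a * y b := rfl

lemma norm_frob_outer₂ (x y : EuclideanSpace ℝ (Fin d)) : ‖frob (outer₂ x y)‖ = ‖x‖ * ‖y‖ :=
  norm_frob_vecMulVec x y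

lemma wMean_sub (X : ι → EuclideanSpace ℝ (Fin d)) (u w : EuclideanSpace ℝ ι) :
    wMean X (u - w) = wMean X u - wMean X w := by
  simp [wMean, sub_smul]

lemma wMean_apply (X : ι → EuclideanSpace ℝ (Fin d)) (w : EuclideanSpace ℝ ι) (a : Fin d) :
    wMean X w a = ∑ i, w i * X i a := by
  simp [wMean]

lemma norm_wMean_le {X : ι → EuclideanSpace ℝ (Fin d)} {M : ℝ} (hX : ∀ i, ‖X i‖ ≤ M)
    (w : EuclideanSpace ℝ ι) : ‖wMean X w‖ ≤ M * ∑ i, |w i| := by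
  rw [wMean, Finset.mul_sum]
  refine (norm_sum_le _ _).trans (Finset.sum_le_sum fun i _ => ?_)
  rw [norm_smul, Real.norm_eq_abs, mul_comm]
  exact mul_le_mul_of_nonneg_right (hX i) (abs_nonneg _)

lemma frob_wCov (X : ι → EuclideanSpace ℝ (Fin d)) (w : EuclideanSpace ℝ ι) :
    frob (wCov X w) = ∑ i, w i • frob (outer (X i)) - frob (outer (wMean X w)) := by
  simp [wCov]

lemma isHermitian_wCov (X : ι → EuclideanSpace ℝ (Fin d)) (w : EuclideanSpace ℝ ι) :
    (wCov X w).IsHermitian := by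
  ext a b
  simp [wCov, outer, Matrix.sum_apply, Matrix.vecMulVec_apply, mul_comm]

lemma isHermitian_smul_wCov (ρ : ℝ) (X : ι → EuclideanSpace ℝ (Fin d))
    (w : EuclideanSpace ℝ ι) : (ρ • wCov X w).IsHermitian := by
  rw [Matrix.IsHermitian, Matrix.conjTranspose_smul, isHermitian_wCov]
  simp

lemma norm_frob_outer (x : EuclideanSpace ℝ (Fin d)) : ‖frob (outer x)‖ = ‖x‖ ^ 2 := by
  rw [outer_eq_outer₂, norm_frob_outer₂, sq]

lemma outer_sub_outer (x y : EuclideanSpace ℝ (Fin d)) :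
    outer x - outer y = outer₂ (x - y) x + outer₂ y (x - y) := by
  ext a b
  simp only [outer_eq_outer₂, Matrix.sub_apply, Matrix.add_apply, outer₂_apply, PiLp.sub_apply]
  ring

lemma sum_abs_le_sqrt_card_mul_norm (w : EuclideanSpace ℝ ι) :
    ∑ i, |w i| ≤ √(Fintype.card ι) * ‖w‖ := by
  rw [EuclideanSpace.norm_eq, ← Real.sqrt_mul (by positivity)]
  apply Real.le_sqrt_of_sq_le
  simpa using sq_sum_le_card_mul_sum_sq (s := Finset.univ) (f := fun i => |w i|)

lemma norm_le_sqrt_card_mul {w : EuclideanSpace ℝ ι} {c : ℝ} (hc : 0 ≤ c) (h : ∀ i, |w i| ≤ c) :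
    ‖w‖ ≤ √(Fintype.card ι) * c := by
  rw [EuclideanSpace.norm_eq]
  apply Real.sqrt_le_iff.2 ⟨by positivity, ?_⟩
  rw [mul_pow, Real.sq_sqrt (by positivity)]
  calc ∑ i, ‖w i‖ ^ 2 ≤ ∑ _i : ι, c ^ 2 := Finset.sum_le_sum fun i _ => by
        rw [Real.norm_eq_abs]
        exact pow_le_pow_left₀ (abs_nonneg _) (h i) 2
    _ = _ := by simp

/-- The Gibbs state `exp (ρ Σ_w) / tr exp (ρ Σ_w)` attached to a weight vector, `ρ = ln d / ε`. -/
def covGibbs (ε : ℝ) (X : ι → EuclideanSpace ℝ (Fin d)) (w : EuclideanSpace ℝ ι) :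
    Matrix (Fin d) (Fin d) ℝ :=
  gibbs ((Real.log d / ε) • wCov X w)

/-- The gradient of the softmax objective: its `i`-th coordinate is `X_iᵀ Y X_i - 2 X_iᵀ Y μ_w`,
where `Y` is the Gibbs state of `w`. -/
def softmaxGrad (ε : ℝ) (X : ι → EuclideanSpace ℝ (Fin d)) (w : EuclideanSpace ℝ ι) :
    EuclideanSpace ℝ ι :=
  WithLp.toLp 2 fun i => inner ℝ (frob (covGibbs ε X w)) (frob (outer (X i))) -
    2 * inner ℝ (frob (covGibbs ε X w)) (frob (outer₂ (X i) (wMean X w)))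

lemma frob_outer₂_wMean (X : ι → EuclideanSpace ℝ (Fin d)) (h : EuclideanSpace ℝ ι)
    (y : EuclideanSpace ℝ (Fin d)) :
    frob (outer₂ (wMean X h) y) = ∑ i, h i • frob (outer₂ (X i) y) := by
  ext p
  simp [outer₂_apply, wMean_apply, Finset.sum_mul, mul_assoc]

lemma inner_frob_outer₂_comm {A : Matrix (Fin d) (Fin d) ℝ} (hA : A.IsHermitian)
    (x y : EuclideanSpace ℝ (Fin d)) :
    inner ℝ (frob A) (frob (outer₂ x y)) = inner ℝ (frob A) (frob (outer₂ y x)) := by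
  have h : Aᵀ = A := hA
  rw [outer₂, outer₂, inner_frob_vecMulVec, inner_frob_vecMulVec, Matrix.dotProduct_mulVec,
    ← Matrix.mulVec_transpose, h, dotProduct_comm]

/-- The gradient in terms of covariances. The mean term comes from the concavity of
`w ↦ -μ_w μ_wᵀ`; it is what makes the objective nonconvex. -/
lemma inner_softmaxGrad [NeZero d] (ε : ℝ) (X : ι → EuclideanSpace ℝ (Fin d))
    (u w : EuclideanSpace ℝ ι) :
    inner ℝ (softmaxGrad ε X w) (u - w) =
      inner ℝ (frob (covGibbs ε X w)) (frob (wCov X u) - frob (wCov X w)) +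
        inner ℝ (frob (covGibbs ε X w)) (frob (outer (wMean X u - wMean X w))) := by
  have hY : (covGibbs ε X w).IsHermitian := (posSemidef_gibbs (isHermitian_smul_wCov _ X w)).1
  set Y := covGibbs ε X w with hYdef
  set h := u - w with hh
  have h1 : inner ℝ (softmaxGrad ε X w) h =
      inner ℝ (frob Y) (∑ i, h i • frob (outer (X i))) -
        2 * inner ℝ (frob Y) (frob (outer₂ (wMean X h) (wMean X w))) := by
    rw [frob_outer₂_wMean]
    simp only [PiLp.inner_apply (𝕜 := ℝ) (ι := ι), softmaxGrad, RCLike.inner_apply, conj_trivial,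
      inner_sum, inner_smul_right, Finset.mul_sum, ← Finset.sum_sub_distrib]
    refine Finset.sum_congr rfl fun i _ => ?_
    rw [← hYdef]
    ring
  have h2 : ∑ i, h i • frob (outer (X i)) = frob (wCov X u) - frob (wCov X w) +
      (frob (outer (wMean X u)) - frob (outer (wMean X w))) := by
    simp only [frob_wCov, hh, PiLp.sub_apply, sub_smul, Finset.sum_sub_distrib]
    abel
  have h3 : ∀ x y : EuclideanSpace ℝ (Fin d),
      inner ℝ (frob Y) (frob (outer x) - frob (outer y)) -
        2 * inner ℝ (frob Y) (frob (outer₂ (x - y) y)) =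
      inner ℝ (frob Y) (frob (outer (x - y))) := by
    intro x y
    have e1 : frob (outer x) - frob (outer y) - frob (outer₂ (x - y) y) =
        frob (outer (x - y)) + frob (outer₂ y (x - y)) := by
      ext p
      simp only [outer_eq_outer₂, PiLp.sub_apply, PiLp.add_apply, frob_apply, outer₂_apply]
      ring
    have e2 := congrArg (fun z => inner ℝ (frob Y) z) e1
    simp only [inner_sub_right, inner_add_right] at e2
    have e3 := inner_frob_outer₂_comm hY (x - y) y
    rw [inner_sub_right]
    linarith
  have h4 := h3 (wMean X u) (wMean X w)
  rw [h1, h2, inner_add_right, hh, wMean_sub, ← h4]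
  ring

lemma softmaxObj_eq (ε : ℝ) (X : ι → EuclideanSpace ℝ (Fin d)) (w : EuclideanSpace ℝ ι) :
    softmaxObj ε X w = 1 / (Real.log d / ε) * logTrExp ((Real.log d / ε) • wCov X w) := rfl

lemma abs_softmaxObj_sub_sub_inner_le [NeZero d] {ε : ℝ} (hρ : 0 < Real.log d / ε)
    (X : ι → EuclideanSpace ℝ (Fin d)) (u w : EuclideanSpace ℝ ι) :
    |softmaxObj ε X u - softmaxObj ε X w -
      inner ℝ (frob (covGibbs ε X w)) (frob (wCov X u) - frob (wCov X w))| ≤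
      Real.log d / ε * ‖frob (wCov X u) - frob (wCov X w)‖ ^ 2 := by
  have h := abs_logTrExp_sub_sub_inner_le (isHermitian_smul_wCov (Real.log d / ε) X w)
    (isHermitian_smul_wCov (Real.log d / ε) X u)
  rw [softmaxObj_eq, softmaxObj_eq, covGibbs]
  set ρ := Real.log d / ε
  rw [map_smul, map_smul, ← smul_sub, inner_smul_right, norm_smul, Real.norm_eq_abs,
    abs_of_pos hρ] at h
  have e : 1 / ρ * logTrExp (ρ • wCov X u) - 1 / ρ * logTrExp (ρ • wCov X w) -
      inner ℝ (frob (gibbs (ρ • wCov X w))) (frob (wCov X u) - frob (wCov X w)) =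
      1 / ρ * (logTrExp (ρ • wCov X u) - logTrExp (ρ • wCov X w) -
        ρ * inner ℝ (frob (gibbs (ρ • wCov X w))) (frob (wCov X u) - frob (wCov X w))) := by
    field_simp
  rw [e, abs_mul, abs_of_pos (by positivity : 0 < 1 / ρ)]
  calc _ ≤ 1 / ρ * (ρ * ‖frob (wCov X u) - frob (wCov X w)‖) ^ 2 := by gcongr
    _ = _ := by field_simp

lemma differentiable_frob_wCov (X : ι → EuclideanSpace ℝ (Fin d)) :
    Differentiable ℝ fun w : EuclideanSpace ℝ ι => frob (wCov X w) := by
  rw [differentiable_euclidean]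
  intro p
  simp only [frob_apply, wCov, outer, Matrix.sub_apply, Matrix.sum_apply, Matrix.smul_apply,
    Matrix.vecMulVec_apply, wMean_apply]
  fun_prop

lemma hasGradientAt_softmaxObj [NeZero d] {ε : ℝ} (hρ : 0 < Real.log d / ε)
    (X : ι → EuclideanSpace ℝ (Fin d)) (w : EuclideanSpace ℝ ι) :
    HasGradientAt (softmaxObj ε X) (softmaxGrad ε X w) w := by
  rw [hasGradientAt_iff_isLittleO]
  have hsq : (fun u : EuclideanSpace ℝ ι => ‖u - w‖ ^ 2) =o[nhds w] fun u => u - w := by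
    have ht : Filter.Tendsto (fun u : EuclideanSpace ℝ ι => u - w) (nhds w) (nhds 0) := by
      have : Continuous fun u : EuclideanSpace ℝ ι => u - w := by fun_prop
      simpa using this.tendsto w
    exact (Asymptotics.isLittleO_norm_pow_id one_lt_two).comp_tendsto ht
  have hS := (differentiable_frob_wCov X w).isBigO_sub
  have hX : ∀ i, ‖X i‖ ≤ ∑ j, ‖X j‖ := fun i =>
    Finset.single_le_sum (f := fun j => ‖X j‖) (fun j _ => norm_nonneg _) (Finset.mem_univ i)
  have hμ : (fun u => wMean X u - wMean X w) =O[nhds w] fun u => u - w := by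
    refine Asymptotics.IsBigO.of_bound ((∑ j, ‖X j‖) * √(Fintype.card ι))
      (Filter.Eventually.of_forall fun u => ?_)
    rw [← wMean_sub, mul_assoc]
    exact (norm_wMean_le hX _).trans (mul_le_mul_of_nonneg_left
      (sum_abs_le_sqrt_card_mul_norm _) (Finset.sum_nonneg fun j _ => norm_nonneg _))
  have h1 : (fun u => softmaxObj ε X u - softmaxObj ε X w -
      inner ℝ (frob (covGibbs ε X w)) (frob (wCov X u) - frob (wCov X w)))
      =o[nhds w] fun u => u - w := by
    refine Asymptotics.IsBigO.trans_isLittleO (Asymptotics.IsBigO.of_bound (Real.log d / ε)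
      (Filter.Eventually.of_forall fun u => ?_)) ((hS.norm_norm.pow 2).trans_isLittleO hsq)
    rw [Real.norm_eq_abs]
    simpa using abs_softmaxObj_sub_sub_inner_le hρ X u w
  have h2 : (fun u => inner ℝ (frob (covGibbs ε X w)) (frob (outer (wMean X u - wMean X w))))
      =o[nhds w] fun u => u - w := by
    refine Asymptotics.IsBigO.trans_isLittleO (Asymptotics.IsBigO.of_bound ‖frob (covGibbs ε X w)‖
      (Filter.Eventually.of_forall fun u => ?_)) ((hμ.norm_norm.pow 2).trans_isLittleO hsq)
    refine (norm_inner_le_norm _ _).trans ?_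
    rw [norm_frob_outer]
    simp
  refine (h1.sub h2).congr_left fun u => ?_
  rw [inner_softmaxGrad]
  ring

lemma gradient_softmaxObj [NeZero d] {ε : ℝ} (hρ : 0 < Real.log d / ε)
    (X : ι → EuclideanSpace ℝ (Fin d)) (w : EuclideanSpace ℝ ι) :
    gradient (softmaxObj ε X) w = softmaxGrad ε X w :=
  (hasGradientAt_softmaxObj hρ X w).gradient

lemma norm_frob_wCov_sub_le {X : ι → EuclideanSpace ℝ (Fin d)} {M : ℝ} (hM : 0 ≤ M)
    (hX : ∀ i, ‖X i‖ ≤ M) {u w : EuclideanSpace ℝ ι} (hu : ∑ i, |u i| = 1)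
    (hw : ∑ i, |w i| = 1) :
    ‖frob (wCov X u) - frob (wCov X w)‖ ≤ 3 * M ^ 2 * ∑ i, |u i - w i| := by
  have hμ : ∀ v : EuclideanSpace ℝ ι, ∑ i, |v i| = 1 → ‖wMean X v‖ ≤ M := fun v hv => by
    simpa [hv] using norm_wMean_le hX v
  have hμ' : ‖wMean X u - wMean X w‖ ≤ M * ∑ i, |u i - w i| := by
    simpa [wMean_sub] using norm_wMean_le hX (u - w)
  have e : frob (wCov X u) - frob (wCov X w) = ∑ i, (u i - w i) • frob (outer (X i)) -
      (frob (outer₂ (wMean X u - wMean X w) (wMean X u)) +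
        frob (outer₂ (wMean X w) (wMean X u - wMean X w))) := by
    rw [← map_add, ← outer_sub_outer, map_sub, frob_wCov, frob_wCov]
    simp only [sub_smul, Finset.sum_sub_distrib]
    abel
  have b1 : ‖∑ i, (u i - w i) • frob (outer (X i))‖ ≤ M ^ 2 * ∑ i, |u i - w i| := by
    rw [Finset.mul_sum]
    refine (norm_sum_le _ _).trans (Finset.sum_le_sum fun i _ => ?_)
    rw [norm_smul, Real.norm_eq_abs, norm_frob_outer, mul_comm]
    exact mul_le_mul_of_nonneg_right (pow_le_pow_left₀ (norm_nonneg _) (hX i) 2) (abs_nonneg _)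
  have b2 : ‖frob (outer₂ (wMean X u - wMean X w) (wMean X u))‖ ≤
      (M * ∑ i, |u i - w i|) * M := by
    rw [norm_frob_outer₂]
    exact mul_le_mul hμ' (hμ u hu) (norm_nonneg _) (by positivity)
  have b3 : ‖frob (outer₂ (wMean X w) (wMean X u - wMean X w))‖ ≤
      M * (M * ∑ i, |u i - w i|) := by
    rw [norm_frob_outer₂]
    exact mul_le_mul (hμ w hw) hμ' (norm_nonneg _) hM
  rw [e]
  refine (norm_sub_le _ _).trans ?_
  have := norm_add_le (frob (outer₂ (wMean X u - wMean X w) (wMean X u)))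
    (frob (outer₂ (wMean X w) (wMean X u - wMean X w)))
  linarith

lemma norm_frob_covGibbs_le_one [NeZero d] (ε : ℝ) (X : ι → EuclideanSpace ℝ (Fin d))
    (w : EuclideanSpace ℝ ι) : ‖frob (covGibbs ε X w)‖ ≤ 1 :=
  norm_gibbs_le_one (isHermitian_smul_wCov _ X w)

lemma abs_inner_frob_outer₂_le (A : Matrix (Fin d) (Fin d) ℝ)
    (x y : EuclideanSpace ℝ (Fin d)) :
    |inner ℝ (frob A) (frob (outer₂ x y))| ≤ ‖frob A‖ * (‖x‖ * ‖y‖) := by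
  rw [← norm_frob_outer₂]
  exact abs_real_inner_le_norm _ _

/-- The gradient is Lipschitz, as the Gibbs map is nonexpansive. The factor `N` comes from bounding
each coordinate by the `ℓ¹` norm of `u - w` and then returning to `ℓ²` norms on both sides. -/
lemma norm_softmaxGrad_sub_le [NeZero d] {ε : ℝ} (hρ : 0 < Real.log d / ε)
    {X : ι → EuclideanSpace ℝ (Fin d)} {M : ℝ} (hM : 0 ≤ M) (hX : ∀ i, ‖X i‖ ≤ M)
    {u w : EuclideanSpace ℝ ι} (hu : ∑ i, |u i| = 1) (hw : ∑ i, |w i| = 1) :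
    ‖softmaxGrad ε X u - softmaxGrad ε X w‖ ≤
      Fintype.card ι * (9 * (Real.log d / ε) * M ^ 4 + 2 * M ^ 2) * ‖u - w‖ := by
  set ρ := Real.log d / ε with hρdef
  set a := ∑ i, |u i - w i| with ha
  have ha0 : 0 ≤ a := Finset.sum_nonneg fun i _ => abs_nonneg _
  have hμ : ‖wMean X u‖ ≤ M := by simpa [hu] using norm_wMean_le hX u
  have hμ' : ‖wMean X u - wMean X w‖ ≤ M * a := by
    simpa [wMean_sub] using norm_wMean_le hX (u - w)
  have hY : ‖frob (covGibbs ε X u - covGibbs ε X w)‖ ≤ 3 * ρ * M ^ 2 * a := by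
    rw [map_sub]
    refine (norm_gibbs_sub_le (isHermitian_smul_wCov _ X u) (isHermitian_smul_wCov _ X w)).trans ?_
    rw [map_smul, map_smul, ← smul_sub, norm_smul, Real.norm_eq_abs, abs_of_pos hρ]
    have := mul_le_mul_of_nonneg_left (norm_frob_wCov_sub_le hM hX hu hw) hρ.le
    linarith
  have hcoord : ∀ i, |(softmaxGrad ε X u - softmaxGrad ε X w) i| ≤
      (9 * ρ * M ^ 4 + 2 * M ^ 2) * a := by
    intro i
    have e : (softmaxGrad ε X u - softmaxGrad ε X w) i =
        inner ℝ (frob (covGibbs ε X u - covGibbs ε X w)) (frob (outer₂ (X i) (X i))) -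
        2 * inner ℝ (frob (covGibbs ε X u - covGibbs ε X w))
          (frob (outer₂ (X i) (wMean X u))) -
        2 * inner ℝ (frob (covGibbs ε X w))
          (frob (outer₂ (X i) (wMean X u - wMean X w))) := by
      have hsub : outer₂ (X i) (wMean X u - wMean X w) =
          outer₂ (X i) (wMean X u) - outer₂ (X i) (wMean X w) := by
        ext a b
        simp only [Matrix.sub_apply, outer₂_apply, PiLp.sub_apply]
        ring
      simp only [softmaxGrad, PiLp.sub_apply, outer_eq_outer₂, hsub, map_sub, inner_sub_left,
        inner_sub_right]
      ring
    have c1 : |inner ℝ (frob (covGibbs ε X u - covGibbs ε X w))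
        (frob (outer₂ (X i) (X i)))| ≤ 3 * ρ * M ^ 2 * a * (M * M) :=
      (abs_inner_frob_outer₂_le _ _ _).trans (mul_le_mul hY
        (mul_le_mul (hX i) (hX i) (norm_nonneg _) hM) (by positivity) (by positivity))
    have c2 : |inner ℝ (frob (covGibbs ε X u - covGibbs ε X w))
        (frob (outer₂ (X i) (wMean X u)))| ≤ 3 * ρ * M ^ 2 * a * (M * M) :=
      (abs_inner_frob_outer₂_le _ _ _).trans (mul_le_mul hY
        (mul_le_mul (hX i) hμ (norm_nonneg _) hM) (by positivity) (by positivity))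
    have c3 : |inner ℝ (frob (covGibbs ε X w))
        (frob (outer₂ (X i) (wMean X u - wMean X w)))| ≤ 1 * (M * (M * a)) := by
      exact (abs_inner_frob_outer₂_le _ _ _).trans (mul_le_mul (norm_frob_covGibbs_le_one ε X w)
        (mul_le_mul (hX i) hμ' (norm_nonneg _) hM) (by positivity) (by positivity))
    rw [e]
    rw [abs_le] at c1 c2 c3 ⊢
    constructor <;> nlinarith
  have hnorm := norm_le_sqrt_card_mul (by positivity) hcoord
  have ha1 : a ≤ √(Fintype.card ι) * ‖u - w‖ := by
    simpa [ha] using sum_abs_le_sqrt_card_mul_norm (u - w)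
  refine hnorm.trans ?_
  calc √(Fintype.card ι) * ((9 * ρ * M ^ 4 + 2 * M ^ 2) * a)
      ≤ √(Fintype.card ι) * ((9 * ρ * M ^ 4 + 2 * M ^ 2) * (√(Fintype.card ι) * ‖u - w‖)) := by
        gcongr
    _ = √(Fintype.card ι) ^ 2 * (9 * ρ * M ^ 4 + 2 * M ^ 2) * ‖u - w‖ := by ring
    _ = _ := by rw [Real.sq_sqrt (by positivity)]

lemma norm_softmaxGrad_le [NeZero d] (ε : ℝ) {X : ι → EuclideanSpace ℝ (Fin d)} {M : ℝ}
    (hM : 0 ≤ M) (hX : ∀ i, ‖X i‖ ≤ M) {w : EuclideanSpace ℝ ι} (hw : ∑ i, |w i| = 1) :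
    ‖softmaxGrad ε X w‖ ≤ √(Fintype.card ι) * (3 * M ^ 2) := by
  have hμ : ‖wMean X w‖ ≤ M := by simpa [hw] using norm_wMean_le hX w
  have hY := norm_frob_covGibbs_le_one ε X w
  refine norm_le_sqrt_card_mul (by positivity) fun i => ?_
  have c1 : |inner ℝ (frob (covGibbs ε X w)) (frob (outer₂ (X i) (X i)))| ≤ 1 * (M * M) :=
    (abs_inner_frob_outer₂_le _ _ _).trans (mul_le_mul hY
      (mul_le_mul (hX i) (hX i) (norm_nonneg _) hM) (by positivity) zero_le_one)
  have c2 : |inner ℝ (frob (covGibbs ε X w)) (frob (outer₂ (X i) (wMean X w)))| ≤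
      1 * (M * M) :=
    (abs_inner_frob_outer₂_le _ _ _).trans (mul_le_mul hY
      (mul_le_mul (hX i) hμ (norm_nonneg _) hM) (by positivity) zero_le_one)
  rw [softmaxGrad]
  simp only [outer_eq_outer₂]
  rw [abs_le] at c1 c2 ⊢
  constructor <;> nlinarith

lemma posSemidef_outer (x : EuclideanSpace ℝ (Fin d)) : (outer x).PosSemidef := by
  simpa [outer] using Matrix.posSemidef_vecMulVec_self_star (x : Fin d → ℝ)

lemma posSemidef_wCov {X : ι → EuclideanSpace ℝ (Fin d)} {w : EuclideanSpace ℝ ι}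
    (h0 : ∀ i, 0 ≤ w i) (h1 : ∑ i, w i = 1) : (wCov X w).PosSemidef := by
  rw [wCov_eq X w h1]
  exact Matrix.posSemidef_sum _ fun i _ => (posSemidef_outer _).smul (h0 i)

/-- The softmax lies between `tr (Y Σ_w)` and `tr (Y Σ_w) + ε`, because the entropy of `Y` is at
most `ln d = ε ρ`; this is the upper half. -/
lemma softmaxObj_le_inner [NeZero d] {ε : ℝ} (hε : 0 < ε) (hd : 0 < Real.log d)
    (X : ι → EuclideanSpace ℝ (Fin d)) (w : EuclideanSpace ℝ ι) :
    softmaxObj ε X w ≤ inner ℝ (frob (covGibbs ε X w)) (frob (wCov X w)) + ε := by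
  have h := logTrExp_le (isHermitian_smul_wCov (Real.log d / ε) X w)
  have hρ : 0 < Real.log d / ε := by positivity
  rw [map_smul, inner_smul_right] at h
  rw [softmaxObj_eq, covGibbs, one_div_mul_eq_div, div_le_iff₀ hρ]
  refine h.trans (le_of_eq ?_)
  field_simp

/-- `λ_max(Σ_w) ≤ f(w)`. -/
lemma posSemidef_softmaxObj_smul_one_sub [NeZero d] {ε : ℝ} (hρ : 0 < Real.log d / ε)
    (X : ι → EuclideanSpace ℝ (Fin d)) (w : EuclideanSpace ℝ ι) :
    (softmaxObj ε X w • (1 : Matrix (Fin d) (Fin d) ℝ) - wCov X w).PosSemidef := by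
  have h := (posSemidef_logTrExp_smul_one_sub
    (isHermitian_smul_wCov (Real.log d / ε) X w)).smul (by positivity : 0 ≤ 1 / (Real.log d / ε))
  rw [smul_sub, smul_smul, smul_smul, one_div_mul_cancel hρ.ne', one_smul] at h
  exact h

lemma softmaxObj_nonneg [NeZero d] {ε : ℝ} (hρ : 0 < Real.log d / ε)
    {X : ι → EuclideanSpace ℝ (Fin d)} {w : EuclideanSpace ℝ ι} (h0 : ∀ i, 0 ≤ w i)
    (h1 : ∑ i, w i = 1) : 0 ≤ softmaxObj ε X w := by
  have h := ((posSemidef_softmaxObj_smul_one_sub hρ X w).add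
    (posSemidef_wCov (X := X) h0 h1)).diag_nonneg (i := (0 : Fin d))
  simpa using h

lemma inner_frob_outer_nonneg {A : Matrix (Fin d) (Fin d) ℝ} (hA : A.PosSemidef)
    (x : EuclideanSpace ℝ (Fin d)) : 0 ≤ inner ℝ (frob A) (frob (outer x)) := by
  rw [outer, inner_frob_vecMulVec]
  simpa using hA.dotProduct_mulVec_nonneg (x : Fin d → ℝ)

lemma softmaxObj_le [NeZero d] {ε : ℝ} (hε : 0 < ε) (hd : 0 < Real.log d)
    {X : ι → EuclideanSpace ℝ (Fin d)} {M : ℝ} (hX : ∀ i, ‖X i‖ ≤ M)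
    {w : EuclideanSpace ℝ ι} (hw : ∑ i, |w i| = 1) : softmaxObj ε X w ≤ M ^ 2 + ε := by
  refine (softmaxObj_le_inner hε hd X w).trans (add_le_add_left ?_ ε)
  have hY := norm_frob_covGibbs_le_one ε X w
  have h0 := inner_frob_outer_nonneg (posSemidef_gibbs
    (isHermitian_smul_wCov (Real.log d / ε) X w)) (wMean X w)
  rw [frob_wCov, inner_sub_right]
  refine (sub_le_self _ h0).trans ((real_inner_le_norm _ _).trans ?_)
  refine (mul_le_of_le_one_left (norm_nonneg _) hY).trans ((norm_sum_le _ _).trans ?_)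
  calc ∑ i, ‖w i • frob (outer (X i))‖ ≤ ∑ i, |w i| * M ^ 2 := Finset.sum_le_sum fun i _ => by
        rw [norm_smul, Real.norm_eq_abs, norm_frob_outer]
        exact mul_le_mul_of_nonneg_left (pow_le_pow_left₀ (norm_nonneg _) (hX i) 2) (abs_nonneg _)
    _ = M ^ 2 := by rw [← Finset.sum_mul, hw, one_mul]

end Softmax

/-! ### Projected gradient descent and the weight polytope -/

section ProjectedGradient

variable {E : Type} [NormedAddCommGroup E] [InnerProductSpace ℝ E] [CompleteSpace E]

lemma proj_mem_and_inner_le_zero {K : Set E} (hne : K.Nonempty) (hcl : IsClosed K)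
    (hconv : Convex ℝ K) (x : E) :
    proj K x ∈ K ∧ ∀ u ∈ K, inner ℝ (x - proj K x) (u - proj K x) ≤ 0 := by
  have key : ∃ p, p ∈ K ∧ ∀ q ∈ K, ‖x - p‖ ≤ ‖x - q‖ := by
    obtain ⟨p, hp, h⟩ := exists_norm_eq_iInf_of_complete_convex hne hcl.isComplete hconv x
    refine ⟨p, hp, fun q hq => ?_⟩
    rw [h]
    exact ciInf_le ⟨0, by rintro _ ⟨r, rfl⟩; exact norm_nonneg _⟩ (⟨q, hq⟩ : K)
  have hspec : proj K x ∈ K ∧ ∀ q ∈ K, ‖x - proj K x‖ ≤ ‖x - q‖ := Classical.epsilon_spec key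
  refine ⟨hspec.1, (norm_eq_iInf_iff_real_inner_le_zero hconv hspec.1).1 ?_⟩
  have : Nonempty K := hne.to_subtype
  exact le_antisymm (le_ciInf fun q => hspec.2 q q.2)
    (ciInf_le ⟨0, by rintro _ ⟨r, rfl⟩; exact norm_nonneg _⟩ (⟨_, hspec.1⟩ : K))

/-- The descent lemma for smoothness on a convex set only: the segment stays inside. -/
lemma SmoothOn.le_add_inner_add_sq {f : E → ℝ} {β : ℝ} {K : Set E} (hf : SmoothOn f β K)
    (hconv : Convex ℝ K) {x y : E} (hx : x ∈ K) (hy : y ∈ K) :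
    f y ≤ f x + inner ℝ (gradient f x) (y - x) + β / 2 * ‖y - x‖ ^ 2 := by
  have hmem : ∀ t ∈ Set.Icc (0 : ℝ) 1, x + t • (y - x) ∈ K := fun t ht =>
    hconv.add_smul_sub_mem hx hy ht
  set φ : ℝ → ℝ := fun t => f (x + t • (y - x)) - t * inner ℝ (gradient f x) (y - x) -
    t ^ 2 * (β / 2 * ‖y - x‖ ^ 2) with hφ
  have hder : ∀ t ∈ Set.Icc (0 : ℝ) 1, HasDerivAt φ
      (inner ℝ (gradient f (x + t • (y - x))) (y - x) - 1 * inner ℝ (gradient f x) (y - x) -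
        (2 * t) * (β / 2 * ‖y - x‖ ^ 2)) t := by
    intro t ht
    have hline : HasDerivAt (fun t : ℝ => x + t • (y - x)) (y - x) t := by
      simpa using ((hasDerivAt_id t).smul_const (y - x)).const_add x
    have hgrad := ((hf.1 _ (hmem t ht)).hasGradientAt.hasFDerivAt).comp_hasDerivAt t hline
    have hsq : HasDerivAt (fun t : ℝ => t ^ 2) (2 * t) t := by simpa using hasDerivAt_pow 2 t
    have := (hgrad.sub ((hasDerivAt_id t).mul_const (inner ℝ (gradient f x) (y - x)))).sub
      (hsq.mul_const (β / 2 * ‖y - x‖ ^ 2))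
    exact this
  have hanti : AntitoneOn φ (Set.Icc 0 1) := by
    refine antitoneOn_of_deriv_nonpos (convex_Icc 0 1)
      (fun t ht => (hder t ht).continuousAt.continuousWithinAt)
      (fun t ht => (hder t (interior_subset ht)).differentiableAt.differentiableWithinAt)
      fun t ht => ?_
    have ht' := interior_subset ht
    rw [(hder t ht').deriv, one_mul, ← inner_sub_left]
    have h1 := hf.2 _ (hmem t ht') _ hx
    rw [add_sub_cancel_left, norm_smul, Real.norm_eq_abs, abs_of_nonneg ht'.1] at h1
    have h2 := real_inner_le_norm (gradient f (x + t • (y - x)) - gradient f x) (y - x)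
    have h3 := mul_le_mul_of_nonneg_right h1 (norm_nonneg (y - x))
    nlinarith
  have h01 := hanti (Set.left_mem_Icc.2 zero_le_one) (Set.right_mem_Icc.2 zero_le_one) zero_le_one
  simp only [hφ, one_smul, zero_smul, add_zero, add_sub_cancel] at h01
  linarith

/-- An output of projected gradient descent is an approximate stationary point. The objective drops
by at least `β/2 * ‖w_{t+1} - w_t‖²` in each step, so the shortest of `T` steps, from `w` to `w'`,
is short, and the variational inequality for `w'` carries over to `w`. -/
lemma IsPGDOutput.exists_step {K : Set E} {f : E → ℝ} {β F : ℝ} {T : ℕ} {w : E}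
    (hcl : IsClosed K) (hconv : Convex ℝ K) (hβ : 0 < β) (hf : SmoothOn f β K)
    (hF : ∀ x ∈ K, 0 ≤ f x ∧ f x ≤ F) (hw : IsPGDOutput K f (1 / β) T w) :
    w ∈ K ∧ ∃ w' ∈ K, T * (β / 2 * ‖w' - w‖ ^ 2) ≤ F ∧
      ∀ u ∈ K, -(β * ‖w' - w‖ * ‖u - w'‖ + ‖gradient f w‖ * ‖w' - w‖) ≤
        inner ℝ (gradient f w) (u - w) := by
  obtain ⟨w₀, hw₀, s, hs, rfl, hmin⟩ := hw
  set z := pgd K f (1 / β) w₀ with hz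
  have hne : K.Nonempty := ⟨w₀, hw₀⟩
  have hproj := proj_mem_and_inner_le_zero hne hcl hconv
  have hstep : ∀ t, z (t + 1) = proj K (z t - (1 / β) • gradient f (z t)) := fun t => rfl
  have hmem : ∀ t, z t ∈ K := by
    intro t
    cases t with
    | zero => exact hw₀
    | succ t => rw [hstep]; exact (hproj _).1
  have hvar : ∀ t, ∀ u ∈ K, β * inner ℝ (z t - z (t + 1)) (u - z (t + 1)) ≤
      inner ℝ (gradient f (z t)) (u - z (t + 1)) := by
    intro t u hu
    have h := (hproj (z t - (1 / β) • gradient f (z t))).2 u hu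
    rw [← hstep, sub_right_comm, inner_sub_left, real_inner_smul_left] at h
    have h' : inner ℝ (z t - z (t + 1)) (u - z (t + 1)) ≤
        1 / β * inner ℝ (gradient f (z t)) (u - z (t + 1)) := by linarith
    calc _ ≤ β * (1 / β * inner ℝ (gradient f (z t)) (u - z (t + 1))) := by gcongr
      _ = _ := by field_simp
  have hdesc : ∀ t, β / 2 * ‖z (t + 1) - z t‖ ^ 2 ≤ f (z t) - f (z (t + 1)) := by
    intro t
    have h1 := hf.le_add_inner_add_sq hconv (hmem t) (hmem (t + 1))
    have h2 := hvar t (z t) (hmem t)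
    rw [real_inner_self_eq_norm_sq, ← neg_sub (z (t + 1)) (z t), norm_neg, inner_neg_right] at h2
    linarith
  refine ⟨hmem s, z (s + 1), hmem _, ?_, fun u hu => ?_⟩
  · have hsum : ∑ t ∈ Finset.range T, β / 2 * ‖z (s + 1) - z s‖ ^ 2 ≤
        ∑ t ∈ Finset.range T, (f (z t) - f (z (t + 1))) :=
      Finset.sum_le_sum fun t ht => le_trans (by gcongr; exact hmin t (Finset.mem_range.1 ht))
        (hdesc t)
    rw [Finset.sum_range_sub', Finset.sum_const, Finset.card_range, nsmul_eq_mul] at hsum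
    linarith [(hF _ (hmem 0)).2, (hF _ (hmem T)).1]
  · have e : u - z s = (u - z (s + 1)) + (z (s + 1) - z s) := by abel
    rw [e, inner_add_right]
    have h1 := hvar s u hu
    have h2 := abs_le.1 (abs_real_inner_le_norm (z s - z (s + 1)) (u - z (s + 1)))
    have h3 := abs_le.1 (abs_real_inner_le_norm (gradient f (z s)) (z (s + 1) - z s))
    rw [norm_sub_rev (z s)] at h2
    have h4 := mul_le_mul_of_nonneg_left h2.1 hβ.le
    linarith [h3.1]

end ProjectedGradient

/-- The uniform weights on `G`. -/
def unifWeights {ι : Type} (G : Finset ι) : EuclideanSpace ℝ ι :=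
  WithLp.toLp 2 fun i => open Classical in if i ∈ G then 1 / (G.card : ℝ) else 0

lemma unifWeights_of_mem {ι : Type} {G : Finset ι} {i : ι} (hi : i ∈ G) :
    unifWeights G i = 1 / (G.card : ℝ) := by simp [unifWeights, hi]

lemma unifWeights_of_notMem {ι : Type} {G : Finset ι} {i : ι} (hi : i ∉ G) :
    unifWeights G i = 0 := by
  simp [unifWeights, hi]

section WeightSet

variable {ι : Type} [Fintype ι]

lemma sum_eq_one_of_mem_weightSet {η : ℝ} {w : EuclideanSpace ℝ ι} (hw : w ∈ weightSet ι η) :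
    ∑ i, w i = 1 := by
  rw [← hw.1]
  exact Finset.sum_congr rfl fun i _ => (abs_of_nonneg (hw.2 i).1).symm

lemma mem_weightSet_iff {η : ℝ} {w : EuclideanSpace ℝ ι} : w ∈ weightSet ι η ↔
    ∑ i, w i = 1 ∧ ∀ i, 0 ≤ w i ∧ w i ≤ 1 / ((1 - η) * (Fintype.card ι : ℝ)) := by
  refine ⟨fun h => ⟨sum_eq_one_of_mem_weightSet h, h.2⟩, fun h => ⟨?_, h.2⟩⟩
  rw [← h.1]
  exact Finset.sum_congr rfl fun i _ => abs_of_nonneg (h.2 i).1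

lemma convex_weightSet (η : ℝ) : Convex ℝ (weightSet ι η) := by
  intro u hu w hw a b ha hb hab
  rw [mem_weightSet_iff] at hu hw ⊢
  refine ⟨?_, fun i => ?_⟩
  · simp [Finset.sum_add_distrib, ← Finset.mul_sum, hu.1, hw.1, hab]
  · have h1 := hu.2 i
    have h2 := hw.2 i
    simp only [PiLp.add_apply, PiLp.smul_apply, smul_eq_mul]
    constructor
    · nlinarith
    · calc _ ≤ a * (1 / ((1 - η) * (Fintype.card ι : ℝ))) +
          b * (1 / ((1 - η) * (Fintype.card ι : ℝ))) :=
            add_le_add (mul_le_mul_of_nonneg_left h1.2 ha) (mul_le_mul_of_nonneg_left h2.2 hb)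
        _ = _ := by rw [← add_mul, hab, one_mul]

lemma isClosed_weightSet (η : ℝ) : IsClosed (weightSet ι η) := by
  have h : weightSet ι η = {w | ∑ i, |w i| = 1} ∩
      ⋂ i, ({w | 0 ≤ w i} ∩ {w | w i ≤ 1 / ((1 - η) * (Fintype.card ι : ℝ))}) := by
    ext w
    simp [weightSet]
  rw [h]
  refine (isClosed_eq (by fun_prop) continuous_const).inter (isClosed_iInter fun i => ?_)
  exact (isClosed_le continuous_const (by fun_prop)).inter
    (isClosed_le (by fun_prop) continuous_const)

lemma norm_le_sum_abs (w : EuclideanSpace ℝ ι) : ‖w‖ ≤ ∑ i, |w i| := by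
  have h0 : 0 ≤ ∑ i, |w i| := Finset.sum_nonneg fun i _ => abs_nonneg _
  rw [EuclideanSpace.norm_eq]
  refine Real.sqrt_le_iff.2 ⟨h0, ?_⟩
  exact Finset.sum_sq_le_sq_sum_of_nonneg fun i _ => abs_nonneg _

/-- The diameter of `Δ_{N,η}` is `O(η)`, even for the `ℓ¹` norm: the upper bound on the weights
exceeds their average only by a factor `1 + O(η)`. -/
lemma norm_sub_le_of_mem_weightSet [Nonempty ι] {η : ℝ} (hη0 : 0 ≤ η) (hη : η ≤ 1 / 2)
    {u w : EuclideanSpace ℝ ι} (hu : u ∈ weightSet ι η) (hw : w ∈ weightSet ι η) :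
    ‖u - w‖ ≤ 4 * η := by
  refine (norm_le_sum_abs _).trans ?_
  have hN : (0 : ℝ) < Fintype.card ι := by exact_mod_cast Fintype.card_pos
  set m := 1 / ((1 - η) * (Fintype.card ι : ℝ)) with hm
  calc ∑ i, |(u - w) i| ≤ ∑ i, ((m - u i) + (m - w i)) := Finset.sum_le_sum fun i _ => by
        have h1 := (hu.2 i).2
        have h2 := (hw.2 i).2
        rw [PiLp.sub_apply, abs_le]
        constructor <;> linarith
    _ = 2 * (Fintype.card ι * m) - 2 := by
        simp only [Finset.sum_add_distrib, Finset.sum_sub_distrib, Finset.sum_const,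
          Finset.card_univ, nsmul_eq_mul, sum_eq_one_of_mem_weightSet hu,
          sum_eq_one_of_mem_weightSet hw]
        ring
    _ = 2 * (1 / (1 - η)) - 2 := by
        have : (1 - η) ≠ 0 := by linarith
        rw [hm]; field_simp
    _ ≤ 4 * η := by
        have : 1 / (1 - η) ≤ 1 + 2 * η := by
          rw [div_le_iff₀ (by linarith)]
          nlinarith
        linarith

lemma unifWeights_mem_weightSet [Nonempty ι] {G : Finset ι} {η : ℝ} (hη : η < 1)
    (hG : (1 - η) * Fintype.card ι ≤ G.card) : unifWeights G ∈ weightSet ι η := by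
  have hN : (0 : ℝ) < Fintype.card ι := by exact_mod_cast Fintype.card_pos
  have hpos : 0 < (1 - η) * Fintype.card ι := by
    have : 0 < 1 - η := by linarith
    positivity
  have hG0 : (0 : ℝ) < G.card := hpos.trans_le hG
  rw [mem_weightSet_iff]
  constructor
  · simp [unifWeights, hG0.ne']
  · intro i
    by_cases hi : i ∈ G
    · rw [unifWeights_of_mem hi]
      exact ⟨by positivity, one_div_le_one_div_of_le hpos hG⟩
    · rw [unifWeights_of_notMem hi]
      exact ⟨le_rfl, by positivity⟩

end WeightSet

/-! ### Stationary points have a good mean -/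

section QuadraticForms

variable {d : ℕ}

lemma inner_frob_outer (A : Matrix (Fin d) (Fin d) ℝ) (x : EuclideanSpace ℝ (Fin d)) :
    inner ℝ (frob A) (frob (outer x)) = (x : Fin d → ℝ) ⬝ᵥ A *ᵥ x :=
  inner_frob_vecMulVec A x x

lemma inner_frob_outer_outer (x y : EuclideanSpace ℝ (Fin d)) :
    inner ℝ (frob (outer y)) (frob (outer x)) = (inner ℝ y x) ^ 2 := by
  simp only [PiLp.inner_apply, frob_apply, outer_eq_outer₂, outer₂_apply, RCLike.inner_apply,
    conj_trivial, Fintype.sum_prod_type, sq, Finset.sum_mul_sum]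
  exact Finset.sum_congr rfl fun i _ => Finset.sum_congr rfl fun j _ => by ring

lemma inner_frob_one_outer (x : EuclideanSpace ℝ (Fin d)) :
    inner ℝ (frob 1) (frob (outer x)) = ‖x‖ ^ 2 := by
  rw [inner_frob_outer, Matrix.one_mulVec, EuclideanSpace.real_norm_sq_eq]
  simp [dotProduct, sq]

lemma posSemidef_of_inner_frob_outer_nonneg {A : Matrix (Fin d) (Fin d) ℝ} (hA : A.IsHermitian)
    (h : ∀ x : EuclideanSpace ℝ (Fin d), 0 ≤ inner ℝ (frob A) (frob (outer x))) :
    A.PosSemidef := by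
  refine Matrix.posSemidef_iff_dotProduct_mulVec.2 ⟨hA, fun x => ?_⟩
  have := h (WithLp.toLp 2 x)
  rw [inner_frob_outer] at this
  simpa using this

lemma abs_inner_frob_outer_le (A : Matrix (Fin d) (Fin d) ℝ) (x : EuclideanSpace ℝ (Fin d)) :
    |inner ℝ (frob A) (frob (outer x))| ≤ specNorm A * ‖x‖ ^ 2 := by
  rw [inner_frob_outer, ← Matrix.inner_toEuclideanCLM, specNorm]
  refine (abs_real_inner_le_norm _ _).trans ?_
  have := (Matrix.toEuclideanCLM (n := Fin d) (𝕜 := ℝ) A).le_opNorm x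
  nlinarith [norm_nonneg x]

lemma specNorm_le_of_abs_inner_frob_outer_le {A : Matrix (Fin d) (Fin d) ℝ}
    (hA : A.IsHermitian) {c : ℝ} (hc : 0 ≤ c)
    (h : ∀ x : EuclideanSpace ℝ (Fin d), |inner ℝ (frob A) (frob (outer x))| ≤ c * ‖x‖ ^ 2) :
    specNorm A ≤ c := by
  have hsymm : (Matrix.toEuclideanCLM (n := Fin d) (𝕜 := ℝ) A).IsSymmetric :=
    Matrix.isSymmetric_toEuclideanLin_iff.2 hA
  rw [specNorm, ContinuousLinearMap.norm_eq_iSup_rayleighQuotient _ hsymm]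
  refine ciSup_le fun x => ?_
  have hx := h x
  rw [inner_frob_outer, ← Matrix.inner_toEuclideanCLM] at hx
  rw [ContinuousLinearMap.rayleighQuotient, ContinuousLinearMap.reApplyInnerSelf_apply,
    real_inner_comm, abs_div, abs_of_nonneg (by positivity : 0 ≤ ‖x‖ ^ 2)]
  exact div_le_of_le_mul₀ (by positivity) hc hx

lemma inner_frob_nonneg {A B : Matrix (Fin d) (Fin d) ℝ} (hA : A.PosSemidef)
    (hB : B.PosSemidef) : 0 ≤ inner ℝ (frob A) (frob B) := by
  obtain ⟨U, a, h1, h2, h3⟩ := exists_orthogonal_diagonalization hA.1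
  obtain ⟨V, b, h1', h2', h3'⟩ := exists_orthogonal_diagonalization hB.1
  have diag_nonneg : ∀ {C W : Matrix (Fin d) (Fin d) ℝ} {c : Fin d → ℝ}, C.PosSemidef →
      Wᵀ * W = 1 → C = W * Matrix.diagonal c * Wᵀ → ∀ i, 0 ≤ c i := by
    intro C W c hC hW hCW i
    have h := (hC.conjTranspose_mul_mul_same W).diag_nonneg (i := i)
    have e : Wᴴ * C * W = Matrix.diagonal c := by
      rw [Matrix.conjTranspose_eq_transpose_of_trivial]
      calc Wᵀ * C * W = (Wᵀ * W) * Matrix.diagonal c * (Wᵀ * W) := by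
            rw [hCW]; simp only [Matrix.mul_assoc]
        _ = _ := by rw [hW, Matrix.one_mul, Matrix.mul_one]
    rw [e] at h
    simpa using h
  rw [congrArg frob h3, congrArg frob h3', inner_frob_conj]
  exact Finset.sum_nonneg fun i _ => Finset.sum_nonneg fun j _ =>
    mul_nonneg (overlap_nonneg _ _ _ _)
      (mul_nonneg (diag_nonneg hA h2 h3 i) (diag_nonneg hB h2' h3' j))

end QuadraticForms

section Deterministic

variable {ι : Type} [Fintype ι] {d : ℕ}

/-- Moving the centre of the second moment from the weighted mean to any other point. -/
lemma sum_smul_outer_sub (X : ι → EuclideanSpace ℝ (Fin d)) {w : EuclideanSpace ℝ ι}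
    (hw : ∑ i, w i = 1) (μ : EuclideanSpace ℝ (Fin d)) :
    ∑ i, w i • outer (X i - μ) = wCov X w + outer (wMean X w - μ) := by
  ext a b
  have key : ∀ c : Fin d, wMean X w c = ∑ i, w i * X i c := wMean_apply X w
  simp only [wCov, Matrix.sub_apply, Matrix.add_apply, Matrix.sum_apply, Matrix.smul_apply,
    outer_eq_outer₂, outer₂_apply, smul_eq_mul, PiLp.sub_apply]
  have h : ∀ i, w i * ((X i a - μ a) * (X i b - μ b)) = w i * (X i a * X i b) -
      (w i * X i a) * μ b - μ a * (w i * X i b) + w i * (μ a * μ b) := fun i => by ring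
  simp only [h, Finset.sum_add_distrib, Finset.sum_sub_distrib, ← Finset.sum_mul,
    ← Finset.mul_sum, ← key, hw]
  ring

lemma one_le_log_one_div {ε : ℝ} (hε : 0 < ε) (h : ε ≤ 1 / 8) : 1 ≤ Real.log (1 / ε) := by
  rw [Real.le_log_iff_exp_le (by positivity), le_div_iff₀ hε]
  nlinarith [Real.exp_one_lt_d9, Real.exp_pos 1]

lemma half_le_log {d : ℕ} (hd : 2 ≤ d) : 1 / 2 ≤ Real.log d := by
  have h : Real.log 2 ≤ Real.log d := Real.log_le_log two_pos (by exact_mod_cast hd)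
  linarith [Real.log_two_gt_d9]

/-- With `M² = d Λ`, the Lipschitz constant of the gradient is dominated by its term of order `M⁴`,
at the cost of a larger numerical factor. -/
lemma lipschitz_const_le {d : ℕ} (hd : 2 ≤ d) {ε Λ N : ℝ} (hε : 0 < ε) (hε1 : ε ≤ 1)
    (hΛ : 1 ≤ Λ) (hN : 0 ≤ N) :
    N * (9 * (Real.log d / ε) * (d * Λ) ^ 2 + 2 * (d * Λ)) ≤
      20 * (N * d ^ 2 / ε) * (Real.log d * Λ ^ 2) := by
  have hd' : (2 : ℝ) ≤ d := by exact_mod_cast hd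
  have hlog := half_le_log hd
  have h1 : 1 ≤ d * (Real.log d / ε) * Λ := by
    have : 1 / 2 ≤ Real.log d / ε := hlog.trans (le_div_self (by linarith) hε hε1)
    calc (1 : ℝ) = 2 * (1 / 2) * 1 := by norm_num
      _ ≤ d * (Real.log d / ε) * Λ := by gcongr
  have h2 : 2 * (d * Λ) ≤ 11 * (Real.log d / ε) * (d * Λ) ^ 2 := by
    have h3 := mul_le_mul_of_nonneg_left h1 (by positivity : (0 : ℝ) ≤ d * Λ)
    have h4 : (0 : ℝ) ≤ d * Λ := by positivity
    nlinarith
  calc _ ≤ N * (9 * (Real.log d / ε) * (d * Λ) ^ 2 + 11 * (Real.log d / ε) * (d * Λ) ^ 2) := by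
        gcongr
    _ = _ := by ring

lemma smoothOn_softmaxObj (hd : 2 ≤ d) {ε Λ β η : ℝ} (hε : 0 < ε) (hε1 : ε ≤ 1) (hΛ : 1 ≤ Λ)
    {X : ι → EuclideanSpace ℝ (Fin d)} (hX : ∀ i, ‖X i‖ ≤ √(d * Λ))
    (hβ : 20 * (Fintype.card ι * d ^ 2 / ε) * (Real.log d * Λ ^ 2) ≤ β) :
    SmoothOn (softmaxObj ε X) β (weightSet ι η) := by
  have : NeZero d := ⟨by omega⟩
  have hlog := half_le_log hd
  have hρ : 0 < Real.log d / ε := by have : 0 < Real.log d := by linarith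
                                     positivity
  refine ⟨fun w _ => (hasGradientAt_softmaxObj hρ X w).differentiableAt, fun u hu w hw => ?_⟩
  rw [gradient_softmaxObj hρ, gradient_softmaxObj hρ]
  refine (norm_softmaxGrad_sub_le hρ (Real.sqrt_nonneg _) hX hu.1 hw.1).trans ?_
  refine mul_le_mul_of_nonneg_right (le_trans (le_of_eq ?_) ((lipschitz_const_le hd hε hε1 hΛ
    (Nat.cast_nonneg _)).trans hβ)) (norm_nonneg _)
  have h2 : √((d : ℝ) * Λ) ^ 2 = d * Λ := Real.sq_sqrt (by positivity)
  have h4 : √((d : ℝ) * Λ) ^ 4 = (d * Λ) ^ 2 := by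
    calc √((d : ℝ) * Λ) ^ 4 = (√((d : ℝ) * Λ) ^ 2) ^ 2 := by ring
      _ = _ := by rw [h2]
  rw [h2, h4]

lemma softmaxObj_nonneg_and_le (hd : 2 ≤ d) {ε Λ η : ℝ} (hε : 0 < ε) (hε1 : ε ≤ 1) (hΛ : 1 ≤ Λ)
    {X : ι → EuclideanSpace ℝ (Fin d)} (hX : ∀ i, ‖X i‖ ≤ √(d * Λ))
    {w : EuclideanSpace ℝ ι} (hw : w ∈ weightSet ι η) :
    0 ≤ softmaxObj ε X w ∧ softmaxObj ε X w ≤ 2 * d * Λ := by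
  have : NeZero d := ⟨by omega⟩
  have hlog := half_le_log hd
  have hlog0 : 0 < Real.log d := by linarith
  have hd' : (2 : ℝ) ≤ d := by exact_mod_cast hd
  refine ⟨softmaxObj_nonneg (by positivity) (fun i => (hw.2 i).1) (sum_eq_one_of_mem_weightSet hw),
    (softmaxObj_le hε hlog0 hX hw.1).trans ?_⟩
  rw [Real.sq_sqrt (by positivity)]
  nlinarith

lemma mul_step_le_two {β D T δ : ℝ} (hβ : 0 < β) (hD : 0 < D) (hT : β * D ≤ T)
    (h : T * (β / 2 * δ ^ 2) ≤ 2 * D) : β * δ ≤ 2 := by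
  have h1 : β * D * (β / 2 * δ ^ 2) ≤ 2 * D :=
    (mul_le_mul_of_nonneg_right hT (by positivity)).trans h
  have h2 : D * (β * δ) ^ 2 ≤ D * 2 ^ 2 := by linarith
  exact le_of_sq_le_sq (le_of_mul_le_mul_left h2 hD) (by norm_num)

lemma six_mul_sqrt_mul_le {d : ℕ} (hd : 2 ≤ d) {ε Λ N : ℝ} (hε : 0 < ε) (hΛ : 1 ≤ Λ)
    (hN : 1 ≤ N) :
    6 * (√N * (d * Λ)) ≤ ε * (20 * (N * d ^ 2 / ε) * (Real.log d * Λ ^ 2)) := by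
  have hlog := half_le_log hd
  have hd' : (2 : ℝ) ≤ d := by exact_mod_cast hd
  have h1 : √N ≤ N := Real.sqrt_le_iff.2 ⟨by linarith, by nlinarith⟩
  have h2 : 1 ≤ d * Real.log d * Λ := by
    calc (1 : ℝ) = 2 * (1 / 2) * 1 := by norm_num
      _ ≤ d * Real.log d * Λ := by gcongr
  have h3 : 0 ≤ d * Λ := by positivity
  calc 6 * (√N * (d * Λ)) ≤ 20 * (N * (d * Λ)) :=
        mul_le_mul (by norm_num) (mul_le_mul_of_nonneg_right h1 h3) (by positivity) (by norm_num)
    _ ≤ 20 * (N * (d * Λ)) * (d * Real.log d * Λ) :=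
        le_mul_of_one_le_right (by positivity) h2
    _ = ε * (20 * (N * d ^ 2 / ε) * (Real.log d * Λ ^ 2)) := by field_simp

/-- Stationarity of an output of projected gradient descent on the softmax objective, at the scale
`ε`: the step out of `w` has length at most `2/β`, and it is paired with differences of weight
vectors, whose norms are `O(ε)`. -/
lemma IsPGDOutput.inner_softmaxGrad_ge [Nonempty ι] (hd : 2 ≤ d) {ε Λ β : ℝ} (hε : 0 < ε)
    (hε1 : ε ≤ 1 / 8) (hΛ : 1 ≤ Λ) {X : ι → EuclideanSpace ℝ (Fin d)}
    (hX : ∀ i, ‖X i‖ ≤ √(d * Λ))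
    (hβ : 20 * (Fintype.card ι * d ^ 2 / ε) * (Real.log d * Λ ^ 2) ≤ β) {T : ℕ}
    (hT : β * (d * Λ) ≤ T) {w : EuclideanSpace ℝ ι}
    (hw : IsPGDOutput (weightSet ι (2 * ε)) (softmaxObj ε X) (1 / β) T w) :
    w ∈ weightSet ι (2 * ε) ∧ ∀ u ∈ weightSet ι (2 * ε),
      -(17 * ε) ≤ inner ℝ (softmaxGrad ε X w) (u - w) := by
  have : NeZero d := ⟨by omega⟩
  have hlog := half_le_log hd
  have hlog0 : 0 < Real.log d := by linarith
  have hd' : (2 : ℝ) ≤ d := by exact_mod_cast hd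
  have hN : (1 : ℝ) ≤ Fintype.card ι := by exact_mod_cast Fintype.card_pos
  set N : ℝ := (Fintype.card ι : ℝ) with hNdef
  have hβ0 : 0 < β := lt_of_lt_of_le (by positivity) hβ
  have hout := IsPGDOutput.exists_step (E := EuclideanSpace ℝ ι) (K := weightSet ι (2 * ε))
    (f := softmaxObj ε X) (β := β) (F := 2 * d * Λ) (T := T) (w := w)
  obtain ⟨hwK, w', hw'K, hstep, hvar⟩ := hout (isClosed_weightSet _) (convex_weightSet _) hβ0
    (smoothOn_softmaxObj hd hε (by linarith) hΛ hX hβ)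
    (fun x hx => softmaxObj_nonneg_and_le hd hε (by linarith) hΛ hX hx) hw
  refine ⟨hwK, fun u hu => ?_⟩
  have hρ : 0 < Real.log d / ε := by positivity
  -- The step from `w` to `w'` has length at most `2 / β`.
  have hδ : β * ‖w' - w‖ ≤ 2 :=
    mul_step_le_two hβ0 (by positivity) hT (by linarith)
  have hdiam := norm_sub_le_of_mem_weightSet (by positivity) (by linarith) hu hw'K
  have hgrad : ‖softmaxGrad ε X w‖ ≤ √N * (3 * (d * Λ)) := by
    have := norm_softmaxGrad_le ε (Real.sqrt_nonneg _) hX hwK.1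
    rwa [Real.sq_sqrt (by positivity)] at this
  have hβlow : 6 * (√N * (d * Λ)) ≤ ε * β :=
    (six_mul_sqrt_mul_le hd hε hΛ hN).trans (by gcongr)
  have hterm2 : ‖softmaxGrad ε X w‖ * ‖w' - w‖ ≤ ε := by
    have h1 : ‖softmaxGrad ε X w‖ * ‖w' - w‖ * β ≤ ε * β := by
      calc _ = ‖softmaxGrad ε X w‖ * (β * ‖w' - w‖) := by ring
        _ ≤ (√N * (3 * (d * Λ))) * 2 := by gcongr
        _ = 6 * (√N * (d * Λ)) := by ring
        _ ≤ _ := hβlow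
    exact le_of_mul_le_mul_right h1 hβ0
  have hterm1 : β * ‖w' - w‖ * ‖u - w'‖ ≤ 2 * (4 * (2 * ε)) := by gcongr
  have h := hvar u hu
  rw [gradient_softmaxObj hρ] at h
  linarith

/-- The second moment bound for the good points passes to the covariance of their uniform
weights. -/
lemma posSemidef_sub_wCov_unifWeights [Nonempty ι] {ε κ : ℝ} (hε : 0 < ε) (hε1 : ε ≤ 1 / 8)
    {X : ι → EuclideanSpace ℝ (Fin d)} {G : Finset ι} {μ : EuclideanSpace ℝ (Fin d)}
    (hG : (1 - ε) * Fintype.card ι ≤ G.card) (hmom : GoodMoments ε κ X G μ) :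
    ((1 + κ) • (1 : Matrix (Fin d) (Fin d) ℝ) - wCov X (unifWeights G)).PosSemidef := by
  have hN : (0 : ℝ) < Fintype.card ι := by exact_mod_cast Fintype.card_pos
  have hmem : unifWeights G ∈ weightSet ι (2 * ε) :=
    unifWeights_mem_weightSet (by linarith) (by nlinarith)
  have h1 := sum_eq_one_of_mem_weightSet hmem
  have hspec := hmom _ hmem
  set A := ∑ i ∈ G, unifWeights G i • outer (X i - μ) - 1 with hA
  have hsum : ∑ i ∈ G, unifWeights G i • outer (X i - μ) =
      wCov X (unifWeights G) + outer (wMean X (unifWeights G) - μ) := by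
    rw [← sum_smul_outer_sub X h1]
    refine Finset.sum_subset (Finset.subset_univ _) fun i _ hi => ?_
    rw [unifWeights_of_notMem hi, zero_smul]
  have hHerm : ((1 + κ) • (1 : Matrix (Fin d) (Fin d) ℝ) - wCov X (unifWeights G)).IsHermitian := by
    have := isHermitian_wCov X (unifWeights G)
    rw [Matrix.IsHermitian] at this ⊢
    rw [Matrix.conjTranspose_sub, this, Matrix.conjTranspose_smul, Matrix.conjTranspose_one]
    simp
  refine posSemidef_of_inner_frob_outer_nonneg hHerm fun x => ?_
  have e : (1 + κ) • (1 : Matrix (Fin d) (Fin d) ℝ) - wCov X (unifWeights G) =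
      κ • (1 : Matrix (Fin d) (Fin d) ℝ) - A + outer (wMean X (unifWeights G) - μ) := by
    rw [hA, hsum, add_smul, one_smul]
    abel
  rw [e, map_add, map_sub, map_smul, inner_add_left, inner_sub_left, real_inner_smul_left,
    inner_frob_one_outer]
  have h2 := inner_frob_outer_nonneg (posSemidef_outer (wMean X (unifWeights G) - μ)) x
  have h3 := (le_abs_self _).trans (abs_inner_frob_outer_le A x)
  have h4 := mul_le_mul_of_nonneg_right hspec (sq_nonneg ‖x‖)
  linarith

/-- The constant of the final error bound, in terms of those of the two deterministic
conditions. -/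
def errorConst (c₁ c₂ : ℝ) : ℝ :=
  c₂ * (√(2 * (c₁ + 18 + 4 * c₂ ^ 2 * (c₁ + 1) + 4 * c₂ ^ 2)) + 1)

/-- An approximate stationary point has a small covariance, hence a good mean. If `Y` is the Gibbs
state of `w`, comparing `w` with the uniform weights `u` on the good points gives
`f(w) - ε ≤ tr (Y Σ_w) ≤ tr (Y Σ_u) + ‖μ_u - μ_w‖² + O(ε)`, and by the certificate the
squared distance of the means is at most `O(ε)` times the excess of `f(w)` over `1`. -/
lemma norm_wMean_sub_le_of_stationary [Nonempty ι] (hd : 2 ≤ d) {ε c₁ c₂ : ℝ} (hε : 0 < ε)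
    (hε1 : ε ≤ 1 / 8) (hc₁ : 0 < c₁) (hc₂ : 0 < c₂) (hεc : 8 * c₂ ^ 2 * ε ≤ 1)
    {X : ι → EuclideanSpace ℝ (Fin d)} {G : Finset ι} {μ : EuclideanSpace ℝ (Fin d)}
    (hG : (1 - ε) * Fintype.card ι ≤ G.card)
    (hmom : GoodMoments ε (c₁ * (ε * Real.log (1 / ε))) X G μ)
    (hcert : SpectralCertificate ε c₂ X μ) {w : EuclideanSpace ℝ ι}
    (hwK : w ∈ weightSet ι (2 * ε))
    (hw : ∀ u ∈ weightSet ι (2 * ε), -(17 * ε) ≤ inner ℝ (softmaxGrad ε X w) (u - w)) :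
    ‖wMean X w - μ‖ ≤ errorConst c₁ c₂ * (ε * √(Real.log (1 / ε))) := by
  have : NeZero d := ⟨by omega⟩
  have hlog := half_le_log hd
  have hlog0 : 0 < Real.log d := by linarith
  have hρ : 0 < Real.log d / ε := by positivity
  have hN : (0 : ℝ) < Fintype.card ι := by exact_mod_cast Fintype.card_pos
  have hℓ := one_le_log_one_div hε hε1
  set ℓ := Real.log (1 / ε) with hℓdef
  set u := unifWeights G with hudef
  have huK : u ∈ weightSet ι (2 * ε) :=
    unifWeights_mem_weightSet (by linarith) (by nlinarith)
  have hpsd := posSemidef_sub_wCov_unifWeights hε hε1 hG hmom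
  have hY := posSemidef_gibbs (isHermitian_smul_wCov (Real.log d / ε) X w)
  have htr := trace_gibbs (isHermitian_smul_wCov (Real.log d / ε) X w)
  -- `tr (Y Σ_u) ≤ 1 + c₁ ε ℓ`
  have hYu : inner ℝ (frob (covGibbs ε X w)) (frob (wCov X u)) ≤ 1 + c₁ * (ε * ℓ) := by
    have h := inner_frob_nonneg hY hpsd
    rw [map_sub, inner_sub_right, map_smul, real_inner_smul_right, inner_frob,
      Matrix.transpose_one, Matrix.mul_one, htr, mul_one] at h
    exact sub_nonneg.1 h
  have hYμ : inner ℝ (frob (covGibbs ε X w)) (frob (outer (wMean X u - wMean X w))) ≤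
      ‖wMean X u - wMean X w‖ ^ 2 := by
    rw [← norm_frob_outer]
    exact (real_inner_le_norm _ _).trans (mul_le_of_le_one_left (norm_nonneg _)
      (norm_frob_covGibbs_le_one ε X w))
  have hgrad := hw u huK
  rw [inner_softmaxGrad, inner_sub_right] at hgrad
  have hf := softmaxObj_le_inner hε hlog0 X w
  have hu := hcert u huK (c₁ * (ε * ℓ)) (by positivity) hpsd
  set δ := max (softmaxObj ε X w - 1) 0 with hδdef
  have hδ0 : 0 ≤ δ := le_max_right _ _
  have hwpsd : ((1 + δ) • (1 : Matrix (Fin d) (Fin d) ℝ) - wCov X w).PosSemidef := by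
    have h1 := posSemidef_softmaxObj_smul_one_sub hρ X w
    have h2 : 0 ≤ 1 + δ - softmaxObj ε X w := by linarith [le_max_left (softmaxObj ε X w - 1) 0]
    have h3 := h1.add ((Matrix.PosSemidef.one (n := Fin d) (R := ℝ)).smul h2)
    convert h3 using 1
    rw [sub_smul]
    abel
  have hw' := hcert w hwK δ hδ0 hwpsd
  have hq : √ℓ ^ 2 = ℓ := Real.sq_sqrt (by linarith)
  have hsq : ∀ {D δ' : ℝ}, 0 ≤ δ' → 0 ≤ D → D ≤ c₂ * (√(ε * δ') + ε * √ℓ) →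
      D ^ 2 ≤ 2 * c₂ ^ 2 * (ε * δ' + ε ^ 2 * ℓ) := by
    intro D δ' hδ' hD h
    have h1 := pow_le_pow_left₀ hD h 2
    have h2 : √(ε * δ') ^ 2 = ε * δ' := Real.sq_sqrt (by positivity)
    have h3 : (√(ε * δ') + ε * √ℓ) ^ 2 ≤ 2 * (ε * δ' + ε ^ 2 * ℓ) := by
      have h4 : (ε * √ℓ) ^ 2 = ε ^ 2 * ℓ := by rw [mul_pow, hq]
      linarith [add_sq_le (a := √(ε * δ')) (b := ε * √ℓ)]
    rw [mul_pow] at h1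
    nlinarith [mul_le_mul_of_nonneg_left h3 (sq_nonneg c₂)]
  have hDu := hsq (by positivity) (norm_nonneg _) hu
  have hDw := hsq hδ0 (norm_nonneg _) hw'
  have htri : ‖wMean X u - wMean X w‖ ^ 2 ≤ 2 * ‖μ - wMean X u‖ ^ 2 + 2 * ‖μ - wMean X w‖ ^ 2 := by
    have h1 : wMean X u - wMean X w = (μ - wMean X w) - (μ - wMean X u) := by abel
    have h2 := norm_sub_le (μ - wMean X w) (μ - wMean X u)
    rw [← h1] at h2
    nlinarith [sq_nonneg (‖μ - wMean X w‖ - ‖μ - wMean X u‖),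
      norm_nonneg (wMean X u - wMean X w)]
  have hεℓ : ε ≤ ε * ℓ := le_mul_of_one_le_right hε.le hℓ
  have hε2 : ε * (ε * ℓ) ≤ ε * ℓ := mul_le_of_le_one_left (by positivity) (by linarith)
  set B := c₁ + 18 + 4 * c₂ ^ 2 * (c₁ + 1) + 4 * c₂ ^ 2 with hB
  have hB0 : 0 < B := by positivity
  have hδB : δ ≤ 2 * B * (ε * ℓ) := by
    have h1 : softmaxObj ε X w - 1 ≤ B * (ε * ℓ) + 4 * c₂ ^ 2 * (ε * δ) := by
      have h2 : softmaxObj ε X w - 1 ≤ c₁ * (ε * ℓ) + 18 * ε +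
          (2 * (2 * c₂ ^ 2 * (ε * (c₁ * (ε * ℓ)) + ε ^ 2 * ℓ)) +
          2 * (2 * c₂ ^ 2 * (ε * δ + ε ^ 2 * ℓ))) := by linarith
      have h3 := mul_le_mul_of_nonneg_left hε2 (by positivity : 0 ≤ 4 * c₂ ^ 2 * (c₁ + 1))
      have h4 := mul_le_mul_of_nonneg_left hε2 (by positivity : 0 ≤ 4 * c₂ ^ 2)
      have h5 := mul_le_mul_of_nonneg_left hεℓ (by norm_num : (0 : ℝ) ≤ 18)
      rw [hB]
      linarith
    have h6 : δ ≤ B * (ε * ℓ) + 4 * c₂ ^ 2 * (ε * δ) := max_le h1 (by positivity)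
    have h7 := mul_le_mul_of_nonneg_right hεc hδ0
    linarith
  have hfin : √(ε * δ) ≤ √(2 * B) * (ε * √ℓ) := by
    have e : √(2 * B) * (ε * √ℓ) = √(2 * B * (ε ^ 2 * ℓ)) := by
      rw [Real.sqrt_mul (by positivity) (ε ^ 2 * ℓ), Real.sqrt_mul (by positivity) ℓ,
        Real.sqrt_sq hε.le]
    rw [e]
    refine Real.sqrt_le_sqrt ?_
    have := mul_le_mul_of_nonneg_left hδB hε.le
    linarith
  rw [norm_sub_rev]
  refine hw'.trans ?_
  rw [errorConst, mul_assoc]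
  refine mul_le_mul_of_nonneg_left ?_ hc₂.le
  rw [add_mul, one_mul]
  linarith

lemma errorConst_pos {c₁ c₂ : ℝ} (hc₂ : 0 < c₂) : 0 < errorConst c₁ c₂ := by
  unfold errorConst
  positivity

/-- Outputs of projected gradient descent have a good mean under the deterministic conditions. -/
lemma IsPGDOutput.norm_wMean_sub_le [Nonempty ι] (hd : 2 ≤ d) {ε Λ β c₁ c₂ : ℝ} (hε : 0 < ε)
    (hc₁ : 0 < c₁) (hc₂ : 0 < c₂) (hε1 : ε < min (1 / 8) (1 / (8 * c₂ ^ 2))) (hΛ : 1 ≤ Λ)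
    {X : ι → EuclideanSpace ℝ (Fin d)} {G : Finset ι} {μ : EuclideanSpace ℝ (Fin d)}
    (hX : ∀ i, ‖X i‖ ≤ √(d * Λ)) (hG : (1 - ε) * Fintype.card ι ≤ G.card)
    (hmom : GoodMoments ε (c₁ * (ε * Real.log (1 / ε))) X G μ)
    (hcert : SpectralCertificate ε c₂ X μ)
    (hβ : 20 * (Fintype.card ι * d ^ 2 / ε) * (Real.log d * Λ ^ 2) ≤ β) {T : ℕ}
    (hT : β * (d * Λ) ≤ T) {w : EuclideanSpace ℝ ι}
    (hw : IsPGDOutput (weightSet ι (2 * ε)) (softmaxObj ε X) (1 / β) T w) :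
    w ∈ weightSet ι (2 * ε) ∧
      ‖wMean X w - μ‖ ≤ errorConst c₁ c₂ * (ε * √(Real.log (1 / ε))) := by
  obtain ⟨h8, hεc⟩ := lt_min_iff.1 hε1
  rw [lt_div_iff₀ (by positivity)] at hεc
  obtain ⟨hwK, hstat⟩ := IsPGDOutput.inner_softmaxGrad_ge (w := w) hd hε h8.le hΛ hX hβ hT hw
  exact ⟨hwK, norm_wMean_sub_le_of_stationary hd hε h8.le hc₁ hc₂ (by linarith) hG hmom hcert hwK
    hstat⟩

end Deterministic

/-! ### Half-nets and stability of a sample -/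

section Net

variable {d : ℕ}

/-- A half-net of the unit sphere with at most `5 ^ d` points: a maximal `1/2`-separated subset. -/
lemma exists_half_net (d : ℕ) : ∃ S : Finset (EuclideanSpace ℝ (Fin d)), S.card ≤ 5 ^ d ∧
    (∀ v ∈ S, ‖v‖ = 1) ∧ ∀ x : EuclideanSpace ℝ (Fin d), ‖x‖ = 1 → ∃ v ∈ S, ‖x - v‖ ≤ 1 / 2 := by
  classical
  let P : Finset (EuclideanSpace ℝ (Fin d)) → Prop := fun S =>
    (∀ v ∈ S, ‖v‖ = 1) ∧ ∀ v ∈ S, ∀ u ∈ S, v ≠ u → 1 / 2 ≤ ‖v - u‖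
  have hbound : ∀ S, P S → S.card ≤ 5 ^ d := by
    intro S hS
    have hinj : Function.Injective fun v : EuclideanSpace ℝ (Fin d) => (2 : ℝ) • v :=
      smul_right_injective _ two_ne_zero
    have h := Besicovitch.card_le_of_separated (S.image fun v => (2 : ℝ) • v) (by
      intro c hc
      obtain ⟨v, hv, rfl⟩ := Finset.mem_image.1 hc
      rw [norm_smul, hS.1 v hv]; norm_num) (by
      intro c hc e he hne
      obtain ⟨v, hv, rfl⟩ := Finset.mem_image.1 hc
      obtain ⟨u, hu, rfl⟩ := Finset.mem_image.1 he
      have := hS.2 v hv u hu fun h => hne (by rw [h])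
      rw [← smul_sub, norm_smul, Real.norm_eq_abs, abs_two]
      linarith)
    rwa [Finset.card_image_of_injective _ hinj, finrank_euclideanSpace_fin] at h
  let C : Set ℕ := {k | ∃ S, P S ∧ S.card = k}
  have hC : C.Nonempty := ⟨0, ∅, by simp [P], rfl⟩
  have hCb : BddAbove C := ⟨5 ^ d, by rintro k ⟨S, hS, rfl⟩; exact hbound S hS⟩
  obtain ⟨S, hS, hcard⟩ := Nat.sSup_mem hC hCb
  refine ⟨S, hbound S hS, hS.1, fun x hx => ?_⟩
  by_contra! hfar
  have hxS : x ∉ S := fun h => by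
    have := hfar x h
    simp at this
    linarith
  have hP : P (insert x S) := by
    refine ⟨fun v hv => ?_, fun v hv u hu hvu => ?_⟩
    · rcases Finset.mem_insert.1 hv with rfl | hv
      · exact hx
      · exact hS.1 v hv
    · rcases Finset.mem_insert.1 hv with hv | hv <;> rcases Finset.mem_insert.1 hu with hu | hu
      · exact absurd (hv.trans hu.symm) hvu
      · rw [hv]; exact (hfar u hu).le
      · rw [hu, norm_sub_rev]; exact (hfar v hv).le
      · exact hS.2 v hv u hu hvu
  have := le_csSup hCb ⟨insert x S, hP, rfl⟩
  rw [Finset.card_insert_of_notMem hxS, hcard] at this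
  omega

/-- Control of a quadratic form on a half-net controls it everywhere. For unit vectors `x, v` one
has `qA(x) - qA(v) = ⟨x - v, A (x + v)⟩` and `‖x - v‖² + ‖x + v‖² = 4`, so at distance at most `1/2`
the product `‖x - v‖ ‖x + v‖` is at most `√15 / 4 < 31/32`. -/
lemma specNorm_le_of_half_net {A : Matrix (Fin d) (Fin d) ℝ} (hA : A.IsHermitian) {c : ℝ}
    (hc : 0 ≤ c) {S : Finset (EuclideanSpace ℝ (Fin d))} (hS1 : ∀ v ∈ S, ‖v‖ = 1)
    (hS : ∀ x : EuclideanSpace ℝ (Fin d), ‖x‖ = 1 → ∃ v ∈ S, ‖x - v‖ ≤ 1 / 2)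
    (h : ∀ v ∈ S, |inner ℝ (frob A) (frob (outer v))| ≤ c) : specNorm A ≤ 32 * c := by
  have hQ0 : 0 ≤ specNorm A := norm_nonneg _
  have hunit : ∀ x : EuclideanSpace ℝ (Fin d), ‖x‖ = 1 →
      |inner ℝ (frob A) (frob (outer x))| ≤ c + 31 / 32 * specNorm A := by
    intro x hx
    obtain ⟨v, hvS, hxv⟩ := hS x hx
    have hv := hS1 v hvS
    set B := Matrix.toEuclideanCLM (n := Fin d) (𝕜 := ℝ) A with hB
    have hsymm : ∀ y z : EuclideanSpace ℝ (Fin d), inner ℝ y (B z) = inner ℝ z (B y) := by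
      intro y z
      rw [hB, Matrix.inner_toEuclideanCLM, Matrix.inner_toEuclideanCLM,
        ← inner_frob_vecMulVec, ← inner_frob_vecMulVec]
      exact inner_frob_outer₂_comm hA y z
    have e : inner ℝ (frob A) (frob (outer x)) =
        inner ℝ (frob A) (frob (outer v)) + inner ℝ (x - v) (B (x + v)) := by
      rw [inner_frob_outer, inner_frob_outer, ← Matrix.inner_toEuclideanCLM,
        ← Matrix.inner_toEuclideanCLM, map_add, inner_add_right, inner_sub_left, inner_sub_left,
        hsymm x v]
      ring
    have hpar := parallelogram_law_with_norm ℝ x v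
    rw [hx, hv] at hpar
    have hprod : ‖x - v‖ * ‖x + v‖ ≤ 31 / 32 := by
      have h0 := norm_nonneg (x - v)
      have hsq : ‖x - v‖ ^ 2 ≤ 1 / 4 := by nlinarith
      have h1 : (‖x - v‖ * ‖x + v‖) ^ 2 ≤ (31 / 32) ^ 2 := by
        have h2 : ‖x + v‖ ^ 2 = 4 - ‖x - v‖ ^ 2 := by nlinarith
        rw [mul_pow, h2]
        nlinarith [sq_nonneg ‖x - v‖]
      exact le_of_sq_le_sq h1 (by norm_num)
    have h3 : |inner ℝ (x - v) (B (x + v))| ≤ 31 / 32 * specNorm A := by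
      refine (abs_real_inner_le_norm _ _).trans ?_
      have h4 : ‖B (x + v)‖ ≤ specNorm A * ‖x + v‖ := B.le_opNorm _
      calc ‖x - v‖ * ‖B (x + v)‖ ≤ ‖x - v‖ * (specNorm A * ‖x + v‖) := by gcongr
        _ = (‖x - v‖ * ‖x + v‖) * specNorm A := by ring
        _ ≤ _ := by gcongr
    rw [e]
    exact (abs_add_le _ _).trans (add_le_add (h v hvS) h3)
  have hall : ∀ x : EuclideanSpace ℝ (Fin d), |inner ℝ (frob A) (frob (outer x))| ≤
      (c + 31 / 32 * specNorm A) * ‖x‖ ^ 2 := by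
    intro x
    rcases eq_or_ne x 0 with rfl | hx
    · rw [inner_frob_outer]; simp
    · have hn : ‖x‖ ≠ 0 := norm_ne_zero_iff.2 hx
      have hu := hunit (‖x‖⁻¹ • x) (by rw [norm_smul, norm_inv, norm_norm, inv_mul_cancel₀ hn])
      have e : inner ℝ (frob A) (frob (outer (‖x‖⁻¹ • x))) =
          (‖x‖ ^ 2)⁻¹ * inner ℝ (frob A) (frob (outer x)) := by
        rw [inner_frob_outer, inner_frob_outer]
        simp only [WithLp.ofLp_smul, Matrix.mulVec_smul, smul_dotProduct, dotProduct_smul,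
          smul_eq_mul]
        ring
      rw [e, abs_mul, abs_of_nonneg (by positivity), inv_mul_le_iff₀ (by positivity)] at hu
      linarith
  have := specNorm_le_of_abs_inner_frob_outer_le hA (by positivity) hall
  linarith

lemma norm_le_of_half_net {y : EuclideanSpace ℝ (Fin d)} {c : ℝ} (hc : 0 ≤ c)
    {S : Finset (EuclideanSpace ℝ (Fin d))}
    (hS : ∀ x : EuclideanSpace ℝ (Fin d), ‖x‖ = 1 → ∃ v ∈ S, ‖x - v‖ ≤ 1 / 2)
    (h : ∀ v ∈ S, |inner ℝ y v| ≤ c) : ‖y‖ ≤ 2 * c := by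
  rcases eq_or_ne y 0 with rfl | hy
  · simpa using hc
  · have hn : ‖y‖ ≠ 0 := norm_ne_zero_iff.2 hy
    obtain ⟨v, hv, hxv⟩ := hS (‖y‖⁻¹ • y)
      (by rw [norm_smul, norm_inv, norm_norm, inv_mul_cancel₀ hn])
    have h1 : ‖y‖ = inner ℝ y v + inner ℝ y (‖y‖⁻¹ • y - v) := by
      rw [← inner_add_right, add_sub_cancel, real_inner_smul_right, real_inner_self_eq_norm_sq]
      field_simp
    have h2 := (abs_le.1 (abs_real_inner_le_norm y (‖y‖⁻¹ • y - v))).2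
    have h3 := (abs_le.1 (h v hv)).2
    have h4 := mul_le_mul_of_nonneg_left hxv (norm_nonneg y)
    linarith

end Net

section Stability

variable {d N : ℕ}

/-- Stability of a centred sample `g` at scale `ε`: its first two empirical moments are those of a
standard Gaussian up to `a ε`, and no reweighting of total mass at most `14 ε N` carries more
than `a ε ln (1/ε) N` of the second moment in any direction. -/
structure StableSample (a ε : ℝ) (g : Fin N → EuclideanSpace ℝ (Fin d)) : Prop where
  second : ∀ x, |∑ j, (inner ℝ (g j) x) ^ 2 - N * ‖x‖ ^ 2| ≤ a * ε * N * ‖x‖ ^ 2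
  first : ∀ x, |∑ j, inner ℝ (g j) x| ≤ a * ε * N * ‖x‖
  tail : ∀ b : Fin N → ℝ, (∀ j, 0 ≤ b j ∧ b j ≤ 1) → ∑ j, b j ≤ 14 * ε * N →
    ∀ x, ∑ j, b j * (inner ℝ (g j) x) ^ 2 ≤ a * (ε * Real.log (1 / ε)) * N * ‖x‖ ^ 2

/-- Stability follows from bounds on a half-net. The tail bound over all reweightings needs no union
bound, as `∑ b_j y_j² ≤ ∑ (y_j² - s)_+ + s ∑ b_j`; here `s = 4 ln (1/ε)`. -/
lemma stableSample_of_half_net {ε : ℝ} (hε : 0 < ε) (hε1 : ε ≤ 1 / 8)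
    {g : Fin N → EuclideanSpace ℝ (Fin d)}
    {S : Finset (EuclideanSpace ℝ (Fin d))} (hS1 : ∀ v ∈ S, ‖v‖ = 1)
    (hS : ∀ x : EuclideanSpace ℝ (Fin d), ‖x‖ = 1 → ∃ v ∈ S, ‖x - v‖ ≤ 1 / 2)
    (h2 : ∀ v ∈ S, |∑ j, (inner ℝ (g j) v) ^ 2 - N| ≤ ε * N)
    (h1 : ∀ v ∈ S, |∑ j, inner ℝ (g j) v| ≤ ε * N)
    (h3 : ∀ v ∈ S, ∑ j, max ((inner ℝ (g j) v) ^ 2 - 4 * Real.log (1 / ε)) 0 ≤ 12 * ε * N) :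
    StableSample 2176 ε g := by
  have hℓ := one_le_log_one_div hε hε1
  have hq : ∀ (b : Fin N → ℝ) (x : EuclideanSpace ℝ (Fin d)),
      inner ℝ (frob (∑ j, b j • outer (g j))) (frob (outer x)) =
        ∑ j, b j * (inner ℝ (g j) x) ^ 2 := by
    intro b x
    simp only [map_sum, map_smul, sum_inner, real_inner_smul_left, inner_frob_outer_outer]
  have hherm : ∀ b : Fin N → ℝ, (∑ j, b j • outer (g j)).IsHermitian := by
    intro b
    ext p q
    simp [Matrix.sum_apply, outer_eq_outer₂, outer₂_apply, mul_comm]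
  refine ⟨fun x => ?_, fun x => ?_, fun b hb hbs x => ?_⟩
  · set A := ∑ j, (1 : ℝ) • outer (g j) - (N : ℝ) • (1 : Matrix (Fin d) (Fin d) ℝ) with hA
    have hAH : A.IsHermitian := by
      have := hherm fun _ => 1
      rw [Matrix.IsHermitian] at this ⊢
      rw [hA, Matrix.conjTranspose_sub, this, Matrix.conjTranspose_smul, Matrix.conjTranspose_one]
      simp
    have hqA : ∀ x : EuclideanSpace ℝ (Fin d), inner ℝ (frob A) (frob (outer x)) =
        ∑ j, (inner ℝ (g j) x) ^ 2 - N * ‖x‖ ^ 2 := by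
      intro x
      rw [hA, map_sub, inner_sub_left, hq, map_smul, real_inner_smul_left, inner_frob_one_outer]
      simp
    have hspec := specNorm_le_of_half_net hAH (by positivity) hS1 hS (c := ε * N) fun v hv => by
      rw [hqA, hS1 v hv]
      simpa using h2 v hv
    rw [← hqA]
    refine (abs_inner_frob_outer_le A x).trans ?_
    have : specNorm A ≤ 2176 * ε * N := by
      have : 0 ≤ ε * N := by positivity
      linarith
    gcongr
  · rw [← sum_inner]
    refine (abs_real_inner_le_norm _ _).trans ?_
    have := norm_le_of_half_net (y := ∑ j, g j) (c := ε * N) (by positivity) hS fun v hv => by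
      rw [sum_inner]
      exact h1 v hv
    have h0 : 0 ≤ ε * N := by positivity
    have : ‖∑ j, g j‖ ≤ 2176 * ε * N := by linarith
    gcongr
  · have hspec := specNorm_le_of_half_net (hherm b) (c := 68 * (ε * Real.log (1 / ε)) * N)
      (by positivity) hS1 hS fun v hv => by
      rw [hq, abs_of_nonneg (Finset.sum_nonneg fun j _ => mul_nonneg (hb j).1 (sq_nonneg _))]
      calc ∑ j, b j * (inner ℝ (g j) v) ^ 2
          ≤ ∑ j, (max ((inner ℝ (g j) v) ^ 2 - 4 * Real.log (1 / ε)) 0 +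
            4 * Real.log (1 / ε) * b j) := Finset.sum_le_sum fun j _ => by
            have m1 := le_max_left ((inner ℝ (g j) v) ^ 2 - 4 * Real.log (1 / ε)) 0
            have m2 := le_max_right ((inner ℝ (g j) v) ^ 2 - 4 * Real.log (1 / ε)) 0
            nlinarith [(hb j).1, (hb j).2]
        _ ≤ 12 * ε * N + 4 * Real.log (1 / ε) * (14 * ε * N) := by
            rw [Finset.sum_add_distrib, ← Finset.mul_sum]
            have := h3 v hv
            gcongr
        _ ≤ 68 * (ε * Real.log (1 / ε)) * N := by
            have : ε * N ≤ ε * N * Real.log (1 / ε) :=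
              le_mul_of_one_le_right (by positivity) hℓ
            linarith
    rw [← hq]
    refine (le_abs_self _).trans ((abs_inner_frob_outer_le _ x).trans ?_)
    have : specNorm (∑ j, b j • outer (g j)) ≤ 2176 * (ε * Real.log (1 / ε)) * N := by linarith
    gcongr

end Stability

/-! ### Stable samples satisfy the deterministic conditions -/

section Transfer

variable {ι : Type} {d N : ℕ}

/-- The weights of the points of `G`, carried along `e : ι → Fin N` to the original sample. -/
def pushWeights (e : ι → Fin N) (G : Finset ι) (w : EuclideanSpace ℝ ι) (j : Fin N) : ℝ :=
  ∑ i ∈ G, if e i = j then w i else 0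

lemma sum_pushWeights_mul (e : ι → Fin N) (G : Finset ι) (w : EuclideanSpace ℝ ι)
    (φ : Fin N → ℝ) : ∑ j, pushWeights e G w j * φ j = ∑ i ∈ G, w i * φ (e i) := by
  simp only [pushWeights, Finset.sum_mul]
  rw [Finset.sum_comm]
  refine Finset.sum_congr rfl fun i _ => ?_
  simp [ite_mul]

lemma pushWeights_mem_Icc {e : ι → Fin N} (he : Function.Injective e) (G : Finset ι)
    {w : EuclideanSpace ℝ ι} {M : ℝ} (hM : 0 ≤ M) (hw : ∀ i, 0 ≤ w i ∧ w i ≤ M) (j : Fin N) :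
    0 ≤ pushWeights e G w j ∧ pushWeights e G w j ≤ M := by
  refine ⟨Finset.sum_nonneg fun i _ => by split_ifs <;> simp [(hw i).1], ?_⟩
  by_cases h : ∃ i ∈ G, e i = j
  · obtain ⟨i, hi, rfl⟩ := h
    rw [pushWeights, Finset.sum_eq_single i]
    · simpa using (hw i).2
    · intro k _ hki
      rw [if_neg fun h => hki (he h)]
    · exact fun h => absurd hi h
  · push Not at h
    rw [pushWeights, Finset.sum_eq_zero fun i hi => if_neg (h i hi)]
    exact hM

variable [Fintype ι] [Nonempty ι] {ε : ℝ} {e : ι → Fin N} {G : Finset ι} {w : EuclideanSpace ℝ ι}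

lemma weight_le_of_mem_weightSet (hε : 0 < ε) (hε1 : ε ≤ 1 / 8)
    (he : Function.Injective e) (hG : (1 - ε) * N ≤ G.card) (hw : w ∈ weightSet ι (2 * ε)) :
    0 < (N : ℝ) ∧ ∀ i, w i ≤ (1 + 6 * ε) / N := by
  have hcard : Fintype.card ι ≤ N := by simpa using Fintype.card_le_of_injective e he
  have hn : 0 < Fintype.card ι := Fintype.card_pos
  have hN : (0 : ℝ) < N := by exact_mod_cast hn.trans_le hcard
  refine ⟨hN, fun i => (hw.2 i).2.trans ?_⟩
  have hGn : (G.card : ℝ) ≤ Fintype.card ι := by exact_mod_cast Finset.card_le_univ G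
  have hn' : (0 : ℝ) < Fintype.card ι := by exact_mod_cast hn
  rw [div_le_div_iff₀ (by nlinarith) hN, one_mul]
  have h1 : 1 ≤ (1 + 6 * ε) * ((1 - 2 * ε) * (1 - ε)) := by nlinarith [mul_pos hε hε]
  calc (N : ℝ) ≤ (1 + 6 * ε) * ((1 - 2 * ε) * (1 - ε)) * N := le_mul_of_one_le_left hN.le h1
    _ = (1 + 6 * ε) * ((1 - 2 * ε) * ((1 - ε) * N)) := by ring
    _ ≤ _ := by
      have : 0 ≤ 1 - 2 * ε := by linarith
      gcongr
      linarith

/-- The corrupted points carry little weight. -/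
lemma sum_compl_weights_le [DecidableEq ι] (hε : 0 < ε) (hε1 : ε ≤ 1 / 8)
    (he : Function.Injective e) (hG : (1 - ε) * N ≤ G.card) (hw : w ∈ weightSet ι (2 * ε)) :
    ∑ i ∈ Gᶜ, w i ≤ 2 * ε := by
  obtain ⟨hN, hle⟩ := weight_le_of_mem_weightSet hε hε1 he hG hw
  have hcard : (Fintype.card ι : ℝ) ≤ N := by
    exact_mod_cast (by simpa using Fintype.card_le_of_injective e he : Fintype.card ι ≤ N)
  have hGc : (Gᶜ.card : ℝ) ≤ ε * N := by
    rw [Finset.card_compl, Nat.cast_sub (Finset.card_le_univ G)]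
    linarith
  calc ∑ i ∈ Gᶜ, w i ≤ ∑ _i ∈ Gᶜ, (1 + 6 * ε) / N := Finset.sum_le_sum fun i _ => hle i
    _ = Gᶜ.card * ((1 + 6 * ε) / N) := by rw [Finset.sum_const, nsmul_eq_mul]
    _ ≤ ε * N * ((1 + 6 * ε) / N) := by gcongr
    _ = ε * (1 + 6 * ε) := by field_simp
    _ ≤ 2 * ε := by nlinarith

/-- Seen on the original sample, the weights of the good points differ from the uniform ones by
total mass `O(ε)`. -/
lemma sum_abs_pushWeights_sub_le (hε : 0 < ε) (hε1 : ε ≤ 1 / 8)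
    (he : Function.Injective e) (hG : (1 - ε) * N ≤ G.card) (hw : w ∈ weightSet ι (2 * ε)) :
    (∀ j, N * |pushWeights e G w j - 1 / N| ≤ 1) ∧
      ∑ j, N * |pushWeights e G w j - 1 / N| ≤ 14 * ε * N := by
  classical
  obtain ⟨hN, hle⟩ := weight_le_of_mem_weightSet hε hε1 he hG hw
  have hω := pushWeights_mem_Icc he G (by positivity) fun i => ⟨(hw.2 i).1, hle i⟩
  have hsum : 1 - 2 * ε ≤ ∑ j, pushWeights e G w j := by
    have h := sum_pushWeights_mul e G w fun _ => 1
    simp only [mul_one] at h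
    have h2 := Finset.sum_add_sum_compl G fun i => w i
    rw [sum_eq_one_of_mem_weightSet hw] at h2
    linarith [sum_compl_weights_le hε hε1 he hG hw]
  have hM : (1 + 6 * ε) / N ≤ 2 / N := by gcongr; linarith
  constructor
  · intro j
    have h1 : |pushWeights e G w j - 1 / N| ≤ 1 / N := by
      have h2 : (2 : ℝ) / N = 1 / N + 1 / N := by ring
      rw [abs_le]
      constructor <;> linarith [hω j]
    calc N * |pushWeights e G w j - 1 / N| ≤ N * (1 / N) := by gcongr
      _ = 1 := by field_simp
  · rw [← Finset.mul_sum]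
    calc N * ∑ j, |pushWeights e G w j - 1 / N|
        ≤ N * ∑ j, (((1 + 6 * ε) / N - pushWeights e G w j) + ((1 + 6 * ε) / N - 1 / N)) := by
          refine mul_le_mul_of_nonneg_left (Finset.sum_le_sum fun j _ => ?_) hN.le
          have h1 : (1 : ℝ) / N ≤ (1 + 6 * ε) / N := by gcongr; linarith
          have h2 := (hω j).2
          rw [abs_le]
          constructor <;> linarith
      _ = N * (1 + 12 * ε - ∑ j, pushWeights e G w j) := by
          simp only [Finset.sum_add_distrib, Finset.sum_sub_distrib, Finset.sum_const,
            Finset.card_univ, Fintype.card_fin, nsmul_eq_mul]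
          field_simp
          ring
      _ ≤ N * (1 + 12 * ε - (1 - 2 * ε)) := by gcongr
      _ = 14 * ε * N := by ring

variable {a : ℝ} {g : Fin N → EuclideanSpace ℝ (Fin d)}

lemma StableSample.abs_sum_weights_sq_sub_le (hst : StableSample a ε g) (ha : 0 ≤ a) (hε : 0 < ε)
    (hε1 : ε ≤ 1 / 8) (he : Function.Injective e) (hG : (1 - ε) * N ≤ G.card)
    (hw : w ∈ weightSet ι (2 * ε)) (x : EuclideanSpace ℝ (Fin d)) :
    |∑ i ∈ G, w i * (inner ℝ (g (e i)) x) ^ 2 - ‖x‖ ^ 2| ≤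
      2 * a * (ε * Real.log (1 / ε)) * ‖x‖ ^ 2 := by
  have hℓ := one_le_log_one_div hε hε1
  obtain ⟨hN, -⟩ := weight_le_of_mem_weightSet hε hε1 he hG hw
  obtain ⟨hb1, hb2⟩ := sum_abs_pushWeights_sub_le hε hε1 he hG hw
  have htail := hst.tail (fun j => N * |pushWeights e G w j - 1 / N|)
    (fun j => ⟨by positivity, hb1 j⟩) hb2 x
  have hsec := hst.second x
  rw [← sum_pushWeights_mul e G w fun j => (inner ℝ (g j) x) ^ 2]
  have hsplit : N * (∑ j, pushWeights e G w j * (inner ℝ (g j) x) ^ 2 - ‖x‖ ^ 2) =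
      (∑ j, (inner ℝ (g j) x) ^ 2 - N * ‖x‖ ^ 2) +
        ∑ j, N * (pushWeights e G w j - 1 / N) * (inner ℝ (g j) x) ^ 2 := by
    have : ∀ j, N * (pushWeights e G w j - 1 / N) * (inner ℝ (g j) x) ^ 2 =
        N * (pushWeights e G w j * (inner ℝ (g j) x) ^ 2) - (inner ℝ (g j) x) ^ 2 := fun j => by
      field_simp
    simp only [this, Finset.sum_sub_distrib, ← Finset.mul_sum]
    ring
  have hdev : |∑ j, N * (pushWeights e G w j - 1 / N) * (inner ℝ (g j) x) ^ 2| ≤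
      ∑ j, N * |pushWeights e G w j - 1 / N| * (inner ℝ (g j) x) ^ 2 := by
    refine (Finset.abs_sum_le_sum_abs _ _).trans (le_of_eq (Finset.sum_congr rfl fun j _ => ?_))
    rw [abs_mul, abs_mul, abs_of_pos hN, abs_of_nonneg (sq_nonneg (inner ℝ (g j) x))]
  have hεℓ : ε ≤ ε * Real.log (1 / ε) := le_mul_of_one_le_right hε.le hℓ
  have hA : a * ε * N * ‖x‖ ^ 2 ≤ a * (ε * Real.log (1 / ε)) * N * ‖x‖ ^ 2 := by gcongr
  refine le_of_mul_le_mul_left ?_ hN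
  calc N * |∑ j, pushWeights e G w j * (inner ℝ (g j) x) ^ 2 - ‖x‖ ^ 2|
      = |N * (∑ j, pushWeights e G w j * (inner ℝ (g j) x) ^ 2 - ‖x‖ ^ 2)| := by
        rw [abs_mul, abs_of_pos hN]
    _ ≤ a * ε * N * ‖x‖ ^ 2 + a * (ε * Real.log (1 / ε)) * N * ‖x‖ ^ 2 := by
        rw [hsplit]
        exact (abs_add_le _ _).trans (add_le_add hsec (hdev.trans htail))
    _ ≤ _ := by linarith

lemma StableSample.abs_sum_weights_le (hst : StableSample a ε g) (ha : 14 ≤ a) (hε : 0 < ε)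
    (hε1 : ε ≤ 1 / 8) (he : Function.Injective e) (hG : (1 - ε) * N ≤ G.card)
    (hw : w ∈ weightSet ι (2 * ε)) (x : EuclideanSpace ℝ (Fin d)) :
    |∑ i ∈ G, w i * inner ℝ (g (e i)) x| ≤ 2 * a * (ε * √(Real.log (1 / ε))) * ‖x‖ := by
  have hℓ := one_le_log_one_div hε hε1
  obtain ⟨hN, -⟩ := weight_le_of_mem_weightSet hε hε1 he hG hw
  obtain ⟨hb1, hb2⟩ := sum_abs_pushWeights_sub_le hε hε1 he hG hw
  set b : Fin N → ℝ := fun j => N * |pushWeights e G w j - 1 / N| with hb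
  have hb0 : ∀ j, 0 ≤ b j := fun j => by positivity
  have htail := hst.tail b (fun j => ⟨hb0 j, hb1 j⟩) hb2 x
  have hfst := hst.first x
  set ℓ := Real.log (1 / ε) with hℓdef
  rw [← sum_pushWeights_mul e G w fun j => inner ℝ (g j) x]
  have hsplit : N * ∑ j, pushWeights e G w j * inner ℝ (g j) x =
      ∑ j, inner ℝ (g j) x + ∑ j, N * (pushWeights e G w j - 1 / N) * inner ℝ (g j) x := by
    rw [Finset.mul_sum, ← Finset.sum_add_distrib]
    refine Finset.sum_congr rfl fun j _ => ?_
    field_simp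
    ring
  have hdev : |∑ j, N * (pushWeights e G w j - 1 / N) * inner ℝ (g j) x| ≤
      ∑ j, b j * |inner ℝ (g j) x| := by
    refine (Finset.abs_sum_le_sum_abs _ _).trans (le_of_eq (Finset.sum_congr rfl fun j _ => ?_))
    rw [abs_mul, abs_mul, abs_of_pos hN]
  -- Cauchy-Schwarz against the small total mass of `b`.
  have hcs : (∑ j, b j * |inner ℝ (g j) x|) ^ 2 ≤
      (∑ j, b j) * ∑ j, b j * (inner ℝ (g j) x) ^ 2 := by
    refine Finset.sum_sq_le_sum_mul_sum_of_sq_le_mul Finset.univ (fun j _ => hb0 j)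
      (fun j _ => mul_nonneg (hb0 j) (sq_nonneg _)) fun j _ => ?_
    rw [mul_pow, sq_abs]
    exact le_of_eq (by ring)
  have hq : √ℓ ^ 2 = ℓ := Real.sq_sqrt (by linarith)
  have hdev2 : ∑ j, b j * |inner ℝ (g j) x| ≤ a * (ε * √ℓ) * N * ‖x‖ := by
    refine le_of_sq_le_sq (hcs.trans ?_) (by positivity)
    calc (∑ j, b j) * ∑ j, b j * (inner ℝ (g j) x) ^ 2
        ≤ (14 * ε * N) * (a * (ε * ℓ) * N * ‖x‖ ^ 2) := by
          refine mul_le_mul hb2 htail (Finset.sum_nonneg fun j _ =>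
            mul_nonneg (hb0 j) (sq_nonneg _)) (by positivity)
      _ ≤ (a * ε * N) * (a * (ε * ℓ) * N * ‖x‖ ^ 2) := by gcongr
      _ = (a * (ε * √ℓ) * N * ‖x‖) ^ 2 := by
          rw [← hq]
          simp only [Real.sqrt_sq (Real.sqrt_nonneg ℓ)]
          ring
  have hsq1 : 1 ≤ √ℓ := Real.one_le_sqrt.2 hℓ
  have hA : a * ε * N * ‖x‖ ≤ a * (ε * √ℓ) * N * ‖x‖ := by
    have : ε ≤ ε * √ℓ := le_mul_of_one_le_right hε.le hsq1
    gcongr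
  refine le_of_mul_le_mul_left ?_ hN
  calc N * |∑ j, pushWeights e G w j * inner ℝ (g j) x|
      = |N * ∑ j, pushWeights e G w j * inner ℝ (g j) x| := by rw [abs_mul, abs_of_pos hN]
    _ ≤ a * ε * N * ‖x‖ + a * (ε * √ℓ) * N * ‖x‖ := by
        rw [hsplit]
        exact (abs_add_le _ _).trans (add_le_add hfst (hdev.trans hdev2))
    _ ≤ _ := by linarith

variable {X : ι → EuclideanSpace ℝ (Fin d)} {μ : EuclideanSpace ℝ (Fin d)}

lemma StableSample.goodMoments (hst : StableSample a ε g) (ha : 0 ≤ a) (hε : 0 < ε)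
    (hε1 : ε ≤ 1 / 8) (he : Function.Injective e) (hG : (1 - ε) * N ≤ G.card)
    (hX : ∀ i ∈ G, X i - μ = g (e i)) :
    GoodMoments ε (2 * a * (ε * Real.log (1 / ε))) X G μ := by
  intro w hw
  have hℓ := one_le_log_one_div hε hε1
  have hherm : (∑ i ∈ G, w i • outer (X i - μ) - 1).IsHermitian := by
    ext p q
    simp [Matrix.sum_apply, outer_eq_outer₂, outer₂_apply, mul_comm, Matrix.one_apply, eq_comm]
  refine specNorm_le_of_abs_inner_frob_outer_le hherm (by positivity) fun x => ?_
  rw [map_sub, inner_sub_left, inner_frob_one_outer]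
  simp only [map_sum, map_smul, sum_inner, real_inner_smul_left, inner_frob_outer_outer]
  rw [Finset.sum_congr rfl fun i hi => by rw [hX i hi]]
  exact hst.abs_sum_weights_sq_sub_le ha hε hε1 he hG hw x

/-- Weighted data `y` with mean `D` and second moment about `1` on `G`: the points of `G` account
for variance `1 - O(ε ℓ)`, so a small total variance leaves little for the points outside `G`, whose
mass is `O(ε)`; by Cauchy-Schwarz they cannot move the mean far. -/
lemma mean_le_of_variance_le {ι : Type} [Fintype ι] [DecidableEq ι] {G : Finset ι} {w y : ι → ℝ}
    {ε ℓ δ κ D : ℝ} (hε : 0 < ε) (hε1 : ε ≤ 1 / 8) (hℓ : 1 ≤ ℓ) (hδ : 0 ≤ δ) (hκ0 : 0 ≤ κ)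
    (hD0 : 0 ≤ D) (hw0 : ∀ i, 0 ≤ w i) (hw1 : ∑ i, w i = 1) (hmean' : ∑ i, w i * y i = D)
    (hvar : ∑ i, w i * (y i - D) ^ 2 ≤ 1 + δ)
    (hsec : |∑ i ∈ G, w i * y i ^ 2 - 1| ≤ κ * (ε * ℓ))
    (hfst : |∑ i ∈ G, w i * y i| ≤ κ * (ε * √ℓ)) (hα : ∑ i ∈ Gᶜ, w i ≤ 2 * ε) :
    D ≤ 6 * (κ + 1) * (√(ε * δ) + ε * √ℓ) := by
  have hα0 : 0 ≤ ∑ i ∈ Gᶜ, w i := Finset.sum_nonneg fun i _ => hw0 i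
  set α := ∑ i ∈ Gᶜ, w i with hαdef
  set m := ∑ i ∈ G, w i * y i with hm
  have hGsum : ∑ i ∈ G, w i = 1 - α := by
    have := Finset.sum_add_sum_compl G fun i => w i
    rw [hw1] at this
    linarith
  have hq : √ℓ ^ 2 = ℓ := Real.sq_sqrt (by linarith)
  have hGvar : 1 - (κ + 2 * κ ^ 2) * (ε * ℓ) ≤ ∑ i ∈ G, w i * (y i - D) ^ 2 := by
    have e : ∑ i ∈ G, w i * (y i - D) ^ 2 =
        ∑ i ∈ G, w i * y i ^ 2 - 2 * D * m + D ^ 2 * (1 - α) := by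
      rw [hm, ← hGsum, Finset.mul_sum, Finset.mul_sum, ← Finset.sum_sub_distrib,
        ← Finset.sum_add_distrib]
      exact Finset.sum_congr rfl fun i _ => by ring
    have h1 := (abs_le.1 hsec).1
    have h2 := (abs_le.1 hfst).2
    have h3 : 2 * D * m ≤ D ^ 2 / 2 + 2 * m ^ 2 := by nlinarith [sq_nonneg (D - 2 * m)]
    have h4 : m ^ 2 ≤ κ ^ 2 * (ε * ℓ) := by
      have h5 := sq_le_sq' (abs_le.1 hfst).1 h2
      have h6 : (κ * (ε * √ℓ)) ^ 2 = κ ^ 2 * (ε * ℓ) * ε := by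
        rw [mul_pow, mul_pow, hq]; ring
      rw [h6] at h5
      exact h5.trans (mul_le_of_le_one_right (by positivity) (by linarith))
    rw [e]
    nlinarith [sq_nonneg D]
  set Q := ∑ i ∈ Gᶜ, w i * (y i - D) ^ 2 with hQ
  have hQle : Q ≤ δ + (κ + 2 * κ ^ 2) * (ε * ℓ) := by
    have := Finset.sum_add_sum_compl G fun i => w i * (y i - D) ^ 2
    linarith
  set P := ∑ i ∈ Gᶜ, w i * (y i - D) with hP
  have hcs : P ^ 2 ≤ α * Q := by
    refine Finset.sum_sq_le_sum_mul_sum_of_sq_le_mul Gᶜ (fun i _ => hw0 i)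
      (fun i _ => mul_nonneg (hw0 i) (sq_nonneg _)) fun i _ => ?_
    exact le_of_eq (by ring)
  have hsqδ : √(ε * δ) ^ 2 = ε * δ := Real.sq_sqrt (by positivity)
  have hPle : P ≤ 2 * √(ε * δ) + (2 * κ + 1) * (ε * √ℓ) := by
    have hR0 : 0 ≤ 2 * √(ε * δ) * ((2 * κ + 1) * (ε * √ℓ)) := by positivity
    have hE : 0 ≤ ε ^ 2 * ℓ := by positivity
    refine le_of_sq_le_sq (hcs.trans ?_) (by positivity)
    have h1 : α * Q ≤ 2 * ε * (δ + (κ + 2 * κ ^ 2) * (ε * ℓ)) :=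
      mul_le_mul hα hQle (Finset.sum_nonneg fun i _ => mul_nonneg (hw0 i) (sq_nonneg _))
        (by positivity)
    have h2 : (ε * √ℓ) ^ 2 = ε ^ 2 * ℓ := by rw [mul_pow, hq]
    have h3 : (2 * √(ε * δ) + (2 * κ + 1) * (ε * √ℓ)) ^ 2 =
        4 * (ε * δ) + (2 * κ + 1) ^ 2 * (ε ^ 2 * ℓ) +
          2 * (2 * √(ε * δ) * ((2 * κ + 1) * (ε * √ℓ))) := by
      rw [← hsqδ, ← h2]
      simp only [Real.sqrt_sq (Real.sqrt_nonneg _)]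
      ring
    have h4 : 0 ≤ ε * δ := by positivity
    rw [h3]
    nlinarith [mul_nonneg hκ0 hE]
  have hDeq : D = m + (P + α * D) := by
    have h1 := Finset.sum_add_sum_compl G fun i => w i * y i
    rw [hmean'] at h1
    have h2 : P + α * D = ∑ i ∈ Gᶜ, w i * y i := by
      rw [hP, hαdef, Finset.sum_mul, ← Finset.sum_add_distrib]
      exact Finset.sum_congr rfl fun i _ => by ring
    rw [h2]
    exact h1.symm
  have hm2 := (abs_le.1 hfst).2
  have hαD : α * D ≤ 1 / 4 * D := by gcongr; linarith
  have hs0 : 0 ≤ √(ε * δ) := Real.sqrt_nonneg _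
  have hs1 : 0 ≤ ε * √ℓ := by positivity
  nlinarith [mul_nonneg hκ0 hs0, mul_nonneg hκ0 hs1]

lemma StableSample.spectralCertificate (hst : StableSample a ε g) (ha : 14 ≤ a) (hε : 0 < ε)
    (hε1 : ε ≤ 1 / 8) (he : Function.Injective e) (hG : (1 - ε) * N ≤ G.card)
    (hX : ∀ i ∈ G, X i - μ = g (e i)) :
    SpectralCertificate ε (6 * (2 * a + 1)) X μ := by
  classical
  intro w hw δ hδ hpsd
  have hℓ := one_le_log_one_div hε hε1
  set ℓ := Real.log (1 / ε) with hℓdef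
  set κ := 2 * a with hκ
  set D := ‖μ - wMean X w‖ with hD
  have hD0 : 0 ≤ D := norm_nonneg _
  rcases eq_or_ne D 0 with hDz | hDne
  · rw [hDz]; positivity
  set x := D⁻¹ • (wMean X w - μ) with hx
  have hDr : ‖wMean X w - μ‖ = D := norm_sub_rev _ _
  have hx1 : ‖x‖ = 1 := by
    rw [hx, norm_smul, norm_inv, Real.norm_eq_abs, abs_of_nonneg hD0, hDr, inv_mul_cancel₀ hDne]
  set y : ι → ℝ := fun i => inner ℝ (X i - μ) x with hy
  have hw0 : ∀ i, 0 ≤ w i := fun i => (hw.2 i).1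
  have hw1 := sum_eq_one_of_mem_weightSet hw
  have hmean : inner ℝ (wMean X w - μ) x = D := by
    rw [hx, real_inner_smul_right, real_inner_self_eq_norm_sq, hDr]
    field_simp
  have hmean' : ∑ i, w i * y i = D := by
    have : wMean X w - μ = ∑ i, w i • (X i - μ) := by
      simp only [smul_sub, Finset.sum_sub_distrib, ← Finset.sum_smul, hw1, one_smul, wMean]
    rw [← hmean, this, sum_inner]
    simp only [real_inner_smul_left, hy]
  -- The total variance in the direction `x`.
  have hvar : ∑ i, w i * (y i - D) ^ 2 ≤ 1 + δ := by
    have h := hpsd.dotProduct_mulVec_nonneg (x : Fin d → ℝ)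
    simp only [star_trivial] at h
    rw [← inner_frob_outer, map_sub, inner_sub_left, map_smul, real_inner_smul_left,
      inner_frob_one_outer, hx1, wCov_eq X w hw1] at h
    simp only [map_sum, map_smul, sum_inner, real_inner_smul_left, inner_frob_outer_outer] at h
    have e : ∀ i, inner ℝ (X i - wMean X w) x = y i - D := fun i => by
      rw [hy, ← hmean, ← inner_sub_left]
      congr 1
      abel
    simp only [e] at h
    linarith
  have hsec : |∑ i ∈ G, w i * y i ^ 2 - 1| ≤ κ * (ε * ℓ) := by
    have h := hst.abs_sum_weights_sq_sub_le (by linarith) hε hε1 he hG hw x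
    rw [hx1, one_pow, mul_one] at h
    rwa [Finset.sum_congr rfl fun i hi => by rw [← hX i hi]] at h
  have hfst : |∑ i ∈ G, w i * y i| ≤ κ * (ε * √ℓ) := by
    have h := hst.abs_sum_weights_le ha hε hε1 he hG hw x
    rw [hx1, mul_one] at h
    rwa [Finset.sum_congr rfl fun i hi => by rw [← hX i hi]] at h
  exact mean_le_of_variance_le hε hε1 hℓ hδ (by rw [hκ]; linarith) hD0 hw0 hw1 hmean' hvar hsec hfst
    (sum_compl_weights_le hε hε1 he hG hw)

end Transfer

/-! ### Preprocessing by the coordinate-wise median -/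

section Preprocessing

variable {d N : ℕ} {ε r R : ℝ} {Z X : Fin N → EuclideanSpace ℝ (Fin d)}
  {m μ : EuclideanSpace ℝ (Fin d)}

/-- A coordinate-wise median of a corrupted sample stays, in every coordinate, within the range of
the true sample, since fewer than half of the points are corrupted. -/
lemma abs_median_sub_le (hN : 0 < N) (hε1 : ε ≤ 1 / 8) (hZ : ∀ i j, |Z i j - μ j| ≤ r)
    {σ : Equiv.Perm (Fin N)} (hσ : (Set.ncard {i | X i ≠ Z (σ i)} : ℝ) ≤ ε * N)
    (hm : IsCoordMedian X m) (j : Fin d) : |m j - μ j| ≤ r := by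
  have hN' : (0 : ℝ) < N := by exact_mod_cast hN
  have key : ∀ S : Set (Fin N), N ≤ 2 * S.ncard → ∃ i ∈ S, X i = Z (σ i) := by
    intro S hS
    by_contra! h
    have h1 : S.ncard ≤ Set.ncard {i | X i ≠ Z (σ i)} :=
      Set.ncard_le_ncard (fun i hi => h i hi) (Set.toFinite _)
    have h2 : (N : ℝ) ≤ 2 * S.ncard := by exact_mod_cast hS
    have h3 : (S.ncard : ℝ) ≤ Set.ncard {i | X i ≠ Z (σ i)} := by exact_mod_cast h1
    nlinarith
  obtain ⟨i, hi, hiZ⟩ := key _ (hm j).1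
  obtain ⟨k, hk, hkZ⟩ := key _ (hm j).2
  have h1 := (abs_le.1 (hZ (σ i) j)).1
  have h2 := (abs_le.1 (hZ (σ k) j)).2
  simp only [Set.mem_ofPred_eq] at hi hk
  rw [hiZ] at hi
  rw [hkZ] at hk
  rw [abs_le]
  constructor <;> linarith

lemma norm_sub_median_le (hr : 0 ≤ r) (hN : 0 < N) (hε1 : ε ≤ 1 / 8)
    (hZ : ∀ i j, |Z i j - μ j| ≤ r)
    {σ : Equiv.Perm (Fin N)} (hσ : (Set.ncard {i | X i ≠ Z (σ i)} : ℝ) ≤ ε * N)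
    (hm : IsCoordMedian X m) (i : Fin N) : ‖Z i - m‖ ≤ √d * (2 * r) := by
  have h := norm_le_sqrt_card_mul (w := Z i - m) (c := 2 * r) (by positivity) fun j => by
    have h1 := abs_median_sub_le hN hε1 hZ hσ hm j
    have h2 := hZ i j
    rw [abs_sub_comm] at h1
    have h3 := abs_add_le (Z i j - μ j) (μ j - m j)
    rw [sub_add_sub_cancel] at h3
    rw [PiLp.sub_apply]
    linarith
  simpa using h

/-- If the true sample is stable and bounded, the preprocessed sample satisfies the deterministic
conditions, the good points being the uncorrupted ones: all of them survive. -/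
lemma exists_good_of_stableSample (hr : 0 ≤ r) (hR : √d * (2 * r) ≤ R) (hN : 0 < N) (hε : 0 < ε)
    (hε1 : ε ≤ 1 / 8) {a : ℝ} (ha : 14 ≤ a) (hZ : ∀ i j, |Z i j - μ j| ≤ r)
    (hst : StableSample a ε fun j => Z j - μ) (hX : IsCorruption ε Z X)
    (hm : IsCoordMedian X m) :
    Nonempty (Kept X m R) ∧ Fintype.card (Kept X m R) ≤ N ∧ ∃ G : Finset (Kept X m R),
      (1 - ε) * Fintype.card (Kept X m R) ≤ G.card ∧
      GoodMoments ε (2 * a * (ε * Real.log (1 / ε))) (preprocess X m R) G (μ - m) ∧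
      SpectralCertificate ε (6 * (2 * a + 1)) (preprocess X m R) (μ - m) := by
  classical
  obtain ⟨σ, hσ⟩ := hX
  have hN' : (0 : ℝ) < N := by exact_mod_cast hN
  have hkeep : ∀ i, X i = Z (σ i) → ‖X i - m‖ ≤ R := fun i hi => by
    rw [hi]
    exact (norm_sub_median_le hr hN hε1 hZ hσ hm _).trans hR
  set G : Finset (Kept X m R) := Finset.univ.filter fun i => X i = Z (σ i) with hGdef
  have hcardG : (1 - ε) * N ≤ G.card := by
    have h1 : Finset.univ.filter (fun i => X i = Z (σ i)) ⊆ G.image Subtype.val := by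
      intro i hi
      have hi' := (Finset.mem_filter.1 hi).2
      exact Finset.mem_image.2 ⟨⟨i, hkeep i hi'⟩, by simp [hGdef, hi'], rfl⟩
    have h2 := (Finset.card_le_card h1).trans Finset.card_image_le
    have h3 := Finset.card_filter_add_card_filter_not (s := (Finset.univ : Finset (Fin N)))
      fun i => X i = Z (σ i)
    rw [Set.ncard_eq_toFinset_card'] at hσ
    have h4 : Set.toFinset {i | X i ≠ Z (σ i)} =
        Finset.univ.filter fun i => ¬ X i = Z (σ i) := by
      ext i; simp
    rw [h4] at hσ
    simp only [Finset.card_univ, Fintype.card_fin] at h3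
    have h5 : ((Finset.univ.filter fun i => X i = Z (σ i)).card : ℝ) +
        (Finset.univ.filter fun i => ¬ X i = Z (σ i)).card = N := by exact_mod_cast h3
    have h6 : ((Finset.univ.filter fun i => X i = Z (σ i)).card : ℝ) ≤ G.card := by
      exact_mod_cast h2
    linarith
  have hGpos : 0 < G.card := by
    have : (0 : ℝ) < G.card := by nlinarith
    exact_mod_cast this
  have hne : Nonempty (Kept X m R) := ⟨(Finset.card_pos.1 hGpos).choose⟩
  have hcard : Fintype.card (Kept X m R) ≤ N := by
    simpa using Fintype.card_subtype_le fun i : Fin N => ‖X i - m‖ ≤ R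
  have he : Function.Injective fun i : Kept X m R => σ i := fun i j hij =>
    Subtype.ext (σ.injective hij)
  have hXG : ∀ i ∈ G, preprocess X m R i - (μ - m) = (fun j => Z j - μ) (σ i) := by
    intro i hi
    have hi' := (Finset.mem_filter.1 hi).2
    simp only [preprocess, hi']
    abel
  refine ⟨hne, hcard, G, le_trans ?_ hcardG, ?_, ?_⟩
  · have : (Fintype.card (Kept X m R) : ℝ) ≤ N := by exact_mod_cast hcard
    have : 0 ≤ 1 - ε := by linarith
    gcongr
  · exact hst.goodMoments (by linarith) hε hε1 he hcardG hXG
  · exact hst.spectralCertificate ha hε hε1 he hcardG hXG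

lemma sum_smul_sub_eq_wMean_preprocess {w : EuclideanSpace ℝ (Kept X m R)}
    (hw : ∑ i, w i = 1) (μ : EuclideanSpace ℝ (Fin d)) :
    ∑ i, w i • X i - μ = wMean (preprocess X m R) w - (μ - m) := by
  simp only [wMean, preprocess, smul_sub, Finset.sum_sub_distrib, ← Finset.sum_smul, hw, one_smul]
  abel

end Preprocessing

/-! ### Concentration of Gaussian samples -/

section GaussianMoments

lemma integral_exp_mul_sq_gaussianReal {t : ℝ} (ht : t < 1 / 2) :
    ∫ x, Real.exp (t * x ^ 2) ∂gaussianReal 0 1 = (√(1 - 2 * t))⁻¹ := by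
  rw [integral_gaussianReal_eq_integral_smul one_ne_zero]
  have h : ∀ x : ℝ, gaussianPDFReal 0 1 x • Real.exp (t * x ^ 2) =
      (√(2 * Real.pi))⁻¹ * Real.exp (-(1 / 2 - t) * x ^ 2) := by
    intro x
    rw [gaussianPDFReal, smul_eq_mul, mul_assoc, ← Real.exp_add]
    simp only [NNReal.coe_one, mul_one, sub_zero]
    congr 2
    ring
  simp_rw [h]
  rw [integral_const_mul, integral_gaussian, ← Real.sqrt_inv, ← Real.sqrt_inv,
    ← Real.sqrt_mul (by positivity)]
  congr 1
  have h1 : (1 / 2 - t) ≠ 0 := by linarith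
  have h2 : (1 - 2 * t) ≠ 0 := by linarith
  have := Real.pi_ne_zero
  field_simp

lemma integrable_exp_mul_sq_gaussianReal {t : ℝ} (ht : t < 1 / 2) :
    Integrable (fun x => Real.exp (t * x ^ 2)) (gaussianReal 0 1) := by
  refine Integrable.of_integral_ne_zero ?_
  rw [integral_exp_mul_sq_gaussianReal ht]
  have : 0 < 1 - 2 * t := by linarith
  positivity

lemma exp_neg_sub_sq_le {u : ℝ} (hu : |u| ≤ 1 / 2) : Real.exp (-(u + u ^ 2)) ≤ 1 - u := by
  rw [abs_le] at hu
  rcases le_total u 0 with h | h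
  · have h1 : |-(u + u ^ 2)| ≤ 1 := by rw [abs_le]; constructor <;> nlinarith
    have h2 := (abs_le.1 (Real.abs_exp_sub_one_sub_id_le h1)).2
    have h3 : (-(u + u ^ 2)) ^ 2 ≤ u ^ 2 := by
      have : (-(u + u ^ 2)) ^ 2 = u ^ 2 * (1 + u) ^ 2 := by ring
      rw [this]
      exact mul_le_of_le_one_right (sq_nonneg u) (by nlinarith)
    linarith
  · have h1 := Real.quadratic_le_exp_of_nonneg (by positivity : 0 ≤ u + u ^ 2)
    rw [Real.exp_neg, inv_le_comm₀ (Real.exp_pos _) (by linarith)]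
    refine le_trans ?_ h1
    rw [inv_le_iff_one_le_mul₀ (by linarith)]
    have h4 : 0 ≤ u ^ 2 * (1 - u - u ^ 2 - u ^ 3) := by
      have : u ^ 2 ≤ 1 / 4 := by nlinarith
      have : u ^ 3 ≤ 1 / 8 := by nlinarith
      exact mul_nonneg (sq_nonneg u) (by linarith)
    nlinarith

/-- The centred chi-square moment generating function. -/
lemma integral_exp_sq_sub_one_le {t : ℝ} (ht : |t| ≤ 1 / 4) :
    ∫ x, Real.exp (t * (x ^ 2 - 1)) ∂gaussianReal 0 1 ≤ Real.exp (2 * t ^ 2) := by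
  have ht' := abs_le.1 ht
  have h : ∀ x : ℝ, Real.exp (t * (x ^ 2 - 1)) = Real.exp (-t) * Real.exp (t * x ^ 2) := fun x => by
    rw [← Real.exp_add]; ring_nf
  simp_rw [h]
  rw [integral_const_mul, integral_exp_mul_sq_gaussianReal (by linarith)]
  have hpos : 0 < √(1 - 2 * t) := Real.sqrt_pos.2 (by linarith)
  have h1 := exp_neg_sub_sq_le (u := 2 * t) (by rw [abs_mul, abs_two]; linarith)
  have h2 : Real.exp (-(t + 2 * t ^ 2)) ≤ √(1 - 2 * t) := by
    refine Real.le_sqrt_of_sq_le (le_trans (le_of_eq ?_) h1)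
    rw [← Real.exp_nat_mul]
    congr 1
    push_cast
    ring
  rw [← div_eq_mul_inv, div_le_iff₀ hpos]
  calc Real.exp (-t) = Real.exp (2 * t ^ 2) * Real.exp (-(t + 2 * t ^ 2)) := by
        rw [← Real.exp_add]; ring_nf
    _ ≤ _ := by gcongr

lemma integrable_exp_sq_sub_one {t : ℝ} (ht : |t| ≤ 1 / 4) :
    Integrable (fun x => Real.exp (t * (x ^ 2 - 1))) (gaussianReal 0 1) := by
  have ht' := abs_le.1 ht
  have h : ∀ x : ℝ, Real.exp (t * (x ^ 2 - 1)) = Real.exp (-t) * Real.exp (t * x ^ 2) := fun x => by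
    rw [← Real.exp_add]; ring_nf
  simp_rw [h]
  exact (integrable_exp_mul_sq_gaussianReal (by linarith)).const_mul _

lemma exp_max_le (x s : ℝ) : Real.exp (max (x ^ 2 - s) 0 / 4) ≤
    1 + Real.exp (-s / 4) * Real.exp (1 / 4 * x ^ 2) := by
  rw [← Real.exp_add]
  rcases le_total (x ^ 2 - s) 0 with h | h
  · rw [max_eq_right h, zero_div, Real.exp_zero]
    linarith [Real.exp_pos (-s / 4 + 1 / 4 * x ^ 2)]
  · rw [max_eq_left h]
    have : (x ^ 2 - s) / 4 = -s / 4 + 1 / 4 * x ^ 2 := by ring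
    rw [this]
    linarith

lemma integrable_exp_max_sq_sub (s : ℝ) :
    Integrable (fun x => Real.exp (max (x ^ 2 - s) 0 / 4)) (gaussianReal 0 1) := by
  have hint : Integrable (fun x : ℝ => 1 + Real.exp (-s / 4) * Real.exp (1 / 4 * x ^ 2))
      (gaussianReal 0 1) :=
    (integrable_const _).add
      ((integrable_exp_mul_sq_gaussianReal (by norm_num)).const_mul _)
  refine hint.mono' (by fun_prop) (Filter.Eventually.of_forall fun x => ?_)
  rw [Real.norm_eq_abs, abs_of_pos (Real.exp_pos _)]
  exact exp_max_le x s

/-- With the threshold `s = 4 ln (1/ε)`, the excess of `x²` over `s` has an exponential moment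
`1 + O(ε)`. -/
lemma integral_exp_max_sq_sub_le {ε : ℝ} (hε : 0 < ε) :
    ∫ x, Real.exp (max (x ^ 2 - 4 * Real.log (1 / ε)) 0 / 4) ∂gaussianReal 0 1 ≤
      Real.exp (2 * ε) := by
  have hint := (integrable_exp_mul_sq_gaussianReal (t := 1 / 4) (by norm_num)).const_mul
    (Real.exp (-(4 * Real.log (1 / ε)) / 4))
  calc _ ≤ ∫ x, (1 + Real.exp (-(4 * Real.log (1 / ε)) / 4) * Real.exp (1 / 4 * x ^ 2))
        ∂gaussianReal 0 1 :=
        integral_mono (integrable_exp_max_sq_sub _) ((integrable_const _).add hint)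
          fun x => exp_max_le x _
    _ = 1 + ε * (√(1 / 2))⁻¹ := by
        rw [integral_add (integrable_const _) hint, integral_const_mul,
          integral_exp_mul_sq_gaussianReal (by norm_num)]
        have : -(4 * Real.log (1 / ε)) / 4 = Real.log ε := by
          rw [one_div, Real.log_inv]; ring
        rw [this, Real.exp_log hε]
        norm_num
    _ ≤ 1 + ε * 2 := by
        have : (1 / 2 : ℝ) ≤ √(1 / 2) := Real.le_sqrt_of_sq_le (by norm_num)
        have : (√(1 / 2))⁻¹ ≤ (2 : ℝ) := by
          rw [inv_le_comm₀ (by positivity) two_pos]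
          simpa using this
        gcongr
    _ ≤ Real.exp (2 * ε) := by linarith [Real.add_one_le_exp (2 * ε)]

end GaussianMoments

section Concentration

/-- The exponential Markov inequality for a sum over independent samples. -/
lemma measureReal_pi_sum_ge_le {E : Type*} [MeasurableSpace E] (P : Measure E)
    [IsProbabilityMeasure P] (N : ℕ) {ψ : E → ℝ} (hint : Integrable (fun z => Real.exp (ψ z)) P)
    {b : ℝ} (hb : ∫ z, Real.exp (ψ z) ∂P ≤ Real.exp b) (t : ℝ) :
    (Measure.pi fun _ : Fin N => P).real {Z | t ≤ ∑ i, ψ (Z i)} ≤ Real.exp (N * b - t) := by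
  have hI : Integrable (fun Z : Fin N → E => ∏ i, Real.exp (ψ (Z i)))
      (Measure.pi fun _ : Fin N => P) := Integrable.fintype_prod fun _ => hint
  have h := mul_meas_ge_le_integral_of_nonneg
    (Filter.Eventually.of_forall fun Z => Finset.prod_nonneg fun i _ => (Real.exp_pos _).le) hI
    (Real.exp t)
  have hprod : ∫ Z : Fin N → E, ∏ i, Real.exp (ψ (Z i)) ∂(Measure.pi fun _ => P) =
      (∫ z, Real.exp (ψ z) ∂P) ^ N := by
    simpa using integral_fintype_prod_eq_pow (ι := Fin N) (𝕜 := ℝ) (fun z => Real.exp (ψ z))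
      (μ := P)
  rw [hprod] at h
  have hset : {Z : Fin N → E | t ≤ ∑ i, ψ (Z i)} =
      {Z | Real.exp t ≤ ∏ i, Real.exp (ψ (Z i))} := by
    ext Z
    simp only [Set.mem_ofPred_eq]
    rw [← Real.exp_sum, Real.exp_le_exp]
  have hpow : (∫ z, Real.exp (ψ z) ∂P) ^ N ≤ Real.exp (N * b) := by
    rw [Real.exp_nat_mul]
    exact pow_le_pow_left₀ (integral_nonneg fun z => (Real.exp_pos _).le) hb N
  rw [hset, Real.exp_sub, le_div_iff₀ (Real.exp_pos t), mul_comm]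
  exact h.trans hpow

variable {d : ℕ}

/-- The one-dimensional marginals of a standard Gaussian vector. -/
lemma map_inner_sub_multivariateGaussian (μ : EuclideanSpace ℝ (Fin d))
    {v : EuclideanSpace ℝ (Fin d)} (hv : ‖v‖ = 1) :
    (multivariateGaussian μ 1).map (fun z => inner ℝ (z - μ) v) = gaussianReal 0 1 := by
  have h1 : multivariateGaussian μ (1 : Matrix (Fin d) (Fin d) ℝ) =
      (stdGaussian (EuclideanSpace ℝ (Fin d))).map fun x => μ + x := by
    simp [multivariateGaussian]
  have hmeas : Measurable fun z : EuclideanSpace ℝ (Fin d) => inner ℝ (z - μ) v := by fun_prop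
  rw [h1, Measure.map_map hmeas (by fun_prop)]
  have h2 : (fun z : EuclideanSpace ℝ (Fin d) => inner ℝ (z - μ) v) ∘ (fun x => μ + x) =
      ⇑(innerSL ℝ v) := by
    ext x
    simp [real_inner_comm]
  rw [h2, IsGaussian.map_eq_gaussianReal, integral_strongDual_stdGaussian,
    variance_dual_stdGaussian, innerSL_apply_norm, hv]
  simp

/-- The exponential Markov inequality for a function of one-dimensional Gaussian marginals. -/
lemma measureReal_pi_gaussian_sum_ge_le (N : ℕ) (μ : EuclideanSpace ℝ (Fin d))
    {v : EuclideanSpace ℝ (Fin d)} (hv : ‖v‖ = 1) {φ : ℝ → ℝ} (hφ : Measurable φ)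
    (hint : Integrable (fun x => Real.exp (φ x)) (gaussianReal 0 1)) {b : ℝ}
    (hb : ∫ x, Real.exp (φ x) ∂gaussianReal 0 1 ≤ Real.exp b) (t : ℝ) :
    (Measure.pi fun _ : Fin N => multivariateGaussian μ 1).real
      {Z | t ≤ ∑ i, φ (inner ℝ (Z i - μ) v)} ≤ Real.exp (N * b - t) := by
  have hmeas : Measurable fun z : EuclideanSpace ℝ (Fin d) => inner ℝ (z - μ) v := by fun_prop
  have hmap := map_inner_sub_multivariateGaussian μ hv
  have hexp : Measurable fun x => Real.exp (φ x) := by fun_prop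
  refine measureReal_pi_sum_ge_le (multivariateGaussian μ 1) N
    (ψ := fun z => φ (inner ℝ (z - μ) v)) ?_ ?_ t
  · rw [← hmap] at hint
    exact hint.comp_measurable hmeas
  · rw [← hmap, integral_map hmeas.aemeasurable hexp.aestronglyMeasurable] at hb
    exact hb

variable (N : ℕ) (μ : EuclideanSpace ℝ (Fin d)) {v : EuclideanSpace ℝ (Fin d)} {ε : ℝ}

lemma measureReal_second_moment_dev_le (hv : ‖v‖ = 1) (hε : 0 < ε) (hε1 : ε ≤ 1) :
    (Measure.pi fun _ : Fin N => multivariateGaussian μ 1).real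
      {Z | ¬ |∑ i, (inner ℝ (Z i - μ) v) ^ 2 - N| ≤ ε * N} ≤
      2 * Real.exp (-(N * ε ^ 2 / 8)) := by
  have hone : ∀ s : ℝ, s = 1 ∨ s = -1 →
      (Measure.pi fun _ : Fin N => multivariateGaussian μ 1).real
        {Z | ε / 4 * (ε * N) ≤ ∑ i, s * (ε / 4) * ((inner ℝ (Z i - μ) v) ^ 2 - 1)} ≤
        Real.exp (-(N * ε ^ 2 / 8)) := by
    intro s hs
    have habs : |s * (ε / 4)| ≤ 1 / 4 := by
      have : |s| = 1 := by rcases hs with rfl | rfl <;> simp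
      rw [abs_mul, this, one_mul, abs_of_pos (by positivity)]
      linarith
    have hs2 : s ^ 2 = 1 := by rcases hs with rfl | rfl <;> norm_num
    refine (measureReal_pi_gaussian_sum_ge_le N μ hv
      (φ := fun x => s * (ε / 4) * (x ^ 2 - 1)) (by fun_prop)
      (integrable_exp_sq_sub_one habs) (integral_exp_sq_sub_one_le habs) _).trans (le_of_eq ?_)
    congr 1
    rw [mul_pow, hs2]
    ring
  refine (measureReal_mono (s₂ := _ ∪ _) ?_ (by finiteness)).trans ((measureReal_union_le _ _).trans
    ((add_le_add (hone 1 (Or.inl rfl)) (hone (-1) (Or.inr rfl))).trans (by linarith)))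
  intro Z hZ
  have hsum : ∀ s : ℝ, ∑ i, s * (ε / 4) * ((inner ℝ (Z i - μ) v) ^ 2 - 1) =
      s * (ε / 4) * (∑ i, (inner ℝ (Z i - μ) v) ^ 2 - N) := by
    intro s
    rw [← Finset.mul_sum, Finset.sum_sub_distrib]
    simp
  simp only [Set.mem_ofPred_eq, not_le] at hZ
  simp only [Set.mem_union, Set.mem_ofPred_eq, hsum]
  rcases lt_abs.1 hZ with h | h
  · left
    rw [one_mul]
    gcongr
  · right
    have := mul_le_mul_of_nonneg_left h.le (by positivity : 0 ≤ ε / 4)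
    linarith

lemma measureReal_first_moment_dev_le (hv : ‖v‖ = 1) (hε : 0 < ε) :
    (Measure.pi fun _ : Fin N => multivariateGaussian μ 1).real
      {Z | ¬ |∑ i, inner ℝ (Z i - μ) v| ≤ ε * N} ≤ 2 * Real.exp (-(N * ε ^ 2 / 8)) := by
  have hone : ∀ s : ℝ, s = 1 ∨ s = -1 →
      (Measure.pi fun _ : Fin N => multivariateGaussian μ 1).real
        {Z | ε * (ε * N) ≤ ∑ i, s * ε * inner ℝ (Z i - μ) v} ≤
        Real.exp (-(N * ε ^ 2 / 8)) := by
    intro s hs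
    have hs2 : s ^ 2 = 1 := by rcases hs with rfl | rfl <;> norm_num
    have hb : ∫ x, Real.exp (s * ε * x) ∂gaussianReal 0 1 ≤ Real.exp (ε ^ 2 / 2) := by
      have h := congrFun (mgf_id_gaussianReal (μ := 0) (v := 1)) (s * ε)
      simp only [mgf, id_eq] at h
      rw [h, mul_pow, hs2]
      simp
    refine (measureReal_pi_gaussian_sum_ge_le N μ hv
      (φ := fun x => s * ε * x) (by fun_prop)
      (integrable_exp_mul_gaussianReal _) hb _).trans (Real.exp_le_exp.2 ?_)
    have : 0 ≤ N * ε ^ 2 := by positivity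
    linarith
  refine (measureReal_mono (s₂ := _ ∪ _) ?_ (by finiteness)).trans ((measureReal_union_le _ _).trans
    ((add_le_add (hone 1 (Or.inl rfl)) (hone (-1) (Or.inr rfl))).trans (by linarith)))
  intro Z hZ
  simp only [Set.mem_ofPred_eq, not_le] at hZ
  simp only [Set.mem_union, Set.mem_ofPred_eq, ← Finset.mul_sum]
  rcases lt_abs.1 hZ with h | h
  · left
    rw [one_mul]
    gcongr
  · right
    have := mul_le_mul_of_nonneg_left h.le hε.le
    linarith

/-- The total excess of the squared marginals over `4 ln (1/ε)` is `O(ε N)`. -/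
lemma measureReal_tail_dev_le (hv : ‖v‖ = 1) (hε : 0 < ε) (hε1 : ε ≤ 1) :
    (Measure.pi fun _ : Fin N => multivariateGaussian μ 1).real
      {Z | ¬ ∑ i, max ((inner ℝ (Z i - μ) v) ^ 2 - 4 * Real.log (1 / ε)) 0 ≤ 12 * ε * N} ≤
      Real.exp (-(N * ε ^ 2 / 8)) := by
  have h := measureReal_pi_gaussian_sum_ge_le N μ hv
    (φ := fun x => max (x ^ 2 - 4 * Real.log (1 / ε)) 0 / 4) (by fun_prop)
    (integrable_exp_max_sq_sub _) (integral_exp_max_sq_sub_le hε) (3 * ε * N)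
  refine (measureReal_mono ?_ (by finiteness)).trans (h.trans (Real.exp_le_exp.2 ?_))
  · intro Z hZ
    simp only [Set.mem_ofPred_eq, not_le] at hZ ⊢
    rw [← Finset.sum_div]
    linarith
  · have h1 : N * ε ^ 2 ≤ N * ε := by
      have : ε ^ 2 ≤ ε := by nlinarith
      gcongr
    have h2 : 0 ≤ N * ε ^ 2 := by positivity
    linarith

lemma measureReal_coord_dev_le (i : Fin N) (j : Fin d) {r : ℝ} (hr : 0 ≤ r) :
    (Measure.pi fun _ : Fin N => multivariateGaussian μ 1).real
      {Z | ¬ |Z i j - μ j| ≤ r} ≤ 2 * Real.exp (-(r ^ 2 / 2)) := by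
  have hmp : MeasurePreserving (Function.eval i)
      (Measure.pi fun _ : Fin N => multivariateGaussian μ 1) (multivariateGaussian μ 1) :=
    measurePreserving_eval _ i
  set v : EuclideanSpace ℝ (Fin d) := EuclideanSpace.single j 1 with hv
  have hv1 : ‖v‖ = 1 := by simp [hv]
  have hinner : ∀ z : EuclideanSpace ℝ (Fin d), inner ℝ (z - μ) v = z j - μ j := fun z => by
    simp [hv, EuclideanSpace.inner_single_right]
  have hmap := map_inner_sub_multivariateGaussian μ hv1
  have hmeas : Measurable fun z : EuclideanSpace ℝ (Fin d) => inner ℝ (z - μ) v := by fun_prop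
  have hone : ∀ s : ℝ, s = 1 ∨ s = -1 →
      (gaussianReal 0 1).real {x | r ≤ s * x} ≤ Real.exp (-(r ^ 2 / 2)) := by
    intro s hs
    have hs2 : s ^ 2 = 1 := by rcases hs with rfl | rfl <;> norm_num
    have hI : Integrable (fun x => Real.exp (r * (s * x))) (gaussianReal 0 1) := by
      simpa [mul_assoc] using integrable_exp_mul_gaussianReal (μ := 0) (v := 1) (r * s)
    have hb := measure_ge_le_exp_mul_mgf (μ := gaussianReal 0 1) (X := fun x => s * x) r hr hI
    refine hb.trans (le_of_eq ?_)
    have h := congrFun (mgf_id_gaussianReal (μ := 0) (v := 1)) (r * s)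
    simp only [mgf, id_eq, ← mul_assoc] at h ⊢
    rw [h, mul_pow, hs2, ← Real.exp_add]
    congr 1
    simp
    ring
  have hset : {Z : Fin N → EuclideanSpace ℝ (Fin d) | ¬ |Z i j - μ j| ≤ r} ⊆
      Function.eval i ⁻¹' ((fun z => inner ℝ (z - μ) v) ⁻¹'
        ({x | r ≤ 1 * x} ∪ {x | r ≤ -1 * x})) := by
    intro Z hZ
    simp only [Set.mem_ofPred_eq, not_le] at hZ
    simp only [Set.mem_preimage, Function.eval, hinner, Set.mem_union, Set.mem_ofPred_eq]
    rcases lt_abs.1 hZ with h | h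
    · left; linarith
    · right; linarith
  have hmS : MeasurableSet ({x : ℝ | r ≤ 1 * x} ∪ {x | r ≤ -1 * x}) :=
    (measurableSet_le (by fun_prop) (by fun_prop)).union
      (measurableSet_le (by fun_prop) (by fun_prop))
  refine (measureReal_mono hset (by finiteness)).trans ?_
  rw [hmp.measureReal_preimage (hmeas hmS).nullMeasurableSet, ← map_measureReal_apply hmeas hmS,
    hmap]
  refine (measureReal_union_le _ _).trans ?_
  linarith [hone 1 (Or.inl rfl), hone (-1) (Or.inr rfl)]

end Concentration

/-! ### The union bound for a Gaussian sample -/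

section GoodEvent

variable {d N : ℕ} {ε τ : ℝ}

/-- The union bound over a net of `5 ^ d` directions, with failure probability `5 exp (-q)` in
each. -/
lemma five_pow_mul_exp_le (hd : 2 ≤ d) (hτ : 0 < τ) (hτ1 : τ < 1) {q : ℝ}
    (hq : 10 * (d + Real.log (1 / τ)) ≤ q) : 5 ^ d * (5 * Real.exp (-q)) ≤ τ / 2 := by
  have hd' : (2 : ℝ) ≤ d := by exact_mod_cast hd
  have hlog : 0 ≤ Real.log (1 / τ) := Real.log_nonneg (by rw [le_div_iff₀ hτ]; linarith)
  have h5 : (5 : ℝ) ≤ Real.exp 2 := by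
    have h : Real.exp 2 = Real.exp 1 ^ 2 := by rw [← Real.exp_nat_mul]; norm_num
    rw [h]
    nlinarith [Real.exp_one_gt_d9]
  have h5d : (5 : ℝ) ^ d ≤ Real.exp (2 * d) := by
    rw [mul_comm, Real.exp_nat_mul]
    gcongr
  have hτe : Real.exp (-Real.log (1 / τ)) = τ := by
    rw [one_div, Real.log_inv, neg_neg, Real.exp_log hτ]
  have hhalf : Real.exp (-1) ≤ 1 / 2 := by
    rw [Real.exp_neg, one_div]
    exact inv_anti₀ two_pos (by linarith [Real.exp_one_gt_d9])
  calc 5 ^ d * (5 * Real.exp (-q)) ≤ Real.exp (2 * d) * (Real.exp 2 * Real.exp (-q)) := by gcongr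
    _ = Real.exp (2 * d + 2 - q) := by rw [← Real.exp_add, ← Real.exp_add]; ring_nf
    _ ≤ Real.exp (-Real.log (1 / τ) + -1) := Real.exp_le_exp.2 (by linarith)
    _ = τ * Real.exp (-1) := by rw [Real.exp_add, hτe]
    _ ≤ τ * (1 / 2) := by gcongr
    _ = τ / 2 := by ring

/-- A Gaussian sample of size `N ≥ 80 (d + ln (1/τ)) / ε²` is, except with probability `τ`, stable
and contained in a cube of side length `O(√(ln (N d / τ)))` around the mean. -/
lemma measureReal_not_stableSample_le (hd : 2 ≤ d) (hε : 0 < ε) (hε1 : ε ≤ 1 / 8) (hτ : 0 < τ)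
    (hτ1 : τ < 1) (hN : 80 * ((d + Real.log (1 / τ)) / ε ^ 2) ≤ N)
    (μ : EuclideanSpace ℝ (Fin d)) :
    (Measure.pi fun _ : Fin N => multivariateGaussian μ 1).real
      {Z | ¬ ((StableSample 2176 ε fun j => Z j - μ) ∧
        ∀ i j, |Z i j - μ j| ≤ 2 * √(Real.log (N * d / τ)))} ≤ τ := by
  have hd' : (2 : ℝ) ≤ d := by exact_mod_cast hd
  have hlog : 0 ≤ Real.log (1 / τ) := Real.log_nonneg (by rw [le_div_iff₀ hτ]; linarith)
  have hq : 10 * (d + Real.log (1 / τ)) ≤ N * ε ^ 2 / 8 := by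
    rw [← mul_div_assoc, div_le_iff₀ (by positivity)] at hN
    linarith
  have hN4 : (4 : ℝ) ≤ N := by
    have : (N : ℝ) * ε ^ 2 ≤ N * 1 := by
      gcongr
      nlinarith
    linarith
  have hNd : 4 ≤ (N : ℝ) * d := by nlinarith
  have hL : 0 < Real.log (N * d / τ) := Real.log_pos (by
    rw [lt_div_iff₀ hτ]; linarith)
  obtain ⟨S, hScard, hS1, hS⟩ := exists_half_net d
  set P := Measure.pi fun _ : Fin N => multivariateGaussian μ (1 : Matrix (Fin d) (Fin d) ℝ)
  set r := 2 * √(Real.log (N * d / τ)) with hr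
  set q := N * ε ^ 2 / 8 with hqdef
  let B : EuclideanSpace ℝ (Fin d) → Set (Fin N → EuclideanSpace ℝ (Fin d)) := fun v =>
    ({Z | ¬ |∑ i, (inner ℝ (Z i - μ) v) ^ 2 - N| ≤ ε * N} ∪
      {Z | ¬ |∑ i, inner ℝ (Z i - μ) v| ≤ ε * N}) ∪
      {Z | ¬ ∑ i, max ((inner ℝ (Z i - μ) v) ^ 2 - 4 * Real.log (1 / ε)) 0 ≤ 12 * ε * N}
  let C : Fin N × Fin d → Set (Fin N → EuclideanSpace ℝ (Fin d)) := fun p =>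
    {Z | ¬ |Z p.1 p.2 - μ p.2| ≤ r}
  have hsub : {Z : Fin N → EuclideanSpace ℝ (Fin d) | ¬ ((StableSample 2176 ε fun j => Z j - μ) ∧
      ∀ i j, |Z i j - μ j| ≤ r)} ⊆
      (⋃ v ∈ S, B v) ∪ ⋃ p ∈ (Finset.univ : Finset (Fin N × Fin d)), C p := by
    intro Z hZ
    by_contra hcon
    simp only [Set.mem_union, Set.mem_iUnion, not_or, not_exists, B, C, Set.mem_ofPred_eq,
      not_not, Finset.mem_univ, true_implies] at hcon
    exact hZ ⟨stableSample_of_half_net hε hε1 hS1 hS (fun v hv => (hcon.1 v hv).1.1)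
      (fun v hv => (hcon.1 v hv).1.2) (fun v hv => (hcon.1 v hv).2),
      fun i j => hcon.2 (i, j)⟩
  have hB : ∀ v ∈ S, P.real (B v) ≤ 5 * Real.exp (-q) := by
    intro v hv
    have h2 := measureReal_second_moment_dev_le N μ (hS1 v hv) hε (by linarith)
    have h1 := measureReal_first_moment_dev_le N μ (hS1 v hv) hε
    have h3 := measureReal_tail_dev_le N μ (hS1 v hv) hε (by linarith)
    refine (measureReal_union_le _ _).trans ((add_le_add ((measureReal_union_le _ _).trans
      (add_le_add h2 h1)) h3).trans (le_of_eq ?_))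
    ring
  have hBsum : P.real (⋃ v ∈ S, B v) ≤ τ / 2 := by
    refine ((measureReal_biUnion_finset_le S B).trans (Finset.sum_le_card_nsmul _ _ _ hB)).trans ?_
    rw [nsmul_eq_mul]
    have : (S.card : ℝ) ≤ 5 ^ d := by exact_mod_cast hScard
    exact (mul_le_mul_of_nonneg_right this (by positivity)).trans (five_pow_mul_exp_le hd hτ hτ1 hq)
  -- As `r² / 2 = 2 ln (N d / τ)`, the `N d` coordinate events cost only `O(τ² / (N d))` in total.
  have hr2 : Real.exp (-(r ^ 2 / 2)) = (τ / (N * d)) ^ 2 := by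
    have : -(r ^ 2 / 2) = (2 : ℕ) * Real.log (τ / (N * d)) := by
      rw [hr, mul_pow, Real.sq_sqrt hL.le, ← inv_div (N * d : ℝ) τ, Real.log_inv]
      push_cast
      ring
    rw [this, Real.exp_nat_mul, Real.exp_log (by positivity)]
  have hCsum : P.real (⋃ p ∈ (Finset.univ : Finset (Fin N × Fin d)), C p) ≤ τ / 2 := by
    refine ((measureReal_biUnion_finset_le _ C).trans (Finset.sum_le_card_nsmul _ _
      (2 * Real.exp (-(r ^ 2 / 2))) fun p _ =>
        measureReal_coord_dev_le N μ p.1 p.2 (by positivity))).trans ?_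
    rw [hr2, nsmul_eq_mul, Finset.card_univ, Fintype.card_prod, Fintype.card_fin, Fintype.card_fin,
      Nat.cast_mul]
    have h : (N * d : ℝ) * (2 * (τ / (N * d)) ^ 2) = 2 * τ * (τ / (N * d)) := by
      field_simp
    rw [h]
    have : τ / (N * d) ≤ 1 / 4 := by
      rw [div_le_div_iff₀ (by positivity) (by norm_num)]
      linarith
    nlinarith
  refine (measureReal_mono hsub (by finiteness)).trans ((measureReal_union_le _ _).trans ?_)
  linarith

end GoodEvent

end

end RobustMean

open RobustMean in
theorem theorem1p3 :
    -- With high probability over an `ε`-corrupted Gaussian sample: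
    (∃ ε₀ > (0 : ℝ), ∃ C > (0 : ℝ), ∃ K₀ > (0 : ℝ), ∃ A > (0 : ℝ), ∃ K₁ > (0 : ℝ),
      ∃ K₂ > (0 : ℝ), ∃ K₃ > (0 : ℝ),
      ∀ (d N : ℕ) (ε τ : ℝ), 2 ≤ d → 0 < ε → ε < ε₀ → 0 < τ → τ < 1 →
      K₀ * ((d + Real.log (1 / τ)) / ε ^ 2) ≤ N →
      ∀ μ : EuclideanSpace ℝ (Fin d),
      (Measure.pi fun _ : Fin N => multivariateGaussian μ 1)
        {Z | ¬ ∀ X, IsCorruption ε Z X → ∀ m, IsCoordMedian X m →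
          ∀ (L R β : ℝ), L = Real.log (N * d / τ) → R = A * √(d * L) →
          β = K₁ * (N * d ^ 2 / ε) * L ^ 3 →
          (weightSet (Kept X m R) (2 * ε)).Nonempty ∧
          SmoothOn (softmaxObj ε (preprocess X m R)) β (weightSet (Kept X m R) (2 * ε)) ∧
          (∀ w ∈ weightSet (Kept X m R) (2 * ε),
            0 ≤ softmaxObj ε (preprocess X m R) w ∧
              softmaxObj ε (preprocess X m R) w ≤ K₂ * d * L) ∧
          ∀ T : ℕ, K₃ * (N * d ^ 3 / ε) * L ^ 4 ≤ T →
            ∀ w, IsPGDOutput (weightSet (Kept X m R) (2 * ε))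
                (softmaxObj ε (preprocess X m R)) (1 / β) T w →
              ‖∑ i, w i • X i - μ‖ ≤ C * (ε * √(Real.log (1 / ε)))}
        ≤ ENNReal.ofReal τ) ∧
    -- For every fixed preprocessed sample that satisfies the deterministic conditions:
    (∀ c₁ > (0 : ℝ), ∀ c₂ > (0 : ℝ),
      ∃ ε₀ > (0 : ℝ), ∃ C > (0 : ℝ), ∃ K₁ > (0 : ℝ), ∃ K₂ > (0 : ℝ), ∃ K₃ > (0 : ℝ),
      ∀ (d : ℕ) (ε Λ : ℝ), 2 ≤ d → 0 < ε → ε < ε₀ → 1 ≤ Λ →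
      ∀ (ι : Type) [Fintype ι] [Nonempty ι] (X : ι → EuclideanSpace ℝ (Fin d)) (G : Finset ι)
        (μ : EuclideanSpace ℝ (Fin d)) (N β : ℝ),
      N = Fintype.card ι → (1 - ε) * N ≤ G.card →
      (∀ i, ‖X i‖ ≤ √(d * Λ)) →
      GoodMoments ε (c₁ * (ε * Real.log (1 / ε))) X G μ →
      SpectralCertificate ε c₂ X μ →
      β = K₁ * (N * d ^ 2 / ε) * (Real.log d * Λ ^ 2) →
      SmoothOn (softmaxObj ε X) β (weightSet ι (2 * ε)) ∧
      (∀ w ∈ weightSet ι (2 * ε), 0 ≤ softmaxObj ε X w ∧ softmaxObj ε X w ≤ K₂ * d * Λ) ∧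
      ∀ T : ℕ, K₃ * (N * d ^ 3 / ε) * (Real.log d * Λ ^ 3) ≤ T →
        ∀ w, IsPGDOutput (weightSet ι (2 * ε)) (softmaxObj ε X) (1 / β) T w →
          ‖wMean X w - μ‖ ≤ C * (ε * √(Real.log (1 / ε)))) := by
  refine ⟨?_, ?_⟩
  · -- A stable sample with `a = 2176` satisfies the deterministic conditions with `c₁ = 2 a` and
    -- `c₂ = 6 (2 a + 1)`. As `R = 4 √(d L) = √(d Λ)` with `Λ = 16 L`, the constants of the
    -- deterministic case are multiplied by powers of `16`: `5120 = 20 * 16²`, `32 = 2 * 16` and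
    -- `81920 = 20 * 16³`.
    refine ⟨min (1 / 8) (1 / (8 * (6 * (2 * 2176 + 1)) ^ 2)), by positivity,
      errorConst (2 * 2176) (6 * (2 * 2176 + 1)), errorConst_pos (by norm_num), 80, by norm_num,
      4, by norm_num, 5120, by norm_num, 32, by norm_num, 81920, by norm_num, ?_⟩
    intro d N ε τ hd hε hε0 hτ hτ1 hN μ
    have hε1 : ε ≤ 1 / 8 := (lt_min_iff.1 hε0).1.le
    -- The bad event need not be measurable; it is contained in the complement of a good event.
    have hgood := measureReal_not_stableSample_le hd hε hε1 hτ hτ1 hN μ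
    rw [measureReal_def, ← ENNReal.le_ofReal_iff_toReal_le (by finiteness) hτ.le] at hgood
    refine (measure_mono ?_).trans hgood
    intro Z hZ hgoodZ
    refine hZ ?_
    obtain ⟨hst, hcube⟩ := hgoodZ
    intro X hX m hm L R β hL hR hβ
    have hd' : (2 : ℝ) ≤ d := by exact_mod_cast hd
    have hlog : 0 ≤ Real.log (1 / τ) := Real.log_nonneg (by rw [le_div_iff₀ hτ]; linarith)
    have hN3 : (3 : ℝ) ≤ N := by
      refine le_trans ?_ hN
      have h : d + Real.log (1 / τ) ≤ (d + Real.log (1 / τ)) / ε ^ 2 := by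
        rw [le_div_iff₀ (by positivity)]
        exact mul_le_of_le_one_right (by positivity) (by nlinarith)
      linarith
    have hdN : (d : ℝ) ≤ N * d / τ ∧ 3 ≤ N * d / τ := by
      constructor <;> rw [le_div_iff₀ hτ] <;> nlinarith
    have hlogd : Real.log d ≤ L := by
      rw [hL]
      exact Real.log_le_log (by linarith) hdN.1
    have hL1 : 1 ≤ L := by
      rw [hL, Real.le_log_iff_exp_le (by linarith)]
      linarith [Real.exp_one_lt_d9]
    have hRΛ : R = √(d * (16 * L)) := by
      have h : d * (16 * L) = 4 ^ 2 * (d * L) := by ring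
      rw [hR, h, Real.sqrt_mul (sq_nonneg 4), Real.sqrt_sq (by norm_num)]
    have hRr : √d * (2 * (2 * √L)) ≤ R := by
      rw [hR, Real.sqrt_mul (by linarith)]
      exact le_of_eq (by ring)
    rw [← hL] at hcube
    have hN0 : 0 < N := by
      have : (0 : ℝ) < N := by linarith
      exact_mod_cast this
    obtain ⟨hne, hcard, G, hG, hmom, hcert⟩ := exists_good_of_stableSample (by positivity) hRr hN0
      hε hε1 (by norm_num) hcube hst hX hm
    have hcard' : (Fintype.card (Kept X m R) : ℝ) ≤ N := by exact_mod_cast hcard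
    have hΛ : 1 ≤ 16 * L := by linarith
    have hXb : ∀ i, ‖preprocess X m R i‖ ≤ √(d * (16 * L)) := fun i => i.2.trans_eq hRΛ
    have hlogd0 : 0 ≤ Real.log d := Real.log_nonneg (by linarith)
    have hβ' : 20 * (Fintype.card (Kept X m R) * d ^ 2 / ε) * (Real.log d * (16 * L) ^ 2) ≤ β := by
      calc _ ≤ 20 * (N * d ^ 2 / ε) * (L * (16 * L) ^ 2) := by gcongr
        _ = β := by rw [hβ]; ring
    refine ⟨⟨_, unifWeights_mem_weightSet (G := G) (by linarith) (le_trans ?_ hG)⟩,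
      smoothOn_softmaxObj hd hε (by linarith) hΛ hXb hβ', fun w hw => ?_, fun T hT w hw => ?_⟩
    · gcongr
      linarith
    · refine (softmaxObj_nonneg_and_le hd hε (by linarith) hΛ hXb hw).imp_right fun h =>
        h.trans_eq ?_
      ring
    · have hT' : β * (d * (16 * L)) ≤ T := by
        refine le_trans (le_of_eq ?_) hT
        rw [hβ]
        ring
      obtain ⟨hwK, hbound⟩ := IsPGDOutput.norm_wMean_sub_le (w := w) hd hε (by norm_num)
        (by norm_num) hε0 hΛ hXb hG hmom hcert hβ' hT' hw
      rwa [sum_smul_sub_eq_wMean_preprocess (sum_eq_one_of_mem_weightSet hwK)]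
  · intro c₁ hc₁ c₂ hc₂
    refine ⟨min (1 / 8) (1 / (8 * c₂ ^ 2)), by positivity, errorConst c₁ c₂, errorConst_pos hc₂,
      20, by norm_num, 2, by norm_num, 20, by norm_num, ?_⟩
    intro d ε Λ hd hε hε0 hΛ ι _ _ X G μ N β hN hG hX hmom hcert hβ
    have hε1 : ε ≤ 1 / 8 := (lt_min_iff.1 hε0).1.le
    subst hN
    refine ⟨smoothOn_softmaxObj hd hε (by linarith) hΛ hX hβ.ge,
      fun w hw => softmaxObj_nonneg_and_le hd hε (by linarith) hΛ hX hw, fun T hT w hw => ?_⟩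
    refine (IsPGDOutput.norm_wMean_sub_le (w := w) hd hε hc₁ hc₂ hε0 hΛ hX hG hmom hcert hβ.ge
      (le_trans (le_of_eq ?_) hT) hw).2
    rw [hβ]
    ring
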